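/- A clustering of a set $V$ of $n$ points is a partition of $V$. For a fairness constraint $\mathcal P$ (an arbitrary predicate on subsets of $V$), a clustering is *fair* if each of its clusters satisfies $\mathcal P$. Let $\mathrm{dist}(\mathcal C,\mathcal D)$ be the number of unordered pairs of points that are together in exactly one of $\mathcal C,\mathcal D$. A fair clustering $\mathcal N$ is *$\gamma$-close* to a clustering $\mathcal D$ if $\mathrm{dist}(\mathcal D,\mathcal N)\le\gamma\,\mathrm{dist}(\mathcal D,\mathcal N^*)$ for a fair clustering $\mathcal N^*$ closest to $\mathcal D$. An *$\eta$-approximate fair correlation clustering* of a complete graph on $V$ with edges labelled $+$ or $-$ is a fair clustering whose cost (number of $+$ pairs separated plus number of $-$ pairs together) is at most $\eta$ times the minimum cost of a fair clustering. A *$(\rho,1)$-approximate fair consensus clustering* of $\mathcal C_1,\dots,\mathcal C_m$ is a fair clustering $\mathcal F$ for which $\sum_i \mathrm{dist}(\mathcal C_i,\mathcal F)$ is at most $\rho$ times the minimum of this sum over fair clusterings. In the *generalized insertion-only stream*, the input clusterings arrive as triples $((u,v),j,b)$, in arbitrary order, where $b\in\{0,1\}$ says whether $u,v$ are together ($b=0$)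 or separated ($b=1$) in $\mathcal C_j$; for each $j$ all pairs of points occur. **Lemma.** Let $\gamma,\eta,\alpha>0$, $0<\beta<1$, $c>1$, $s>1$ and $g>s$ be fixed with $sc-s-2c>0$. Suppose that there is a subroutine that computes a $\gamma$-close fair clustering to any given clustering of $n$ points in time $t_1(n)$, and a subroutine that computes an $\eta$-approximate fair correlation clustering of any labelled complete graph on $n$ vertices in time $t_2(n)$. Then there is a randomized one-pass streaming algorithm, using these subroutines as black boxes, which for all $n\ge1$, $m\ge2$, $\varepsilon\in(0,1)$ and any $m$ clusterings of $n$ points given by a generalized insertion-only stream outputs, with probability at least $1-\frac1m$, a $\left(\frac{1+\varepsilon}{1-\varepsilon}\,r,\,1\right)$-approximate fair consensus clustering, where \begin{align*} r=\max\Bigl\{&\gamma+2-(\gamma+1)\beta,\quad \gamma+2+(\gamma+1)\tfrac{\beta(g-s)+s}{g(s-1)}-\tfrac{2\alpha}{c},\\ &\gamma+2+(\gamma+1)\tfrac{\beta(g(2c+s)-sc)+sc}{g(cs-s-2c)}-2\bigl(1-\tfrac1s-\tfrac1c\bigr)\alpha,\quad 1+3(\eta+1)\alpha\Bigr\}. \end{align*}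 On a word RAM with words of $O(\log(n+m+1/\varepsilon))$ bits, which is given $n$, $m$ and $\lceil 1/\varepsilon\rceil$, the algorithm uses $O(\varepsilon^{-2}n\log m)$ words of space (the subroutines' argument tape, own work space and the output tape not counted), and its running time outside the pass over the stream is $$O\bigl(\varepsilon^{-2}n^2\log^4m+t_1(n)\log m+t_2(n)\log^3m\bigr);$$ each triple of the stream is processed in time $O(\varepsilon^{-2}\log m)$. The $O$-constants and the algorithm depend only on $\gamma,\eta,\alpha,\beta,c,s,g$. In particular, for fixed $\varepsilon$ the space is $O(n\log m)$ and the running time is $O(n^2\log^4m+t_1(n)\log m+t_2(n)\log^3m)$. -/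

import Mathlib

open MeasureTheory

/-! ### Clusterings

A clustering of the `n` points `0, …, n-1` is an equivalence relation; its clusters are the
equivalence classes.  A fairness constraint is an arbitrary predicate on clusters. -/

namespace FairConsensus

abbrev Clustering (n : ℕ) : Type := Setoid (Fin n)

/-- A clustering is fair if each of its clusters satisfies the constraint `P`. -/
def IsFair {n : ℕ} (P : Set (Fin n) → Prop) (C : Clustering n) : Prop :=
  ∀ F ∈ C.classes, P F

open Classical in
/-- The number of unordered pairs of points that are together in exactly one of `C`, `D`. -/
noncomputable def dist {n : ℕ} (C D : Clustering n) : ℕ :=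
  (Finset.univ.filter fun p : Fin n × Fin n =>
    p.1 < p.2 ∧ ¬ (C.r p.1 p.2 ↔ D.r p.1 p.2)).card

/-- `N` is a closest fair clustering to `D`. -/
def IsClosestFair {n : ℕ} (P : Set (Fin n) → Prop) (D N : Clustering n) : Prop :=
  IsFair P N ∧ ∀ N' : Clustering n, IsFair P N' → dist D N ≤ dist D N'

/-- `N` is a `γ`-close fair clustering to `D`. -/
def IsCloseFair {n : ℕ} (P : Set (Fin n) → Prop) (γ : ℝ) (D N : Clustering n) : Prop :=
  IsFair P N ∧ ∀ N' : Clustering n, IsClosestFair P D N' → (dist D N : ℝ) ≤ γ * dist D N'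

open Classical in
/-- The correlation cost of `C` on the complete signed graph whose `+` edges are the edges of `G`
and whose `-` edges are the other pairs of distinct vertices. -/
noncomputable def corCost {n : ℕ} (G : SimpleGraph (Fin n)) (C : Clustering n) : ℕ :=
  (Finset.univ.filter fun p : Fin n × Fin n =>
    p.1 < p.2 ∧ ¬ (G.Adj p.1 p.2 ↔ C.r p.1 p.2)).card

/-- `C` is an optimal fair correlation clustering of `G`. -/
def IsOptFairCor {n : ℕ} (P : Set (Fin n) → Prop) (G : SimpleGraph (Fin n))
    (C : Clustering n) : Prop :=
  IsFair P C ∧ ∀ D : Clustering n, IsFair P D → corCost G C ≤ corCost G D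

/-- `C` is an `η`-approximate fair correlation clustering of `G`. -/
def IsApproxFairCor {n : ℕ} (P : Set (Fin n) → Prop) (η : ℝ) (G : SimpleGraph (Fin n))
    (C : Clustering n) : Prop :=
  IsFair P C ∧ ∀ D : Clustering n, IsOptFairCor P G D → (corCost G C : ℝ) ≤ η * corCost G D

/-- The median objective. -/
noncomputable def obj {n m : ℕ} (I : Fin m → Clustering n) (C : Clustering n) : ℕ :=
  ∑ i, dist (I i) C

/-- `C` is an optimal fair consensus clustering of `I`. -/
def IsOptConsensus {n m : ℕ} (P : Set (Fin n) → Prop) (I : Fin m → Clustering n)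
    (C : Clustering n) : Prop :=
  IsFair P C ∧ ∀ D : Clustering n, IsFair P D → obj I C ≤ obj I D

/-- `C` is a `(ρ, 1)`-approximate fair consensus clustering of `I`. -/
def IsApproxConsensus {n m : ℕ} (P : Set (Fin n) → Prop) (ρ : ℝ) (I : Fin m → Clustering n)
    (C : Clustering n) : Prop :=
  IsFair P C ∧ ∀ D : Clustering n, IsOptConsensus P I D → (obj I C : ℝ) ≤ ρ * obj I D

/-! ### Generalized insertion-only streams -/

/-- A triple `((u, v), j, b)`: `sep = false` (`b = 0`) says that `u` and `v` are together in the
`j`-th clustering, `sep = true` (`b = 1`) that they are separated. -/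
structure Triple (n m : ℕ) where
  u : Fin n
  v : Fin n
  j : Fin m
  sep : Bool

/-- `l` is a generalized insertion-only stream for the clusterings `I`: every triple is correct,
and for each clustering every pair of distinct points occurs, in at least one of its two
orientations.  The order is arbitrary; the stream may list each unordered pair once, or all `n²`
ordered pairs. -/
def IsStream {n m : ℕ} (I : Fin m → Clustering n) (l : List (Triple n m)) : Prop :=
  (∀ x ∈ l, x.sep = false ↔ (I x.j).r x.u x.v) ∧
  ∀ (j : Fin m) (u v : Fin n), u ≠ v →
    ∃ x ∈ l, x.j = j ∧ ((x.u = u ∧ x.v = v) ∨ (x.u = v ∧ x.v = u))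

/-! ### The machine model

A randomized word RAM with structured control flow and with two subroutines that are called as
black boxes.  Every elementary instruction costs one time unit.  Space is the number of memory
words used (one plus the largest address written); arguments for a subroutine are written on a
write-only tape, results are delivered into the memory.  The fields `time`, `space` and `top` of a
state are counters that a program cannot read. -/

/-- The random source: entry `(i, b)` is used if the `i`-th random draw of a run asks for a uniform
element of `{0, …, b}`. -/
abbrev Coins : Type := (p : ℕ × ℕ) → Fin (p.2 + 1)

/-- All entries of the random source are independent and uniform. -/
noncomputable def coinMeasure : Measure Coins :=
  Measure.infinitePi fun p : ℕ × ℕ => (PMF.uniformOfFintype (Fin (p.2 + 1))).toMeasure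

/-- A subroutine: its answer and its running time on each argument. -/
structure Subroutine where
  answer : List ℕ → List ℕ
  cost : List ℕ → ℕ

/-- What a program is run with: the random source, a subroutine for closest fair clustering, and
one for fair correlation clustering. -/
structure Env where
  coins : Coins
  cls : Subroutine
  cor : Subroutine

structure State where
  /-- memory: address to word -/
  mem : ℕ → ℕ
  /-- the argument tape -/
  arg : List ℕ
  /-- the output tape -/
  out : List ℕ
  /-- number of random draws so far -/
  draws : ℕ
  /-- time used so far -/
  time : ℕ
  /-- one plus the largest address written so far -/
  space : ℕ
  /-- the largest word written so far -/
  top : ℕ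

namespace State

def empty : State := ⟨fun _ => 0, [], [], 0, 0, 0, 0⟩

/-- Spend `k` time units. -/
def spend (k : ℕ) (σ : State) : State := { σ with time := σ.time + k }

/-- Write the word `x` at address `a`. -/
def put (a x : ℕ) (σ : State) : State :=
  { σ with
    mem := Function.update σ.mem a x
    space := max σ.space (a + 1)
    top := max σ.top x }

/-- Write a list of words at consecutive addresses, starting from `a`. -/
def putList : ℕ → List ℕ → State → State
  | _, [], σ => σ
  | a, x :: xs, σ => putList (a + 1) xs (σ.put a x)

/-- Call a subroutine on the argument tape, clear the tape, and store the answer from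
address `a` on.  Writing the answer is charged as well. -/
def call (S : Subroutine) (a : ℕ) (σ : State) : State :=
  (putList a (S.answer σ.arg) { σ with arg := [] }).spend
    (1 + S.cost σ.arg + (S.answer σ.arg).length)

end State

inductive Op where
  | add | sub | mul | div | mod

def Op.eval : Op → ℕ → ℕ → ℕ
  | add, x, y => x + y
  | sub, x, y => x - y
  | mul, x, y => x * y
  | div, x, y => x / y
  | mod, x, y => x % y

/-- Programs. `M` stands for the memory; the arguments `d`, `a`, `b` are fixed addresses. -/
inductive Prog where
  /-- `M[d] := k` -/
  | const (d k : ℕ)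
  /-- `M[d] := M[a] ∘ M[b]` -/
  | op (o : Op) (d a b : ℕ)
  /-- `M[d] :=` the length of the binary expansion of `M[a]` -/
  | size (d a : ℕ)
  /-- `M[d] := M[M[a]]` -/
  | load (d a : ℕ)
  /-- `M[M[a]] := M[b]` -/
  | store (a b : ℕ)
  /-- `M[d] :=` a uniformly random element of `{0, …, M[a] - 1}` -/
  | rand (d a : ℕ)
  /-- append `M[a]` to the argument tape -/
  | push (a : ℕ)
  /-- call the closest fair clustering subroutine, answer stored from address `M[a]` on -/
  | callCls (a : ℕ)
  /-- call the fair correlation clustering subroutine, answer stored from address `M[a]` on -/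
  | callCor (a : ℕ)
  /-- append `M[a]` to the output tape -/
  | emit (a : ℕ)
  | skip
  | seq (p q : Prog)
  /-- run `p` if `M[a] = 0`, and `q` otherwise -/
  | ifZero (a : ℕ) (p q : Prog)
  /-- run `p` as often as `M[a]` says at the start of the loop -/
  | loop (a : ℕ) (p : Prog)

/-- The state after running a program. -/
def Prog.run (E : Env) : Prog → State → State
  | const d k, σ => (σ.put d k).spend 1
  | op o d a b, σ => (σ.put d (o.eval (σ.mem a) (σ.mem b))).spend 1
  | size d a, σ => (σ.put d (Nat.size (σ.mem a))).spend 1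
  | load d a, σ => (σ.put d (σ.mem (σ.mem a))).spend 1
  | store a b, σ => (σ.put (σ.mem a) (σ.mem b)).spend 1
  | rand d a, σ =>
      { (σ.put d (E.coins (σ.draws, σ.mem a - 1) : ℕ)).spend 1 with draws := σ.draws + 1 }
  | push a, σ => { σ.spend 1 with arg := σ.arg ++ [σ.mem a] }
  | callCls a, σ => σ.call E.cls (σ.mem a)
  | callCor a, σ => σ.call E.cor (σ.mem a)
  | emit a, σ => { σ.spend 1 with out := σ.out ++ [σ.mem a] }
  | skip, σ => σ.spend 1
  | seq p q, σ => q.run E (p.run E σ)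
  | ifZero a p q, σ => if σ.mem a = 0 then p.run E (σ.spend 1) else q.run E (σ.spend 1)
  | loop a p, σ => (fun τ => (p.run E τ).spend 1)^[σ.mem a] (σ.spend 1)

/-- A one-pass streaming algorithm: a program run before the stream, a program run on each
arriving triple, and a program run after the stream. -/
structure StreamAlg where
  init : Prog
  update : Prog
  query : Prog

namespace StreamAlg

/-- The state after the initialization.  The words `n`, `m`, `e` are given in the cells 0, 1, 2. -/
def start (A : StreamAlg) (E : Env) (n m e : ℕ) : State :=
  A.init.run E (((State.empty.put 0 n).put 1 m).put 2 e)

/-- Processing one triple; it is delivered in the cells 3, 4, 5, 6. -/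
def step {n m : ℕ} (A : StreamAlg) (E : Env) (σ : State) (x : Triple n m) : State :=
  A.update.run E
    ((((σ.put 3 x.u).put 4 x.v).put 5 x.j).put 6 (if x.sep then 1 else 0))

/-- The state after the initialization and the triples of `l`. -/
def after {n m : ℕ} (A : StreamAlg) (E : Env) (e : ℕ) (l : List (Triple n m)) : State :=
  l.foldl (A.step E) (A.start E n m e)

/-- The state at the end. -/
def final {n m : ℕ} (A : StreamAlg) (E : Env) (e : ℕ) (l : List (Triple n m)) : State :=
  A.query.run E (A.after E e l)

end StreamAlg

/-! ### Encodings -/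

/-- The list `L` of `n` labels smaller than `n` represents `C`: two points are together if and only
if they have the same label. -/
def Represents {n : ℕ} (L : List ℕ) (C : Clustering n) : Prop :=
  L.length = n ∧ (∀ x ∈ L, x < n) ∧ ∀ u v : Fin n, C.r u v ↔ L.getD u 0 = L.getD v 0

open Classical in
/-- The adjacency matrix of `G`, row by row. -/
noncomputable def matrixWord {n : ℕ} (G : SimpleGraph (Fin n)) : List ℕ :=
  (List.finRange n).flatMap fun u => (List.finRange n).map fun v => if G.Adj u v then 1 else 0

/-- `S` computes, in time at most `t`, a `γ`-close fair clustering to each clustering of `n`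
points. -/
def SolvesClosestFair {n : ℕ} (P : Set (Fin n) → Prop) (γ : ℝ) (t : ℕ) (S : Subroutine) : Prop :=
  ∀ (D : Clustering n) (L : List ℕ), Represents L D →
    S.cost L ≤ t ∧ ∃ N : Clustering n, Represents (S.answer L) N ∧ IsCloseFair P γ D N

/-- `S` computes, in time at most `t`, an `η`-approximate fair correlation clustering of each
complete signed graph on `n` vertices. -/
def SolvesFairCor {n : ℕ} (P : Set (Fin n) → Prop) (η : ℝ) (t : ℕ) (S : Subroutine) : Prop :=
  ∀ G : SimpleGraph (Fin n),
    S.cost (matrixWord G) ≤ t ∧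
      ∃ C : Clustering n, Represents (S.answer (matrixWord G)) C ∧ IsApproxFairCor P η G C

/-- The ratio of the main result. -/
noncomputable def ratio (γ η α β c s g : ℝ) : ℝ :=
  max (max (γ + 2 - (γ + 1) * β)
        (γ + 2 + (γ + 1) * ((β * (g - s) + s) / (g * (s - 1))) - 2 * α / c))
    (max (γ + 2 + (γ + 1) * ((β * (g * (2 * c + s) - s * c) + s * c) / (g * (c * s - s - 2 * c)))
          - 2 * (1 - 1 / s - 1 / c) * α)
      (1 + 3 * (η + 1) * α))

end FairConsensus

/-! Fix an optimal fair clustering N, let d_i be the distance from the i-th input to N, and let a =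
obj(N)/m be the mean of the d_i. The overlap of two inputs is the number of pairs on which both
deviate from N. A γ-close fair clustering of the i-th input has objective at most obj(N) +
(γ+1)·m·d_i − 2·(sum of its overlaps with all inputs), by `obj_le_of_close`. Such a candidate can
thus miss the ratio r only if d_i is not small and few inputs overlap heavily with input i.

Suppose that only few inputs yield a good candidate in this way. Then few d_i lie below (1−β)a, so
by averaging many lie only moderately above a (`le_card_filter_le`). Among those that fail, each has
few inputs with overlap above αa. This leaves room for three inputs with pairwise overlaps at most
αa. Their majority graph has correlation cost at most 3αa against N, so an η-approximate correlation
clustering of it has objective at most (1+3(η+1)α)·obj(N) (`obj_le_of_majority`). The four terms of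
`ratio` are what these steps consume.

`exists_family` puts this in a form fit for sampling: at most 3m² sets of at least pm indices each,
with p = min(1/g, 1/(2s)), such that any index set that meets all of them yields a good candidate.
The sets are listed for every possible choice of the earlier indices, so a union bound replaces
conditioning, and S = O(log m) uniform draws meet all of them with high probability. Candidates are
compared by their cost on T = S·⌈1/ε⌉² draws. If obj(F) > (1+2ε)·obj(F'), then the difference of the
distances to F' and to F, divided by `dist F F'`, is bounded by 1 and has mean at most −ε/2, so an
exponential moment bound applies (`measure_sample_le`). The union bound runs over pairs of the m +
m³ conceivable candidates. These are fixed before the draws, which may therefore serve both for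
building candidates and for comparing them (`measure_good_sample`).

In the stream, each sampled clustering keeps one label per point, and each triple that reports u and
v together lowers the label of u to at most v and that of v to at most u. Every pair occurs, so each
label ends as the least point of its cluster, whatever the order (`LabInv.eq_minLabel`). The
judgement `Run` carries correctness, time, space and word size through the program together. -/

namespace FairConsensus

/-! ### Distances and costs -/

section Combinatorics

variable {n m : ℕ}

open Classical in
/-- The pairs on which two clusterings disagree. -/
noncomputable def disagree (C D : Clustering n) : Finset (Fin n × Fin n) :=
  Finset.univ.filter fun p => p.1 < p.2 ∧ ¬ (C.r p.1 p.2 ↔ D.r p.1 p.2)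

theorem mem_disagree {C D : Clustering n} {p : Fin n × Fin n} :
    p ∈ disagree C D ↔ p.1 < p.2 ∧ ¬ (C.r p.1 p.2 ↔ D.r p.1 p.2) := by
  classical
  simp [disagree]

theorem card_disagree (C D : Clustering n) : (disagree C D).card = dist C D := rfl

theorem dist_comm (C D : Clustering n) : dist C D = dist D C := by
  rw [← card_disagree, ← card_disagree]
  congr 1
  ext p
  rw [mem_disagree, mem_disagree]
  tauto

theorem dist_triangle (C D F : Clustering n) : dist C F ≤ dist C D + dist D F := by
  classical
  simp only [← card_disagree]
  refine (Finset.card_le_card ?_).trans (Finset.card_union_le _ _)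
  intro p
  rw [Finset.mem_union, mem_disagree, mem_disagree, mem_disagree]
  tauto

open Classical in
/-- The number of pairs on which both `C` and `D` disagree with `N`. -/
noncomputable def overlap (N C D : Clustering n) : ℕ := (disagree C N ∩ disagree D N).card

/-- Where two clusterings both deviate from a third one, they agree with each other. So `disagree C
D` lies in the symmetric difference of the two sets of deviations from `N`. -/
theorem dist_add_overlap_le (N C D : Clustering n) :
    dist C D + 2 * overlap N C D ≤ dist C N + dist D N := by
  classical
  have h1 := Finset.card_sdiff_add_card_inter (disagree C N) (disagree D N)
  have h2 := Finset.card_sdiff_add_card_inter (disagree D N) (disagree C N)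
  have h3 : (disagree C D).card ≤
      (disagree C N \ disagree D N).card + (disagree D N \ disagree C N).card := by
    refine (Finset.card_le_card ?_).trans (Finset.card_union_le _ _)
    intro p
    simp only [Finset.mem_union, Finset.mem_sdiff, mem_disagree]
    tauto
  rw [Finset.inter_comm] at h2
  simp only [overlap, ← card_disagree]
  omega

/-- The graph of the pairs that are together in at least two of three clusterings. -/
def majority (A B C : Clustering n) : SimpleGraph (Fin n) where
  Adj u v := u ≠ v ∧ ((A.r u v ∧ B.r u v) ∨ (A.r u v ∧ C.r u v) ∨ (B.r u v ∧ C.r u v))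
  symm := ⟨by
    rintro u v ⟨h, h'⟩
    refine ⟨h.symm, ?_⟩
    rcases h' with ⟨a, b⟩ | ⟨a, b⟩ | ⟨a, b⟩
    · exact Or.inl ⟨A.symm' a, B.symm' b⟩
    · exact Or.inr (Or.inl ⟨A.symm' a, C.symm' b⟩)
    · exact Or.inr (Or.inr ⟨B.symm' a, C.symm' b⟩)⟩
  loopless := ⟨fun _ h => h.1 rfl⟩

/-- A vote of three differs from `N` only where at least two of the voters do. -/
theorem corCost_majority_le (N A B C : Clustering n) :
    corCost (majority A B C) N ≤ overlap N A B + overlap N A C + overlap N B C := by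
  classical
  unfold corCost overlap
  refine (Finset.card_le_card ?_).trans ((Finset.card_union_le _ _).trans
    (Nat.add_le_add_right (Finset.card_union_le _ _) _))
  intro p hp
  obtain ⟨-, h, h'⟩ := Finset.mem_filter.1 hp
  have hne : p.1 ≠ p.2 := h.ne
  simp only [Finset.mem_union, Finset.mem_inter, mem_disagree]
  simp only [majority] at h'
  tauto

theorem dist_le_corCost_add (G : SimpleGraph (Fin n)) (C D : Clustering n) :
    dist C D ≤ corCost G C + corCost G D := by
  classical
  unfold corCost dist
  refine (Finset.card_le_card ?_).trans (Finset.card_union_le _ _)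
  intro p
  simp only [Finset.mem_filter, Finset.mem_univ, true_and, Finset.mem_union]
  tauto

/-! ### Comparison with optimal solutions; objective values of the two kinds of candidates -/

theorem exists_forall_le {ι : Type*} (p : ι → Prop) (f : ι → ℕ) (h : ∃ x, p x) :
    ∃ x, p x ∧ ∀ y, p y → f x ≤ f y := by
  obtain ⟨x, hx, hmin⟩ := (measure f).wf.has_min {x | p x} h
  exact ⟨x, hx, fun y hy => not_lt.1 (hmin y hy)⟩

theorem IsCloseFair.dist_le {P : Set (Fin n) → Prop} {γ : ℝ} (hγ : 0 < γ) {D F N : Clustering n}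
    (h : IsCloseFair P γ D F) (hN : IsFair P N) : (dist D F : ℝ) ≤ γ * dist D N := by
  obtain ⟨N', h1, h2⟩ := exists_forall_le (IsFair P) (dist D) ⟨N, hN⟩
  refine (h.2 N' ⟨h1, h2⟩).trans (mul_le_mul_of_nonneg_left ?_ hγ.le)
  exact_mod_cast h2 N hN

theorem IsApproxFairCor.cost_le {P : Set (Fin n) → Prop} {η : ℝ} (hη : 0 < η)
    {G : SimpleGraph (Fin n)} {F N : Clustering n}
    (h : IsApproxFairCor P η G F) (hN : IsFair P N) : (corCost G F : ℝ) ≤ η * corCost G N := by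
  obtain ⟨N', h1, h2⟩ := exists_forall_le (IsFair P) (corCost G) ⟨N, hN⟩
  refine (h.2 N' ⟨h1, h2⟩).trans (mul_le_mul_of_nonneg_left ?_ hη.le)
  exact_mod_cast h2 N hN

/-- The triangle inequality through `I i` is sharpened by the deviations from `N` that `I i` and `I
j` share. This gain is what makes a single input useful when many overlaps are large; when they are
small, the majority of three inputs takes over. -/
theorem obj_le_of_close {P : Set (Fin n) → Prop} {γ : ℝ} (hγ : 0 < γ) (I : Fin m → Clustering n)
    {N F : Clustering n} (hN : IsFair P N) (i : Fin m) (h : IsCloseFair P γ (I i) F) :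
    (obj I F : ℝ) ≤ obj I N + (γ + 1) * (m * dist (I i) N)
      - 2 * ∑ j, (overlap N (I i) (I j) : ℝ) := by
  have key : ∀ j, (dist (I j) F : ℝ) ≤
      dist (I j) N + (γ + 1) * dist (I i) N - 2 * overlap N (I i) (I j) := by
    intro j
    have h1 : (dist (I j) F : ℝ) ≤ dist (I i) (I j) + dist (I i) F := by
      have := dist_triangle (I j) (I i) F
      rw [dist_comm (I j) (I i)] at this
      exact_mod_cast this
    have h2 : (dist (I i) (I j) : ℝ) + 2 * overlap N (I i) (I j) ≤
        dist (I i) N + dist (I j) N := by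
      exact_mod_cast dist_add_overlap_le N (I i) (I j)
    have h3 := h.dist_le hγ hN
    linarith
  calc (obj I F : ℝ) = ∑ j, (dist (I j) F : ℝ) := by simp [obj]
    _ ≤ ∑ j, ((dist (I j) N : ℝ) + (γ + 1) * dist (I i) N - 2 * overlap N (I i) (I j)) :=
        Finset.sum_le_sum fun j _ => key j
    _ = _ := by
        rw [Finset.sum_sub_distrib, Finset.sum_add_distrib, ← Finset.mul_sum]
        simp [obj, ← Finset.mul_sum]

theorem obj_le_of_dist (I : Fin m → Clustering n) (N F : Clustering n) :
    (obj I F : ℝ) ≤ obj I N + m * dist N F := by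
  have : obj I F ≤ obj I N + m * dist N F := by
    unfold obj
    refine (Finset.sum_le_sum fun j _ => dist_triangle (I j) N F).trans ?_
    rw [Finset.sum_add_distrib]
    simp
  exact_mod_cast this

/-- This bounds the scale `dist F F'` by which differences of sample distances are normalized in
`measure_sample_le`. -/
theorem mul_dist_le_obj_add (I : Fin m → Clustering n) (F F' : Clustering n) :
    m * dist F F' ≤ obj I F + obj I F' := by
  unfold obj
  rw [← Finset.sum_add_distrib]
  refine le_trans (by simp) (Finset.sum_le_sum (f := fun _ => dist F F') fun j _ => ?_)
  have := dist_triangle F (I j) F'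
  rwa [dist_comm F (I j)] at this

/-- On the majority graph `N` costs at most 3αa, hence `F` at most 3ηαa, and the two clusterings
differ on at most 3(η+1)αa pairs. Each of the m inputs pays this distance at most once. -/
theorem obj_le_of_majority {P : Set (Fin n) → Prop} {η α : ℝ} (hη : 0 < η) {a : ℝ}
    (I : Fin m → Clustering n) {N F : Clustering n} (hN : IsFair P N) {i j k : Fin m}
    (hF : IsApproxFairCor P η (majority (I i) (I j) (I k)) F)
    (hij : (overlap N (I i) (I j) : ℝ) ≤ α * a) (hik : (overlap N (I i) (I k) : ℝ) ≤ α * a)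
    (hjk : (overlap N (I j) (I k) : ℝ) ≤ α * a) (ha : m * a = obj I N) :
    (obj I F : ℝ) ≤ (1 + 3 * (η + 1) * α) * obj I N := by
  have h1 : (corCost (majority (I i) (I j) (I k)) N : ℝ) ≤ 3 * (α * a) := by
    have : (corCost (majority (I i) (I j) (I k)) N : ℝ) ≤ overlap N (I i) (I j)
        + overlap N (I i) (I k) + overlap N (I j) (I k) := by
      exact_mod_cast corCost_majority_le N (I i) (I j) (I k)
    linarith
  have h2 := hF.cost_le hη hN
  have h3 : (dist N F : ℝ) ≤ corCost (majority (I i) (I j) (I k)) N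
      + corCost (majority (I i) (I j) (I k)) F := by
    exact_mod_cast dist_le_corCost_add _ N F
  have h4 : (dist N F : ℝ) ≤ 3 * (η + 1) * α * a := by nlinarith
  have h5 := obj_le_of_dist I N F
  have h6 : (m : ℝ) * dist N F ≤ m * (3 * (η + 1) * α * a) :=
    mul_le_mul_of_nonneg_left h4 (Nat.cast_nonneg m)
  calc (obj I F : ℝ) ≤ obj I N + m * (3 * (η + 1) * α * a) := by linarith
    _ = obj I N + 3 * (η + 1) * α * (m * a) := by ring
    _ = _ := by rw [ha]; ring

/-! ### Distribution of the distances and the choice of three inputs -/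

/-- If fewer than `m / g` of the numbers `d i` are at most `(1 - β)` times their mean `a`, then many
of them are not much larger than the mean. -/
theorem le_card_filter_le (d : Fin m → ℝ) (hd : ∀ i, 0 ≤ d i) {a β g k y : ℝ} (ha : 0 ≤ a)
    (hsum : ∑ i, d i = m * a) (hβ₀ : 0 < β) (hβ₁ : β < 1) (hg : 1 < g) (hk : 0 < k)
    (hy : k * (y + β) = β + (1 - β) / g)
    (hL : ((Finset.univ.filter fun i => d i ≤ (1 - β) * a).card : ℝ) ≤ m / g) :
    (1 - k) * m ≤ ((Finset.univ.filter fun i => d i ≤ (1 + y) * a).card : ℝ) := by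
  have hg0 : 0 < g := by linarith
  have hpos : 0 < β + (1 - β) / g := by
    have : 0 < (1 - β) / g := div_pos (by linarith) hg0
    linarith
  have hyβ : 0 < y + β := by
    rw [← hy] at hpos
    exact (pos_iff_pos_of_mul_pos hpos).1 hk
  -- If the mean is zero, all the numbers vanish; otherwise `a` can be cancelled from the final
  -- inequality.
  rcases ha.eq_or_lt with ha0 | ha0
  · have hz : ∀ i, d i = 0 := by
      have : ∑ i, d i = 0 := by rw [hsum, ← ha0, mul_zero]
      exact fun i => (Finset.sum_eq_zero_iff_of_nonneg fun i _ => hd i).1 this i (Finset.mem_univ i)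
    have : (Finset.univ.filter fun i => d i ≤ (1 + y) * a) = Finset.univ := by
      ext i; simp [hz i, ← ha0]
    rw [this, Finset.card_univ, Fintype.card_fin]
    nlinarith [(Nat.cast_nonneg m : (0 : ℝ) ≤ m)]
  set H := Finset.univ.filter fun i => d i ≤ (1 + y) * a with hH
  set L := Finset.univ.filter fun i => d i ≤ (1 - β) * a with hLdef
  -- An index outside `L` contributes at least (1−β)a, and one outside `H` a further (y+β)a, which
  -- makes (1+y)a; and `L` is contained in `H`. Summing over all indices bounds m − |H|.
  have hbound : ∀ i, (1 - β) * a - (if i ∈ L then (1 - β) * a else 0)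
      + ((y + β) * a - if i ∈ H then (y + β) * a else 0) ≤ d i := by
    intro i
    have h1 : i ∈ L ↔ d i ≤ (1 - β) * a := by simp [hLdef]
    have h2 : i ∈ H ↔ d i ≤ (1 + y) * a := by simp [hH]
    have h3 : 0 < (y + β) * a := mul_pos hyβ ha0
    have := hd i
    by_cases hl : i ∈ L <;> by_cases hh : i ∈ H <;> simp only [hl, hh, if_true, if_false]
    · linarith
    · exact absurd (h2.2 (by linarith [h1.1 hl])) hh
    · rw [h1] at hl; linarith
    · rw [h2] at hh; linarith
  have hs := Finset.sum_le_sum fun i (_ : i ∈ Finset.univ) => hbound i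
  rw [hsum] at hs
  simp only [Finset.sum_add_distrib, Finset.sum_sub_distrib, Finset.sum_const, Finset.card_univ,
    Fintype.card_fin, nsmul_eq_mul, Finset.sum_ite_mem, Finset.univ_inter] at hs
  have h4 : ((m : ℝ) * (1 - β) - L.card * (1 - β) + (m * (y + β) - H.card * (y + β))) * a
      ≤ m * a := by linarith
  have h5 := le_of_mul_le_mul_right h4 ha0
  have h6 : (L.card : ℝ) * (1 - β) ≤ m / g * (1 - β) :=
    mul_le_mul_of_nonneg_right hL (by linarith)
  have h7 : (m : ℝ) / g * (1 - β) = m * (k * (y + β)) - m * β := by rw [hy]; ring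
  have h8 : ((1 - k) * m) * (y + β) ≤ H.card * (y + β) := by nlinarith
  exact le_of_mul_le_mul_right h8 hyβ

/-- The fraction in the second term of `ratio` solves the threshold equation of `le_card_filter_le`
for k = 1 − 1/s, which guarantees m/s indices. -/
theorem threshold_fst {β s g : ℝ} (hs : 1 < s) (hg : 0 < g) :
    (1 - 1 / s) * ((β * (g - s) + s) / (g * (s - 1)) + β) = β + (1 - β) / g := by
  have h1 : s - 1 ≠ 0 := by linarith
  have h2 : s ≠ 0 := by linarith
  field_simp
  ring

/-- Likewise the fraction in the third term, for k = 1 − 1/c − 2/s, which guarantees m/c + 2m/s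
indices. The hypothesis `hsc` says that this k is positive. -/
theorem threshold_snd {β c s g : ℝ} (hc : 0 < c) (hs : 0 < s) (hg : 0 < g)
    (hsc : 0 < s * c - s - 2 * c) :
    (1 - 1 / c - 2 / s) * ((β * (g * (2 * c + s) - s * c) + s * c) / (g * (c * s - s - 2 * c)) + β)
      = β + (1 - β) / g := by
  have e : 1 - 1 / c - 2 / s = (c * s - s - 2 * c) / (c * s) := by field_simp
  rw [e]
  obtain ⟨D, hD⟩ : ∃ D, D = c * s - s - 2 * c := ⟨_, rfl⟩
  have hD0 : D ≠ 0 := by nlinarith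
  rw [← hD]
  field_simp
  linear_combination β * g * hD

open Classical in
/-- A family of large sets such that a set which meets all of them contains three indices that
are pairwise not related by `near`. -/
theorem exists_family_of_near {c s p : ℝ} (hs : 1 < s) (hp0 : 0 < p)
    (hp : 2 * p ≤ 1 / s) (hm : 0 < m) (good G₁ G₂ : Finset (Fin m))
    (near : Fin m → Finset (Fin m)) (hgood : good.card < p * m)
    (hcard₁ : 1 / s * m ≤ (G₁.card : ℝ)) (hcard₂ : 1 / c * m + 2 * (1 / s * m) ≤ (G₂.card : ℝ))
    (hfew₁ : ∀ i ∈ G₁ \ good, ((near i).card : ℝ) < 1 / c * m)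
    (hfew₂ : ∀ i ∈ G₂ \ good, ((near i).card : ℝ) < (1 - 1 / s - 1 / c) * m) :
    ∃ 𝒜 : Fin 3 × Fin m × Fin m → Finset (Fin m), (∀ q, p * m ≤ (𝒜 q).card) ∧
      ∀ X : Set (Fin m), (∀ q, ∃ i ∈ X, i ∈ 𝒜 q) →
        ∃ i ∈ X, ∃ j ∈ X, ∃ k ∈ X, j ∉ near i ∧ k ∉ near i ∧ k ∉ near j := by
  have hmR : (0 : ℝ) < m := by exact_mod_cast hm
  have hs1 : 1 / s < 1 := by rw [div_lt_one (by linarith)]; exact hs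
  have hs2 : 0 < 1 / s * (m : ℝ) := by positivity
  have sdiff_card : ∀ U V : Finset (Fin m), (U.card : ℝ) - V.card ≤ (U \ V).card := by
    intro U V
    have := Finset.le_card_sdiff V U
    have h : U.card ≤ (U \ V).card + V.card := by omega
    have h' : (U.card : ℝ) ≤ (U \ V).card + V.card := by exact_mod_cast h
    linarith
  -- Removing the fewer than pm indices of `good` from m/s indices must leave pm; hence the factor 2
  -- in `hp`.
  have hps : p * m ≤ 1 / s * m - p * m := by nlinarith
  have hpm : 0 < p * m := by positivity
  have huniv : p * m ≤ ((Finset.univ : Finset (Fin m)).card : ℝ) := by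
    rw [Finset.card_univ, Fintype.card_fin]
    nlinarith
  -- The set for the second index depends on the first index, and the set for the third on both. One
  -- set for each conceivable earlier choice makes the family independent of the sample; after an
  -- inadmissible choice `Finset.univ` merely keeps the set large.
  obtain ⟨A₁, hA₁⟩ : ∃ A : Fin m → Finset (Fin m), A = fun i =>
    if i ∈ G₁ \ good then (G₂ \ good) \ near i else Finset.univ := ⟨_, rfl⟩
  obtain ⟨A₂, hA₂⟩ : ∃ A : Fin m → Fin m → Finset (Fin m), A = fun i j =>
    if i ∈ G₁ \ good ∧ j ∈ G₂ \ good then (Finset.univ \ near i) \ near j else Finset.univ :=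
    ⟨_, rfl⟩
  refine ⟨fun q => if q.1 = 0 then G₁ \ good else
    if q.1 = 1 then A₁ q.2.1 else A₂ q.2.1 q.2.2, ?_, ?_⟩
  · rintro ⟨q, i, j⟩
    have h0 : p * m ≤ ((G₁ \ good).card : ℝ) := by
      have := sdiff_card G₁ good
      linarith
    have h1 : p * m ≤ ((A₁ i).card : ℝ) := by
      rw [hA₁]
      by_cases hi : i ∈ G₁ \ good
      · simp only [if_pos hi]
        have e1 := sdiff_card G₂ good
        have e2 := sdiff_card (G₂ \ good) (near i)
        have e3 := hfew₁ i hi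
        linarith
      · simp only [if_neg hi]
        exact huniv
    have h2 : p * m ≤ ((A₂ i j).card : ℝ) := by
      rw [hA₂]
      by_cases hi : i ∈ G₁ \ good ∧ j ∈ G₂ \ good
      · simp only [if_pos hi]
        have e1 := sdiff_card Finset.univ (near i)
        have e2 := sdiff_card (Finset.univ \ near i) (near j)
        have e3 := hfew₁ i hi.1
        have e4 := hfew₂ j hi.2
        rw [Finset.card_univ, Fintype.card_fin] at e1
        -- The two exceptional sets have fewer than m/c and (1−1/s−1/c)m elements, so m/s indices
        -- remain for the third choice.
        have e6 : (1 - 1 / s - 1 / c) * (m : ℝ) = m - 1 / s * m - 1 / c * m := by ring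
        linarith
      · simp only [if_neg hi]
        exact huniv
    dsimp only
    split_ifs
    exacts [h0, h1, h2]
  · intro X hX
    -- Filler for the coordinates on which the chosen set does not depend.
    have i0 : Fin m := ⟨0, hm⟩
    obtain ⟨i, hiX, hi⟩ := hX (0, i0, i0)
    obtain ⟨j, hjX, hj⟩ := hX (1, i, i0)
    dsimp only at hi hj
    rw [if_pos rfl] at hi
    have hj : j ∈ (G₂ \ good) \ near i := by
      rw [if_neg (by decide), if_pos rfl, hA₁] at hj
      simpa only [if_pos hi] using hj
    rw [Finset.mem_sdiff] at hj
    obtain ⟨k, hkX, hk⟩ := hX (2, i, j)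
    have hk : k ∈ (Finset.univ \ near i) \ near j := by
      dsimp only at hk
      rw [if_neg (by decide), if_neg (by decide), hA₂] at hk
      simpa only [if_pos (And.intro hi hj.1)] using hk
    simp only [Finset.mem_sdiff, Finset.mem_univ, true_and] at hk
    exact ⟨i, hiX, j, hjX, k, hkX, hj.2, hk.1, hk.2⟩

open Classical in
/-- There is a small family of large index sets such that every index set which meets all of them
yields a good candidate. -/
theorem exists_family {γ η α β c s g : ℝ} (hγ : 0 < γ) (hη : 0 < η) (hα : 0 < α)
    (hβ₀ : 0 < β) (hβ₁ : β < 1) (hc : 1 < c) (hs : 1 < s) (hg : s < g)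
    (hsc : 0 < s * c - s - 2 * c) (hm : 0 < m) {P : Set (Fin n) → Prop}
    (I : Fin m → Clustering n) {N : Clustering n} (hN : IsFair P N)
    (cls : Fin m → Clustering n) (hcls : ∀ i, IsCloseFair P γ (I i) (cls i))
    (cor : Fin m → Fin m → Fin m → Clustering n)
    (hcor : ∀ i j k, IsApproxFairCor P η (majority (I i) (I j) (I k)) (cor i j k)) :
    ∃ 𝒜 : Fin 3 × Fin m × Fin m → Finset (Fin m),
      (∀ q, min (1 / g) (1 / (2 * s)) * m ≤ (𝒜 q).card) ∧
      ∀ X : Set (Fin m), (∀ q, ∃ i ∈ X, i ∈ 𝒜 q) →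
        (∃ i ∈ X, (obj I (cls i) : ℝ) ≤ ratio γ η α β c s g * obj I N) ∨
        ∃ i ∈ X, ∃ j ∈ X, ∃ k ∈ X,
          (obj I (cor i j k) : ℝ) ≤ ratio γ η α β c s g * obj I N := by
  set p := min (1 / g) (1 / (2 * s)) with hp
  have hc0 : 0 < c := by linarith
  have hs0 : 0 < s := by linarith
  have hg0 : 0 < g := by linarith
  have hp1 : p ≤ 1 / g := min_le_left _ _
  have hp2 : 2 * p ≤ 1 / s := by
    have : p ≤ 1 / (2 * s) := min_le_right _ _
    have e : 1 / s = 2 * (1 / (2 * s)) := by field_simp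
    linarith
  have hs1 : 1 / s < 1 := by rw [div_lt_one hs0]; exact hs
  have hp0 : 0 < p := lt_min (by positivity) (by positivity)
  have hmR : (0 : ℝ) < m := by exact_mod_cast hm
  set r := ratio γ η α β c s g with hr
  set O : ℝ := ((obj I N : ℕ) : ℝ) with hO
  have hO0 : 0 ≤ O := Nat.cast_nonneg _
  set a : ℝ := O / m with ha
  have ha0 : 0 ≤ a := by positivity
  have hma : m * a = O := by rw [ha]; field_simp
  set good : Finset (Fin m) := Finset.univ.filter fun i => (obj I (cls i) : ℝ) ≤ r * O with hgood
  have mem_good : ∀ i, i ∈ good ↔ (obj I (cls i) : ℝ) ≤ r * O := by simp [hgood]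
  -- If many inputs are good on their own, the sample only has to hit one of them, and `good` is the
  -- whole family.
  by_cases hcase : p * m ≤ good.card
  · refine ⟨fun _ => good, fun _ => hcase, fun X hX => Or.inl ?_⟩
    obtain ⟨i, hi, hi'⟩ := hX (0, ⟨0, hm⟩, ⟨0, hm⟩)
    exact ⟨i, hi, (mem_good i).1 hi'⟩
  push Not at hcase
  have hobj : ∀ i, (obj I (cls i) : ℝ) ≤ O + (γ + 1) * (m * dist (I i) N)
      - 2 * ∑ j, (overlap N (I i) (I j) : ℝ) := fun i => obj_le_of_close hγ I hN i (hcls i)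
  have hoverlap : ∀ i, 0 ≤ ∑ j, (overlap N (I i) (I j) : ℝ) :=
    fun i => Finset.sum_nonneg fun j _ => Nat.cast_nonneg _
  have hdsum : ∑ i, (dist (I i) N : ℝ) = m * a := by rw [hma]; simp [hO, obj]
  have r1 : γ + 2 - (γ + 1) * β ≤ r := (le_max_left _ _).trans (le_max_left _ _)
  have r2 : γ + 2 + (γ + 1) * ((β * (g - s) + s) / (g * (s - 1))) - 2 * α / c ≤ r :=
    (le_max_right _ _).trans (le_max_left _ _)
  have r3 : γ + 2 + (γ + 1) * ((β * (g * (2 * c + s) - s * c) + s * c) / (g * (c * s - s - 2 * c)))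
      - 2 * (1 - 1 / s - 1 / c) * α ≤ r := (le_max_left _ _).trans (le_max_right _ _)
  have r4 : 1 + 3 * (η + 1) * α ≤ r := (le_max_right _ _).trans (le_max_right _ _)
  -- An input this close to `N` is good even without the gain from overlaps, by the first term of
  -- `ratio`; and `good` has fewer than pm ≤ m/g elements.
  have hL : ((Finset.univ.filter fun i => (dist (I i) N : ℝ) ≤ (1 - β) * a).card : ℝ) ≤ m / g := by
    have hsub : (Finset.univ.filter fun i => (dist (I i) N : ℝ) ≤ (1 - β) * a) ⊆ good := by
      intro i hi
      rw [Finset.mem_filter] at hi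
      rw [mem_good]
      have h1 : (γ + 1) * (m * dist (I i) N) ≤ (γ + 1) * (m * ((1 - β) * a)) := by
        gcongr
        exact hi.2
      have h2 : (γ + 1) * (m * ((1 - β) * a)) = (γ + 1) * (1 - β) * O := by rw [← hma]; ring
      have h3 := hobj i
      have h4 := hoverlap i
      have h5 : (γ + 2 - (γ + 1) * β) * O ≤ r * O := mul_le_mul_of_nonneg_right r1 hO0
      have h6 : (γ + 2 - (γ + 1) * β) * O = O + (γ + 1) * (1 - β) * O := by ring
      linarith
    have h1 : ((Finset.univ.filter fun i => (dist (I i) N : ℝ) ≤ (1 - β) * a).card : ℝ) ≤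
        good.card := by exact_mod_cast Finset.card_le_card hsub
    have h2 : p * m ≤ m / g := by
      calc p * m ≤ 1 / g * m := mul_le_mul_of_nonneg_right hp1 hmR.le
        _ = m / g := by ring
    linarith
  obtain ⟨x₁, hx₁⟩ : ∃ x, x = (β * (g - s) + s) / (g * (s - 1)) := ⟨_, rfl⟩
  obtain ⟨x₂, hx₂⟩ : ∃ x, x = (β * (g * (2 * c + s) - s * c) + s * c) / (g * (c * s - s - 2 * c)) :=
    ⟨_, rfl⟩
  rw [← hx₁] at r2
  rw [← hx₂] at r3
  obtain ⟨G, hG⟩ : ∃ G : ℝ → Finset (Fin m), G = fun x =>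
    Finset.univ.filter fun i => (dist (I i) N : ℝ) ≤ (1 + x) * a := ⟨_, rfl⟩
  have mem_G : ∀ x i, i ∈ G x → (dist (I i) N : ℝ) ≤ (1 + x) * a := by
    intro x i hi
    rw [hG] at hi
    exact (Finset.mem_filter.1 hi).2
  have hcard : ∀ k x : ℝ, 0 < k → k * (x + β) = β + (1 - β) / g →
      (1 - k) * m ≤ ((G x).card : ℝ) := by
    intro k x hk hx
    rw [hG]
    exact le_card_filter_le _ (fun i => Nat.cast_nonneg _) ha0 hdsum hβ₀ hβ₁ (by linarith) hk hx hL
  have hcard₁ : 1 / s * m ≤ ((G x₁).card : ℝ) := by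
    have := hcard (1 - 1 / s) x₁ (by linarith) (by rw [hx₁]; exact threshold_fst hs hg0)
    linarith
  have hcard₂ : 1 / c * m + 2 * (1 / s * m) ≤ ((G x₂).card : ℝ) := by
    have e : 1 - 1 / c - 2 / s = (s * c - s - 2 * c) / (c * s) := by field_simp
    have := hcard (1 - 1 / c - 2 / s) x₂ (by rw [e]; positivity)
      (by rw [hx₂]; exact threshold_snd hc0 hs0 hg0 hsc)
    have e' : (1 - (1 - 1 / c - 2 / s)) * (m : ℝ) = 1 / c * m + 2 * (1 / s * m) := by ring
    linarith
  obtain ⟨near, hnear⟩ : ∃ f : Fin m → Finset (Fin m), f = fun i =>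
    Finset.univ.filter fun j => α * a < overlap N (I i) (I j) := ⟨_, rfl⟩
  have mem_near : ∀ i j, j ∈ near i ↔ α * a < overlap N (I i) (I j) := by simp [hnear]
  have near_sum : ∀ i, (near i).card * (α * a) ≤ ∑ j, (overlap N (I i) (I j) : ℝ) := by
    intro i
    have h1 : ∑ j ∈ near i, (α * a) ≤ ∑ j ∈ near i, (overlap N (I i) (I j) : ℝ) :=
      Finset.sum_le_sum fun j hj => ((mem_near i j).1 hj).le
    rw [Finset.sum_const, nsmul_eq_mul] at h1
    exact h1.trans (Finset.sum_le_sum_of_subset_of_nonneg (Finset.subset_univ _)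
      fun j _ _ => Nat.cast_nonneg _)
  -- With bm heavy overlaps the gain would be at least 2bα·obj(N), and the candidate of `i` would be
  -- good. The second and third terms of `ratio` are this condition for b = 1/c and b = 1 − 1/s −
  -- 1/c.
  have few : ∀ (y b : ℝ), γ + 2 + (γ + 1) * y - 2 * (b * α) ≤ r →
      ∀ i ∈ G y \ good, ((near i).card : ℝ) < b * m := by
    intro y b hb i hi
    rw [Finset.mem_sdiff] at hi
    by_contra hcon
    push Not at hcon
    apply hi.2
    rw [mem_good]
    have h1 : b * m * (α * a) ≤ ∑ j, (overlap N (I i) (I j) : ℝ) :=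
      (mul_le_mul_of_nonneg_right hcon (by positivity)).trans (near_sum i)
    have h2 : b * m * (α * a) = b * α * O := by rw [← hma]; ring
    have h3 : (γ + 1) * (m * dist (I i) N) ≤ (γ + 1) * (m * ((1 + y) * a)) := by
      gcongr
      exact mem_G y i hi.1
    have h4 : (γ + 1) * (m * ((1 + y) * a)) = (γ + 1) * (1 + y) * O := by rw [← hma]; ring
    have h5 := hobj i
    have h6 := mul_le_mul_of_nonneg_right hb hO0
    have h7 : (γ + 2 + (γ + 1) * y - 2 * (b * α)) * O =
        O + (γ + 1) * (1 + y) * O - 2 * (b * α * O) := by ring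
    linarith
  have hfew₁ := few x₁ (1 / c) (by
    have : 2 * (1 / c * α) = 2 * α / c := by ring
    rw [this]
    exact r2)
  have hfew₂ := few x₂ (1 - 1 / s - 1 / c) (by linarith)
  obtain ⟨𝒜, h𝒜, hX⟩ := exists_family_of_near hs hp0 hp2 hm good (G x₁) (G x₂) near hcase
    hcard₁ hcard₂ hfew₁ hfew₂
  refine ⟨𝒜, h𝒜, fun X hX' => Or.inr ?_⟩
  obtain ⟨i, hi, j, hj, k, hk, hij, hik, hjk⟩ := hX X hX'
  rw [mem_near, not_lt] at hij hik hjk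
  exact ⟨i, hi, j, hj, k, hk, (obj_le_of_majority hη I hN (hcor i j k) hij hik hjk hma).trans
    (mul_le_mul_of_nonneg_right r4 hO0)⟩

end Combinatorics

end FairConsensus

namespace FairConsensus

/-! ### Random draws -/

section Probability

instance : IsProbabilityMeasure coinMeasure := by
  unfold coinMeasure
  infer_instance

theorem lintegral_coin (f : ℕ → ℝ) (hf : ∀ j, 0 ≤ f j) (p : ℕ × ℕ) :
    ∫⁻ ω, ENNReal.ofReal (f (ω p : ℕ)) ∂coinMeasure =
      ENNReal.ofReal ((∑ j ∈ Finset.range (p.2 + 1), f j) / (p.2 + 1 : ℕ)) := by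
  have h := (measurePreserving_eval_infinitePi
    (fun p : ℕ × ℕ => (PMF.uniformOfFintype (Fin (p.2 + 1))).toMeasure) p).lintegral_comp
    (f := fun x => ENNReal.ofReal (f (x : ℕ))) (measurable_of_finite _)
  rw [coinMeasure]
  refine h.trans ?_
  rw [lintegral_fintype]
  simp only [PMF.toMeasure_apply_singleton _ _ (measurableSet_singleton _),
    PMF.uniformOfFintype_apply, Fintype.card_fin]
  rw [← Finset.sum_mul, ← ENNReal.ofReal_sum_of_nonneg (fun _ _ => hf _),
    Fin.sum_univ_eq_sum_range (fun j => f j), ENNReal.ofReal_div_of_pos (by positivity),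
    ENNReal.ofReal_natCast, div_eq_mul_inv]

/-- Markov's inequality for a product over independent draws. -/
theorem measure_one_le_prod_le {m : ℕ} (hm : 0 < m) (f : ℕ → ℝ) (hf : ∀ j, 0 ≤ f j) (T : ℕ) :
    coinMeasure {ω | 1 ≤ ∏ t ∈ Finset.range T, f (ω (t, m - 1) : ℕ)} ≤
      ENNReal.ofReal (((∑ j ∈ Finset.range m, f j) / m) ^ T) := by
  have hind : ProbabilityTheory.iIndepFun
      (fun (p : ℕ × ℕ) (ω : Coins) => ENNReal.ofReal (f (ω p : ℕ))) coinMeasure :=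
    ProbabilityTheory.iIndepFun_infinitePi
      (X := fun (p : ℕ × ℕ) (x : Fin (p.2 + 1)) => ENNReal.ofReal (f (x : ℕ)))
      (fun p => measurable_of_finite _)
  have hmeas : ∀ p : ℕ × ℕ, Measurable fun ω : Coins => ENNReal.ofReal (f (ω p : ℕ)) := fun p =>
    (measurable_of_finite (fun x : Fin (p.2 + 1) => ENNReal.ofReal (f (x : ℕ)))).comp
      (measurable_pi_apply p)
  have hinj : Function.Injective fun t : ℕ => (t, m - 1) := fun a b h => (Prod.mk.inj h).1
  have hint := ProbabilityTheory.lintegral_prod_eq_prod_lintegral_of_indepFun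
    (Finset.range T) _ (hind.precomp hinj) (fun t => hmeas (t, m - 1))
  have hcoin := fun t : ℕ => lintegral_coin f hf (t, m - 1)
  -- The entry `(t, m - 1)` of the random source takes `m - 1 + 1 = m` values.
  simp only [Nat.sub_add_cancel hm] at hcoin
  simp only [hcoin, Finset.prod_const, Finset.card_range] at hint
  rw [ENNReal.ofReal_pow (div_nonneg (Finset.sum_nonneg fun j _ => hf j) (Nat.cast_nonneg m)),
    ← hint]
  refine le_trans (measure_mono ?_) (meas_ge_le_lintegral_div
    (Finset.measurable_prod _ fun t _ => hmeas (t, m - 1)).aemeasurable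
    (one_ne_zero) ENNReal.one_ne_top) |>.trans (by rw [div_one])
  intro ω hω
  simp only [Set.mem_ofPred_eq] at hω ⊢
  rw [← ENNReal.ofReal_prod_of_nonneg (fun _ _ => hf _)]
  exact ENNReal.one_le_ofReal.2 hω

/-- The probability that the draws miss a large set. -/
theorem measure_forall_notMem_le {m : ℕ} (hm : 0 < m) (A : Finset (Fin m)) {p : ℝ}
    (hA : p * m ≤ A.card) (T : ℕ) :
    coinMeasure {ω | ∀ t < T, ∀ i ∈ A, (ω (t, m - 1) : ℕ) ≠ i} ≤ ENNReal.ofReal ((1 - p) ^ T) := by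
  classical
  -- With the indicator of a miss as factor, the product over the draws is 1 exactly if all draws
  -- miss.
  obtain ⟨f, hf⟩ : ∃ f : ℕ → ℝ,
      f = fun j => if ∃ i ∈ A, j = (i : ℕ) then (0 : ℝ) else 1 := ⟨_, rfl⟩
  have hf0 : ∀ j, 0 ≤ f j := by intro j; rw [hf]; dsimp only; split_ifs <;> norm_num
  have hmR : (0 : ℝ) < m := by exact_mod_cast hm
  have hsum : ∑ j ∈ Finset.range m, f j = m - A.card := by
    rw [Finset.sum_range]
    have : ∀ i : Fin m, f i = 1 - if i ∈ A then 1 else 0 := by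
      intro i
      rw [hf]
      have : (∃ i' ∈ A, (i : ℕ) = i') ↔ i ∈ A :=
        ⟨fun ⟨i', h, e⟩ => (Fin.ext e : i = i') ▸ h, fun h => ⟨i, h, rfl⟩⟩
      simp only [this]
      split_ifs <;> norm_num
    simp [this]
  refine (measure_mono ?_).trans ((measure_one_le_prod_le hm f hf0 T).trans ?_)
  · intro ω hω
    simp only [Set.mem_ofPred_eq] at hω ⊢
    rw [Finset.prod_eq_one]
    intro t ht
    rw [hf]
    simp only [ite_eq_right_iff, zero_ne_one, imp_false]
    rintro ⟨i, hi, e⟩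
    exact hω t (Finset.mem_range.1 ht) i hi e
  · refine ENNReal.ofReal_le_ofReal (pow_le_pow_left₀
      (div_nonneg (Finset.sum_nonneg fun j _ => hf0 j) hmR.le) ?_ T)
    rw [hsum, div_le_iff₀ hmR]
    linarith

/-- An exponential tail bound for bounded variables with negative mean. -/
theorem measure_sum_nonneg_le {m : ℕ} (hm : 0 < m) (h : ℕ → ℝ) {ε : ℝ} (hε₀ : 0 < ε) (hε₁ : ε < 1)
    (hh : ∀ j < m, |h j| ≤ 1) (hsum : ∑ j ∈ Finset.range m, h j ≤ -(ε / 2) * m) (T : ℕ) :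
    coinMeasure {ω | 0 ≤ ∑ t ∈ Finset.range T, h (ω (t, m - 1) : ℕ)} ≤
      ENNReal.ofReal (Real.exp (-(ε ^ 2 / 16)) ^ T) := by
  have hmR : (0 : ℝ) < m := by exact_mod_cast hm
  -- The moment parameter is λ = ε/4: since exp x ≤ 1 + x + x² for |x| ≤ 1, the mean is at most 1 −
  -- λε/2 + λ² = 1 − ε²/16.
  refine (measure_mono ?_).trans ((measure_one_le_prod_le hm
    (fun j => Real.exp (ε / 4 * h j)) (fun j => (Real.exp_pos _).le) T).trans ?_)
  · intro ω hω
    simp only [Set.mem_ofPred_eq] at hω ⊢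
    rw [← Real.exp_sum, ← Finset.mul_sum]
    exact Real.one_le_exp (mul_nonneg (by positivity) hω)
  · refine ENNReal.ofReal_le_ofReal (pow_le_pow_left₀
      (div_nonneg (Finset.sum_nonneg fun j _ => (Real.exp_pos _).le) hmR.le) ?_ T)
    have h1 : ∀ j ∈ Finset.range m, Real.exp (ε / 4 * h j) ≤ 1 + ε / 4 * h j + (ε / 4) ^ 2 := by
      intro j hj
      have hj' := hh j (Finset.mem_range.1 hj)
      have h2 : |ε / 4 * h j| ≤ 1 := by
        rw [abs_mul, abs_of_pos (by positivity : 0 < ε / 4)]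
        nlinarith [abs_nonneg (h j)]
      have h3 := (abs_le.1 (Real.abs_exp_sub_one_sub_id_le h2)).2
      have h4 : (ε / 4 * h j) ^ 2 ≤ (ε / 4) ^ 2 := by
        rw [mul_pow]
        have : h j ^ 2 ≤ 1 := by rw [← sq_abs]; nlinarith [abs_nonneg (h j)]
        nlinarith [sq_nonneg (ε / 4)]
      linarith
    have h2 : ∑ j ∈ Finset.range m, Real.exp (ε / 4 * h j) ≤ (1 - ε ^ 2 / 16) * m := by
      refine (Finset.sum_le_sum h1).trans ?_
      rw [Finset.sum_add_distrib, Finset.sum_add_distrib, ← Finset.mul_sum]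
      simp only [Finset.sum_const, Finset.card_range, nsmul_eq_mul, mul_one]
      nlinarith
    rw [div_le_iff₀ hmR]
    refine h2.trans (mul_le_mul_of_nonneg_right ?_ hmR.le)
    have := Real.add_one_le_exp (-(ε ^ 2 / 16))
    linarith

end Probability

end FairConsensus

namespace FairConsensus

/-! ### Reasoning about programs

Addresses `40, …, 63` are scratch space for the evaluation of expressions.  The observable part of a
state masks them, so that commands act on it by plain updates. -/

/-- The observable part of a state. -/
structure Core where
  mem : ℕ → ℕ
  arg : List ℕ
  out : List ℕ
  draws : ℕ

def Core.set (c : Core) (a x : ℕ) : Core := { c with mem := Function.update c.mem a x }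

@[simp] theorem Core.set_mem (c : Core) (a x : ℕ) :
    (c.set a x).mem = Function.update c.mem a x := rfl

def mask (μ : ℕ → ℕ) (a : ℕ) : ℕ := if 40 ≤ a ∧ a < 64 then 0 else μ a

theorem mask_of_not {μ : ℕ → ℕ} {a : ℕ} (h : a < 40 ∨ 64 ≤ a) : mask μ a = μ a := by
  unfold mask; rw [if_neg (by omega)]

theorem mask_update_scratch {μ : ℕ → ℕ} {a x : ℕ} (h : 40 ≤ a) (h' : a < 64) :
    mask (Function.update μ a x) = mask μ := by
  funext b
  unfold mask
  split_ifs with hb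
  · rfl
  · rw [Function.update_of_ne (by omega)]

theorem mask_update {μ : ℕ → ℕ} {a x : ℕ} (h : a < 40 ∨ 64 ≤ a) :
    mask (Function.update μ a x) = Function.update (mask μ) a x := by
  funext b
  unfold mask
  by_cases hb : b = a
  · subst hb; simp; omega
  · rw [Function.update_of_ne hb, Function.update_of_ne hb]

def State.core (σ : State) : Core := ⟨mask σ.mem, σ.arg, σ.out, σ.draws⟩

/-- Space at most `B` is used, and all words are at most `W`. -/
structure State.Within (B W : ℕ) (σ : State) : Prop where
  mem_le : ∀ a, σ.mem a ≤ W
  space_le : σ.space ≤ B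
  top_le : σ.top ≤ W

theorem State.Within.put {B W : ℕ} {σ : State} (h : σ.Within B W) {a x : ℕ} (ha : a < B)
    (hx : x ≤ W) : (σ.put a x).Within B W := by
  refine ⟨fun b => ?_, max_le h.space_le ha, max_le h.top_le hx⟩
  by_cases hb : b = a
  · subst hb; simpa [State.put] using hx
  · simpa [State.put, Function.update_of_ne hb] using h.mem_le b

theorem State.Within.spend {B W : ℕ} {σ : State} (h : σ.Within B W) (k : ℕ) :
    (σ.spend k).Within B W := ⟨h.mem_le, h.space_le, h.top_le⟩

theorem State.core_put {σ : State} {a x : ℕ} (h : a < 40 ∨ 64 ≤ a) :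
    (σ.put a x).core = σ.core.set a x := by
  simp [State.core, State.put, Core.set, mask_update h]

theorem State.core_put_scratch {σ : State} {a x : ℕ} (h : 40 ≤ a) (h' : a < 64) :
    (σ.put a x).core = σ.core := by
  simp [State.core, State.put, mask_update_scratch h h']

@[simp] theorem State.core_spend (σ : State) (k : ℕ) : (σ.spend k).core = σ.core := rfl
@[simp] theorem State.spend_mem (σ : State) (k : ℕ) : (σ.spend k).mem = σ.mem := rfl
@[simp] theorem State.spend_time (σ : State) (k : ℕ) : (σ.spend k).time = σ.time + k := rfl
@[simp] theorem State.put_time (σ : State) (a x : ℕ) : (σ.put a x).time = σ.time := rfl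
@[simp] theorem State.put_mem (σ : State) (a x : ℕ) :
    (σ.put a x).mem = Function.update σ.mem a x := rfl

theorem Prog.run_seq (E : Env) (p q : Prog) (σ : State) :
    (Prog.seq p q).run E σ = q.run E (p.run E σ) := rfl

theorem Prog.run_op (E : Env) (o : Op) (d a b : ℕ) (σ : State) :
    (Prog.op o d a b).run E σ = (σ.put d (o.eval (σ.mem a) (σ.mem b))).spend 1 := rfl

/-! #### Expressions -/

inductive RExpr where
  | lit (k : ℕ)
  | reg (a : ℕ)
  | bin (o : Op) (x y : RExpr)
  | size (x : RExpr)
  | ld (x : RExpr)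

namespace RExpr

instance : Add RExpr := ⟨bin .add⟩
instance : Sub RExpr := ⟨bin .sub⟩
instance : Mul RExpr := ⟨bin .mul⟩
instance : Div RExpr := ⟨bin .div⟩
instance : Mod RExpr := ⟨bin .mod⟩

/-- The value of an expression. -/
def eval (μ : ℕ → ℕ) : RExpr → ℕ
  | lit k => k
  | reg a => μ a
  | bin o x y => o.eval (x.eval μ) (y.eval μ)
  | size x => Nat.size (x.eval μ)
  | ld x => μ (x.eval μ)

/-- Evaluation does not read scratch space and produces no word larger than `W`. -/
def Ok (W : ℕ) (μ : ℕ → ℕ) : RExpr → Prop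
  | lit k => k ≤ W
  | reg a => a < 40
  | bin .add x y => x.Ok W μ ∧ y.Ok W μ ∧ x.eval μ + y.eval μ ≤ W
  | bin .mul x y => x.Ok W μ ∧ y.Ok W μ ∧ x.eval μ * y.eval μ ≤ W
  | bin _ x y => x.Ok W μ ∧ y.Ok W μ
  | size x => x.Ok W μ
  | ld x => x.Ok W μ ∧ 64 ≤ x.eval μ

section
variable (μ : ℕ → ℕ) (W : ℕ) (x y : RExpr)
@[simp] theorem eval_lit (k : ℕ) : (lit k).eval μ = k := rfl
@[simp] theorem eval_reg (a : ℕ) : (reg a).eval μ = μ a := rfl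
@[simp] theorem eval_add : (x + y).eval μ = x.eval μ + y.eval μ := rfl
@[simp] theorem eval_sub : (x - y).eval μ = x.eval μ - y.eval μ := rfl
@[simp] theorem eval_mul : (x * y).eval μ = x.eval μ * y.eval μ := rfl
@[simp] theorem eval_div : (x / y).eval μ = x.eval μ / y.eval μ := rfl
@[simp] theorem eval_mod : (x % y).eval μ = x.eval μ % y.eval μ := rfl
@[simp] theorem eval_size : (size x).eval μ = Nat.size (x.eval μ) := rfl
@[simp] theorem eval_ld : (ld x).eval μ = μ (x.eval μ) := rfl
@[simp] theorem ok_lit (k : ℕ) : (lit k).Ok W μ ↔ k ≤ W := Iff.rfl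
@[simp] theorem ok_reg (a : ℕ) : (reg a).Ok W μ ↔ a < 40 := Iff.rfl
@[simp] theorem ok_add :
    (x + y).Ok W μ ↔ x.Ok W μ ∧ y.Ok W μ ∧ x.eval μ + y.eval μ ≤ W := Iff.rfl
@[simp] theorem ok_mul :
    (x * y).Ok W μ ↔ x.Ok W μ ∧ y.Ok W μ ∧ x.eval μ * y.eval μ ≤ W := Iff.rfl
@[simp] theorem ok_sub : (x - y).Ok W μ ↔ x.Ok W μ ∧ y.Ok W μ := Iff.rfl
@[simp] theorem ok_div : (x / y).Ok W μ ↔ x.Ok W μ ∧ y.Ok W μ := Iff.rfl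
@[simp] theorem ok_mod : (x % y).Ok W μ ↔ x.Ok W μ ∧ y.Ok W μ := Iff.rfl
@[simp] theorem ok_size : (size x).Ok W μ ↔ x.Ok W μ := Iff.rfl
@[simp] theorem ok_ld : (ld x).Ok W μ ↔ x.Ok W μ ∧ 64 ≤ x.eval μ := Iff.rfl
end

/-- `1` if the values are equal, and `0` otherwise. -/
def eq (x y : RExpr) : RExpr := (lit 1 - (x - y)) * (lit 1 - (y - x))

@[simp] theorem eval_eq (μ : ℕ → ℕ) (x y : RExpr) :
    (eq x y).eval μ = if x.eval μ = y.eval μ then 1 else 0 := by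
  simp only [eq, eval_mul, eval_sub, eval_lit]
  split_ifs with h
  · simp [h]
  · rcases Nat.lt_or_gt_of_ne h with h | h
    · rw [show 1 - (y.eval μ - x.eval μ) = 0 by omega, mul_zero]
    · rw [show 1 - (x.eval μ - y.eval μ) = 0 by omega, zero_mul]

@[simp] theorem ok_eq (W : ℕ) (μ : ℕ → ℕ) (x y : RExpr) :
    (eq x y).Ok W μ ↔ 1 ≤ W ∧ x.Ok W μ ∧ y.Ok W μ := by
  have : (1 - (x.eval μ - y.eval μ)) * (1 - (y.eval μ - x.eval μ)) ≤ 1 :=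
    Nat.mul_le_mul (Nat.sub_le _ _) (Nat.sub_le _ _)
  simp only [eq, ok_mul, ok_sub, ok_lit, eval_sub, eval_lit]
  constructor
  · tauto
  · intro h
    exact ⟨⟨h.1, h.2⟩, ⟨h.1, h.2.2, h.2.1⟩, this.trans h.1⟩

/-- Code that computes the value into address `k`, using addresses from `k` on as scratch space. -/
def code : RExpr → ℕ → Prog
  | lit v, k => .const k v
  | reg a, k => .seq (.const k 0) (.op .add k a k)
  | bin o x y, k => .seq (x.code k) (.seq (y.code (k + 1)) (.op o k k (k + 1)))
  | size x, k => .seq (x.code k) (.size k k)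
  | ld x, k => .seq (x.code k) (.load k k)

/-- The number of steps of the code. -/
def cost : RExpr → ℕ
  | lit _ => 1
  | reg _ => 2
  | bin _ x y => x.cost + (y.cost + 1)
  | size x => x.cost + 1
  | ld x => x.cost + 1

/-- The number of scratch addresses that the code uses. -/
def depth : RExpr → ℕ
  | lit _ => 1
  | reg _ => 1
  | bin _ x y => max x.depth (y.depth + 1)
  | size x => x.depth
  | ld x => x.depth

section
variable (x y : RExpr)
@[simp] theorem cost_lit (k : ℕ) : (lit k).cost = 1 := rfl
@[simp] theorem cost_reg (a : ℕ) : (reg a).cost = 2 := rfl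
@[simp] theorem cost_add : (x + y).cost = x.cost + (y.cost + 1) := rfl
@[simp] theorem cost_sub : (x - y).cost = x.cost + (y.cost + 1) := rfl
@[simp] theorem cost_mul : (x * y).cost = x.cost + (y.cost + 1) := rfl
@[simp] theorem cost_div : (x / y).cost = x.cost + (y.cost + 1) := rfl
@[simp] theorem cost_mod : (x % y).cost = x.cost + (y.cost + 1) := rfl
@[simp] theorem cost_size : (size x).cost = x.cost + 1 := rfl
@[simp] theorem cost_ld : (ld x).cost = x.cost + 1 := rfl
end

theorem depth_pos (e : RExpr) : 0 < e.depth := by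
  induction e <;> simp_all [depth]

theorem op_eval_le {W : ℕ} {o : Op} {x y : ℕ} (hx : x ≤ W) (h : o = .add → x + y ≤ W)
    (h' : o = .mul → x * y ≤ W) : o.eval x y ≤ W := by
  cases o
  · exact h rfl
  · exact (Nat.sub_le _ _).trans hx
  · exact h' rfl
  · exact (Nat.div_le_self _ _).trans hx
  · exact (Nat.mod_le _ _).trans hx

/-- The first operand waits in cell `k` while the second is evaluated from `k + 1` on. The third
clause, that scratch cells below `k` survive, is there for this. As `Ok` forbids reading scratch
cells, evaluation in the masked memory gives the true value. -/
theorem code_run {B W : ℕ} (E : Env) (hB : 64 ≤ B) (e : RExpr) (k : ℕ) (σ : State)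
    (hk : 40 ≤ k) (hd : k + e.depth ≤ 64) (hok : e.Ok W σ.core.mem) (hσ : σ.Within B W) :
    ((e.code k).run E σ).core = σ.core ∧
    ((e.code k).run E σ).mem k = e.eval σ.core.mem ∧
    (∀ a, 40 ≤ a → a < k → ((e.code k).run E σ).mem a = σ.mem a) ∧
    ((e.code k).run E σ).Within B W ∧
    ((e.code k).run E σ).time = σ.time + e.cost := by
  induction e generalizing k σ with
  | lit v =>
    simp only [depth] at hd
    refine ⟨State.core_put_scratch hk (by omega), ?_, ?_, ?_, rfl⟩
    · simp [code, Prog.run]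
    · intro a _ ha
      simp [code, Prog.run, Function.update_of_ne (show a ≠ k by omega)]
    · exact (hσ.put (by omega) hok).spend 1
  | reg a =>
    simp only [depth] at hd
    have ha : a < 40 := hok
    have hval : ((Prog.const k 0).run E σ).mem a = σ.mem a := by
      simp [Prog.run, Function.update_of_ne (show a ≠ k by omega)]
    have hval' : ((Prog.const k 0).run E σ).mem k = 0 := by simp [Prog.run]
    have hw : ((Prog.const k 0).run E σ).Within B W := (hσ.put (by omega) (Nat.zero_le _)).spend 1
    refine ⟨?_, ?_, ?_, ?_, rfl⟩
    · rw [code, Prog.run_seq, Prog.run_op, State.core_spend, State.core_put_scratch hk (by omega)]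
      exact State.core_put_scratch hk (by omega)
    · rw [code, Prog.run_seq, Prog.run_op, State.spend_mem, State.put_mem, Function.update_self, hval,
        hval']
      simp [Op.eval, State.core, mask_of_not (Or.inl ha)]
    · intro b _ hb
      simp [code, Prog.run, Function.update_of_ne (show b ≠ k by omega)]
    · rw [code, Prog.run_seq, Prog.run_op, hval, hval']
      exact (hw.put (by omega) (by simpa [Op.eval] using hσ.mem_le a)).spend 1
  | bin o x y ihx ihy =>
    simp only [depth] at hd
    have hd1 : k + x.depth ≤ 64 := by omega
    have hd2 : k + 1 + y.depth ≤ 64 := by omega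
    have hpos := y.depth_pos
    have hokx : x.Ok W σ.core.mem := by cases o <;> exact hok.1
    have hoky : y.Ok W σ.core.mem := by
      cases o <;> first | exact hok.2.1 | exact hok.2
    obtain ⟨a1, a2, a3, a4, a5⟩ := ihx k σ hk hd1 hokx hσ
    obtain ⟨b1, b2, b3, b4, b5⟩ := ihy (k + 1) _ (by omega) hd2 (by rw [a1]; exact hoky) a4
    rw [a1] at b1 b2
    have hk' := b3 k hk (by omega)
    rw [a2] at hk'
    simp only [code, Prog.run]
    rw [hk', b2]
    refine ⟨?_, ?_, ?_, ?_, ?_⟩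
    · rw [State.core_spend, State.core_put_scratch hk (by omega), b1]
    · simp [eval]
    · intro a h h'
      rw [State.spend_mem, State.put_mem, Function.update_of_ne (by omega), b3 a h (by omega),
        a3 a h h']
    · refine (b4.put (by omega) (op_eval_le ?_ ?_ ?_)).spend 1
      · rw [← a2]; exact a4.mem_le k
      · rintro rfl; exact hok.2.2
      · rintro rfl; exact hok.2.2
    · rw [State.spend_time, State.put_time, b5, a5, cost]
      omega
  | size x ih =>
    obtain ⟨a1, a2, a3, a4, a5⟩ := ih k σ hk hd hok hσ
    have hpos := x.depth_pos
    simp only [depth] at hd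
    simp only [code, Prog.run]
    rw [a2]
    refine ⟨?_, ?_, ?_, ?_, ?_⟩
    · rw [State.core_spend, State.core_put_scratch hk (by omega), a1]
    · simp
    · intro a h h'
      rw [State.spend_mem, State.put_mem, Function.update_of_ne (by omega), a3 a h h']
    · refine (a4.put (by omega) (le_trans ?_ (a4.mem_le k))).spend 1
      rw [a2]
      exact Nat.size_le.2 Nat.lt_two_pow_self
    · rw [State.spend_time, State.put_time, a5, cost]
      omega
  | ld x ih =>
    obtain ⟨a1, a2, a3, a4, a5⟩ := ih k σ hk hd hok.1 hσ
    have hpos := x.depth_pos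
    simp only [depth] at hd
    simp only [code, Prog.run]
    refine ⟨?_, ?_, ?_, ?_, ?_⟩
    · rw [State.core_spend, State.core_put_scratch hk (by omega), a1]
    · rw [State.spend_mem, State.put_mem, Function.update_self, a2, eval_ld]
      have := congrArg (fun c : Core => c.mem (x.eval σ.core.mem)) a1
      exact (mask_of_not (Or.inr hok.2)).symm.trans this
    · intro a h h'
      rw [State.spend_mem, State.put_mem, Function.update_of_ne (by omega), a3 a h h']
    · exact (a4.put (by omega) (a4.mem_le _)).spend 1
    · rw [State.spend_time, State.put_time, a5, cost]
      omega

end RExpr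

/-! #### Commands and their rules -/

/-- `M[d] := e` -/
def assign (d : ℕ) (e : RExpr) : Prog :=
  .seq (e.code 40) (.seq (.const 41 0) (.op .add d 40 41))

/-- `M[x] := y` -/
def storeAt (x y : RExpr) : Prog := .seq (x.code 40) (.seq (y.code 41) (.store 40 41))

def pushVal (e : RExpr) : Prog := .seq (e.code 40) (.push 40)

def emitVal (e : RExpr) : Prog := .seq (e.code 40) (.emit 40)

def branch (e : RExpr) (p q : Prog) : Prog := .seq (e.code 40) (.ifZero 40 p q)

def repeatVal (e : RExpr) (p : Prog) : Prog := .seq (e.code 40) (.loop 40 p)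

/-- Run `p` with the values `0, 1, …` below that of `e` in the counter `r`. -/
def forLoop (r : ℕ) (e : RExpr) (p : Prog) : Prog :=
  .seq (assign r (.lit 0)) (repeatVal e (.seq p (assign r (.reg r + .lit 1))))

/-- What a program is run in: the environment, a space bound and a bound for the words. -/
structure Setting where
  env : Env
  B : ℕ
  W : ℕ
  hB : 64 ≤ B

/-- From observable state `c`, the program `p` stays within the bounds, takes at most `t` steps and
establishes `Q`. -/
def Run (Γ : Setting) (p : Prog) (t : ℕ) (c : Core) (Q : Core → Prop) : Prop :=
  ∀ σ : State, σ.core = c → σ.Within Γ.B Γ.W →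
    Q (p.run Γ.env σ).core ∧ (p.run Γ.env σ).Within Γ.B Γ.W ∧
      (p.run Γ.env σ).time ≤ σ.time + t

section Rules

variable {Γ : Setting} {c : Core} {Q : Core → Prop}

theorem Run.mono {p : Prog} {t t' : ℕ} {R : Core → Prop} (h : Run Γ p t c R) (ht : t ≤ t')
    (hR : ∀ c', R c' → Q c') : Run Γ p t' c Q := fun σ h1 h2 => by
  obtain ⟨a, b, d⟩ := h σ h1 h2
  exact ⟨hR _ a, b, by omega⟩

theorem Run.seq {p q : Prog} {s : ℕ} (t t' : ℕ) (hs : t + t' ≤ s)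
    (h : Run Γ p t c fun c' => Run Γ q t' c' Q) : Run Γ (.seq p q) s c Q := fun σ h1 h2 => by
  obtain ⟨a, b, d⟩ := h σ h1 h2
  obtain ⟨a', b', d'⟩ := a _ rfl b
  refine ⟨a', b', ?_⟩
  rw [Prog.run]
  omega

theorem Run.skip {s : ℕ} (hs : 1 ≤ s) (h : Q c) : Run Γ .skip s c Q := fun σ h1 h2 => by
  subst h1
  exact ⟨h, h2.spend 1, Nat.add_le_add_left hs _⟩

/-- Common rule for the commands that begin by evaluating an expression into cell 40. The bound 24
is the number of scratch cells. -/
theorem Run.expr {e : RExpr} {p : Prog} {s : ℕ} (t : ℕ) (hs : e.cost + t ≤ s)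
    (hd : e.depth ≤ 24) (hok : e.Ok Γ.W c.mem)
    (h : ∀ σ : State, σ.core = c → σ.mem 40 = e.eval c.mem → σ.Within Γ.B Γ.W →
      Q (p.run Γ.env σ).core ∧ (p.run Γ.env σ).Within Γ.B Γ.W ∧
        (p.run Γ.env σ).time ≤ σ.time + t) :
    Run Γ (.seq (e.code 40) p) s c Q := fun σ h1 h2 => by
  subst h1
  obtain ⟨a1, a2, -, a4, a5⟩ := e.code_run Γ.env Γ.hB 40 σ le_rfl (by omega) hok h2
  obtain ⟨b1, b2, b3⟩ := h _ a1 a2 a4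
  refine ⟨b1, b2, ?_⟩
  rw [Prog.run]
  omega

theorem Run.assign {d s : ℕ} {e : RExpr} (hs : e.cost + 2 ≤ s) (hd : d < 40) (he : e.depth ≤ 24)
    (hok : e.Ok Γ.W c.mem) (h : Q (c.set d (e.eval c.mem))) :
    Run Γ (assign d e) s c Q := by
  have hB := Γ.hB
  refine Run.expr 2 hs he hok fun σ h1 h2 h3 => ?_
  have e1 : ((Prog.const 41 0).run Γ.env σ).mem 40 = e.eval c.mem := by
    rw [← h2]; simp [Prog.run]
  have e2 : ((Prog.const 41 0).run Γ.env σ).mem 41 = 0 := by simp [Prog.run]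
  have e3 : ((Prog.const 41 0).run Γ.env σ).core = c := by
    rw [← h1]
    exact State.core_put_scratch (by norm_num) (by norm_num)
  have e4 : ((Prog.const 41 0).run Γ.env σ).Within Γ.B Γ.W :=
    (h3.put (by omega) (Nat.zero_le _)).spend 1
  rw [Prog.run_seq, Prog.run_op, e1, e2]
  refine ⟨?_, (e4.put (by omega) ?_).spend 1, le_rfl⟩
  · rw [State.core_spend, State.core_put (Or.inl hd), e3]
    exact h
  · rw [← h2]; exact h3.mem_le 40

theorem Run.storeAt {s : ℕ} {x y : RExpr} (hs : x.cost + (y.cost + 1) ≤ s) (hx : x.depth ≤ 24) (hy : y.depth ≤ 23)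
    (hokx : x.Ok Γ.W c.mem) (hoky : y.Ok Γ.W c.mem) (h64 : 64 ≤ x.eval c.mem)
    (hlt : x.eval c.mem < Γ.B) (h : Q (c.set (x.eval c.mem) (y.eval c.mem))) :
    Run Γ (storeAt x y) s c Q := by
  refine Run.expr (y.cost + 1) hs hx hokx fun σ h1 h2 h3 => ?_
  subst h1
  obtain ⟨a1, a2, a3, a4, a5⟩ := y.code_run Γ.env Γ.hB 41 σ (by norm_num) (by omega) hoky h3
  have e1 := a3 40 le_rfl (by norm_num)
  rw [h2] at e1
  rw [Prog.run, Prog.run, e1, a2]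
  refine ⟨?_, (a4.put hlt ?_).spend 1, ?_⟩
  · rw [State.core_spend, State.core_put (Or.inr h64), a1]
    exact h
  · rw [← a2]; exact a4.mem_le _
  · rw [State.spend_time, State.put_time, a5]
    omega

theorem Run.pushVal {s : ℕ} {e : RExpr} (hs : e.cost + 1 ≤ s) (he : e.depth ≤ 24) (hok : e.Ok Γ.W c.mem)
    (h : Q { c with arg := c.arg ++ [e.eval c.mem] }) :
    Run Γ (pushVal e) s c Q := by
  refine Run.expr 1 hs he hok fun σ h1 h2 h3 => ?_
  subst h1
  refine ⟨?_, ⟨h3.mem_le, h3.space_le, h3.top_le⟩, le_rfl⟩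
  rw [← h2] at h
  exact h

theorem Run.emitVal {s : ℕ} {e : RExpr} (hs : e.cost + 1 ≤ s) (he : e.depth ≤ 24) (hok : e.Ok Γ.W c.mem)
    (h : Q { c with out := c.out ++ [e.eval c.mem] }) :
    Run Γ (emitVal e) s c Q := by
  refine Run.expr 1 hs he hok fun σ h1 h2 h3 => ?_
  subst h1
  refine ⟨?_, ⟨h3.mem_le, h3.space_le, h3.top_le⟩, le_rfl⟩
  rw [← h2] at h
  exact h

theorem Run.branch {e : RExpr} {p q : Prog} {s : ℕ} (t : ℕ) (hs : e.cost + (t + 1) ≤ s)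
    (he : e.depth ≤ 24) (hok : e.Ok Γ.W c.mem)
    (hp : e.eval c.mem = 0 → Run Γ p t c Q) (hq : e.eval c.mem ≠ 0 → Run Γ q t c Q) :
    Run Γ (branch e p q) s c Q := by
  refine Run.expr (t + 1) hs he hok fun σ h1 h2 h3 => ?_
  rw [Prog.run, h2]
  split_ifs with h0
  · obtain ⟨a, b, d⟩ := hp h0 (σ.spend 1) h1 (h3.spend 1)
    exact ⟨a, b, by rw [State.spend_time] at d; omega⟩
  · obtain ⟨a, b, d⟩ := hq h0 (σ.spend 1) h1 (h3.spend 1)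
    exact ⟨a, b, by rw [State.spend_time] at d; omega⟩

/-- The number of passes is read from cell 40 once, before the first pass, so the body may reuse the
scratch cells. -/
theorem Run.repeatVal {e : RExpr} {p : Prog} {t : ℕ} (inv : ℕ → Core → Prop) (he : e.depth ≤ 24)
    (hok : e.Ok Γ.W c.mem) (h0 : inv 0 c)
    (hstep : ∀ i < e.eval c.mem, ∀ c', inv i c' → Run Γ p t c' (inv (i + 1)))
    (hend : ∀ c', inv (e.eval c.mem) c' → Q c') :
    Run Γ (repeatVal e p) (e.cost + (1 + e.eval c.mem * (t + 1))) c Q := by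
  refine Run.expr _ le_rfl he hok fun σ h1 h2 h3 => ?_
  have key : ∀ i ≤ e.eval c.mem,
      inv i ((fun τ => (p.run Γ.env τ).spend 1)^[i] (σ.spend 1)).core ∧
      ((fun τ => (p.run Γ.env τ).spend 1)^[i] (σ.spend 1)).Within Γ.B Γ.W ∧
      ((fun τ => (p.run Γ.env τ).spend 1)^[i] (σ.spend 1)).time ≤ σ.time + (1 + i * (t + 1)) := by
    intro i
    induction i with
    | zero =>
      intro _
      refine ⟨?_, h3.spend 1, by simp⟩
      rw [Function.iterate_zero, id, State.core_spend, h1]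
      exact h0
    | succ i ih =>
      intro hi
      obtain ⟨a, b, d⟩ := ih (by omega)
      obtain ⟨a', b', d'⟩ := hstep i (by omega) _ a _ rfl b
      rw [Function.iterate_succ_apply']
      refine ⟨a', b'.spend 1, ?_⟩
      rw [State.spend_time, Nat.succ_mul]
      omega
  rw [Prog.run, h2]
  obtain ⟨a, b, d⟩ := key _ le_rfl
  exact ⟨hend _ a, b, d⟩

/-- The rule for counting loops.  The invariant is stated for the moment before the counter is
set. -/
theorem Run.forLoop {r : ℕ} {e : RExpr} {p : Prog} {s : ℕ} (t N : ℕ) (inv : ℕ → Core → Prop)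
    (hs : e.cost + 4 + N * (t + 7) ≤ s) (hr : r < 40)
    (he : e.depth ≤ 24) (hok : e.Ok Γ.W (c.set r 0).mem) (hN : e.eval (c.set r 0).mem = N)
    (hNW : N ≤ Γ.W) (hW : 1 ≤ Γ.W)
    (hinv : ∀ i c' x, inv i c' → inv i (c'.set r x)) (h0 : inv 0 c)
    (hstep : ∀ i < N, ∀ c', c'.mem r = i → inv i c' →
      Run Γ p t c' fun c'' => c''.mem r = i ∧ inv (i + 1) c'')
    (hend : ∀ c', inv N c' → Q c') :
    Run Γ (forLoop r e p) s c Q := by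
  -- Three steps set the counter; a pass costs `t` for the body, 6 for the increment and 1 for the
  -- loop.
  refine Run.seq 3 _
    (by change 3 + (e.cost + (1 + N * (t + 7))) ≤ s; omega :
      3 + (e.cost + (1 + N * (t + 6 + 1))) ≤ s)
    (Run.assign le_rfl hr (by decide) (by simp) ?_)
  subst hN
  refine Run.repeatVal (fun i c' => c'.mem r = i ∧ inv i c') he hok ⟨by simp, hinv 0 _ _ h0⟩ ?_
    fun c' h => hend c' h.2
  rintro i hi c' ⟨h1, h2⟩
  refine Run.seq t 6 le_rfl ((hstep i hi c' h1 h2).mono le_rfl ?_)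
  rintro c'' ⟨h3, h4⟩
  refine Run.assign (by simp) hr (by change max 1 (1 + 1) ≤ 24; decide) ?_ ?_
  · simp only [RExpr.ok_add, RExpr.ok_reg, RExpr.ok_lit, RExpr.eval_reg, RExpr.eval_lit, h3]
    omega
  · refine ⟨?_, hinv _ _ _ h4⟩
    simp [h3]

/-- Positivity of the range keeps the drawn word below `M[a]`, and thus within the word bound. -/
theorem Run.rand {d a s : ℕ} (hs : 1 ≤ s) (hd : d < 40) (ha : a < 40) (hpos : 0 < c.mem a)
    (h : Q { c.set d (Γ.env.coins (c.draws, c.mem a - 1) : ℕ) with draws := c.draws + 1 }) :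
    Run Γ (.rand d a) s c Q := fun σ h1 h2 => by
  have hB := Γ.hB
  subst h1
  have e : σ.core.mem a = σ.mem a := mask_of_not (Or.inl ha)
  rw [e] at h hpos
  have hlt : (Γ.env.coins (σ.draws, σ.mem a - 1) : ℕ) < σ.mem a - 1 + 1 := Fin.isLt _
  have hle := h2.mem_le a
  have hw := (h2.put (a := d) (x := (Γ.env.coins (σ.draws, σ.mem a - 1) : ℕ)) (by omega)
    (by omega)).spend 1
  refine ⟨?_, ⟨hw.mem_le, hw.space_le, hw.top_le⟩, Nat.add_le_add_left hs _⟩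
  have hc := State.core_put (σ := σ) (a := d) (x := (Γ.env.coins (σ.draws, σ.mem a - 1) : ℕ))
    (Or.inl hd)
  have : ((Prog.rand d a).run Γ.env σ).core =
      { (σ.put d (Γ.env.coins (σ.draws, σ.mem a - 1) : ℕ)).core with draws := σ.draws + 1 } := rfl
  rw [this, hc]
  exact h

/-- Memory after a list has been written from address `b` on. -/
def writeList (μ : ℕ → ℕ) (b : ℕ) (L : List ℕ) (a : ℕ) : ℕ :=
  if b ≤ a ∧ a < b + L.length then L.getD (a - b) 0 else μ a

theorem State.putList_spec {B W : ℕ} (L : List ℕ) (b : ℕ) (σ : State) (hb : 64 ≤ b)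
    (hB : b + L.length ≤ B) (hL : ∀ x ∈ L, x ≤ W) (hσ : σ.Within B W) :
    (State.putList b L σ).core = { σ.core with mem := writeList σ.core.mem b L } ∧
      (State.putList b L σ).Within B W ∧ (State.putList b L σ).time = σ.time := by
  induction L generalizing b σ with
  | nil =>
    refine ⟨?_, hσ, rfl⟩
    have : writeList σ.core.mem b [] = σ.core.mem := by
      funext a
      unfold writeList
      rw [if_neg (by simp)]
    rw [this]
    rfl
  | cons x L ih =>
    simp only [List.length_cons] at hB
    obtain ⟨h1, h2, h3⟩ := ih (b + 1) (σ.put b x) (by omega) (by omega)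
      (fun y hy => hL y (List.mem_cons_of_mem _ hy))
      (hσ.put (by omega) (hL x List.mem_cons_self))
    refine ⟨?_, h2, h3⟩
    rw [State.putList, h1, State.core_put (Or.inr hb)]
    have : writeList (σ.core.set b x).mem (b + 1) L = writeList σ.core.mem b (x :: L) := by
      funext a
      unfold writeList
      rw [Core.set_mem, List.length_cons]
      by_cases hab : a = b
      · subst hab
        rw [if_neg (by omega), if_pos (by omega)]
        simp
      · rw [Function.update_of_ne hab]
        by_cases h : b + 1 ≤ a ∧ a < b + 1 + L.length
        · rw [if_pos h, if_pos (by omega), show a - b = (a - (b + 1)) + 1 by omega]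
          simp
        · rw [if_neg h, if_neg (by omega)]
    rw [this]
    rfl

theorem State.call_spec {B W : ℕ} (S : Subroutine) (b : ℕ) (σ : State) (hb : 64 ≤ b)
    (hB : b + (S.answer σ.arg).length ≤ B) (hL : ∀ x ∈ S.answer σ.arg, x ≤ W)
    (hσ : σ.Within B W) :
    (σ.call S b).core =
        { σ.core with mem := writeList σ.core.mem b (S.answer σ.arg), arg := [] } ∧
      (σ.call S b).Within B W ∧
      (σ.call S b).time = σ.time + (1 + S.cost σ.arg + (S.answer σ.arg).length) := by
  obtain ⟨h1, h2, h3⟩ := State.putList_spec (S.answer σ.arg) b { σ with arg := [] } hb hB hL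
    ⟨hσ.mem_le, hσ.space_le, hσ.top_le⟩
  refine ⟨?_, h2.spend _, ?_⟩
  · rw [State.call, State.core_spend, h1]
    rfl
  · rw [State.call, State.spend_time, h3]

theorem Run.callCls {a s : ℕ}
    (hs : 1 + Γ.env.cls.cost c.arg + (Γ.env.cls.answer c.arg).length ≤ s) (ha : a < 40) (h64 : 64 ≤ c.mem a)
    (hB : c.mem a + (Γ.env.cls.answer c.arg).length ≤ Γ.B)
    (hL : ∀ x ∈ Γ.env.cls.answer c.arg, x ≤ Γ.W)
    (h : Q { c with
      mem := writeList c.mem (c.mem a) (Γ.env.cls.answer c.arg)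
      arg := [] }) :
    Run Γ (.callCls a) s c Q := fun σ h1 h2 => by
  subst h1
  have e : σ.core.mem a = σ.mem a := mask_of_not (Or.inl ha)
  rw [e] at h64 hB h
  obtain ⟨a1, a2, a3⟩ := State.call_spec Γ.env.cls (σ.mem a) σ h64 hB hL h2
  rw [Prog.run]
  exact ⟨a1 ▸ h, a2, a3.le.trans (Nat.add_le_add_left hs _)⟩

theorem Run.callCor {a s : ℕ}
    (hs : 1 + Γ.env.cor.cost c.arg + (Γ.env.cor.answer c.arg).length ≤ s) (ha : a < 40) (h64 : 64 ≤ c.mem a)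
    (hB : c.mem a + (Γ.env.cor.answer c.arg).length ≤ Γ.B)
    (hL : ∀ x ∈ Γ.env.cor.answer c.arg, x ≤ Γ.W)
    (h : Q { c with
      mem := writeList c.mem (c.mem a) (Γ.env.cor.answer c.arg)
      arg := [] }) :
    Run Γ (.callCor a) s c Q := fun σ h1 h2 => by
  subst h1
  have e : σ.core.mem a = σ.mem a := mask_of_not (Or.inl ha)
  rw [e] at h64 hB h
  obtain ⟨a1, a2, a3⟩ := State.call_spec Γ.env.cor (σ.mem a) σ h64 hB hL h2
  rw [Prog.run]
  exact ⟨a1 ▸ h, a2, a3.le.trans (Nat.add_le_add_left hs _)⟩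

end Rules

end FairConsensus

namespace FairConsensus

/-! ### The algorithm

Registers: `0, 1, 2` hold `n`, `m`, `⌈1/ε⌉`; `3, …, 6` the current triple; `7` the number `S` of
clusterings from which candidates are formed; `8` the number `T` of sampled clusterings; `9` the
least cost of a candidate so far; `20, 21, 22` the base addresses of the labels of the sampled
clusterings, of the current and of the best candidate.  The sampled indices are stored from
address `64` on. -/

open RExpr in
def drawLoop : Prog :=
  forLoop 15 (reg 8) (.seq (.rand 16 1) (storeAt (lit 64 + reg 15) (reg 16)))

open RExpr in
-- Every point starts as its own label, as if all clusters were singletons.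
def rowLoop : Prog :=
  forLoop 15 (reg 8 * reg 0) (storeAt (reg 20 + reg 15) (reg 15 % reg 0))

open RExpr in
-- Here S = C·size(m) and T = S·⌈1/ε⌉². The T indices are followed by T rows of n labels, then by n
-- cells for the current candidate and n for the best one.
def initProg (C : ℕ) : Prog :=
  .seq (assign 7 (lit C * size (reg 1))) <|
  .seq (assign 8 (reg 7 * (reg 2 * reg 2))) <|
  .seq (assign 20 (lit 64 + reg 8)) <|
  .seq (assign 21 (reg 20 + reg 8 * reg 0)) <|
  .seq (assign 22 (reg 21 + reg 0)) <|
  .seq drawLoop rowLoop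

open RExpr in
/-- Replace the label of the point in register `p` by the point in register `q`, if that is
smaller. -/
def lower (p q : ℕ) : Prog :=
  -- With truncated subtraction, x − (x − y) is the minimum of x and y.
  storeAt (reg 16 + reg p) (ld (reg 16 + reg p) - (ld (reg 16 + reg p) - reg q))

open RExpr in
-- The tested value is zero exactly if the sampled index is that of the triple and the triple says
-- "together". All rows are scanned, because an index may have been drawn several times.
def updateProg : Prog :=
  forLoop 15 (reg 8) <|
    branch (lit 1 - eq (ld (lit 64 + reg 15)) (reg 5) + reg 6)
      (.seq (assign 16 (reg 20 + reg 15 * reg 0)) (.seq (lower 3 4) (lower 4 3)))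
      .skip

open RExpr in
/-- `1` if the sample and the current candidate disagree on the pair that is encoded by the counter
`15`, and `0` otherwise. -/
def disagreeExpr : RExpr :=
  -- The counter is (t·n + u)·n + v, so its quotient by n is already the offset of the label of u in
  -- row t.
  lit 1 - eq
    (eq (ld (reg 20 + reg 15 / reg 0))
      (ld (reg 20 + (reg 15 / reg 0 / reg 0 * reg 0 + reg 15 % reg 0))))
    (eq (ld (reg 21 + reg 15 / reg 0 % reg 0)) (ld (reg 21 + reg 15 % reg 0)))

open RExpr in
def costLoop : Prog :=
  .seq (assign 10 (lit 0)) (forLoop 15 (reg 8 * (reg 0 * reg 0)) (assign 10 (reg 10 + disagreeExpr)))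

open RExpr in
def copyLoop : Prog :=
  forLoop 15 (reg 0) (storeAt (reg 22 + reg 15) (ld (reg 21 + reg 15)))

open RExpr in
/-- Compare the current candidate with the best one. -/
def consider : Prog :=
  .seq costLoop (branch (reg 9 - reg 10) .skip (.seq (assign 9 (reg 10)) copyLoop))

open RExpr in
def clsLoop : Prog :=
  forLoop 11 (reg 7) <|
    .seq (forLoop 15 (reg 0) (pushVal (ld (reg 20 + (reg 11 * reg 0 + reg 15)))))
      (.seq (.callCls 21) consider)

open RExpr in
/-- `1` if the pair that is encoded by the counter `15` is together in the clustering whose labels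
start at the address in register `r`. -/
def together (r : ℕ) : RExpr :=
  eq (ld (reg r + reg 15 / reg 0)) (ld (reg r + reg 15 % reg 0))

open RExpr in
-- Integer division by 2 turns a count of at most three votes into 1 exactly from two votes on; the
-- last factor clears the diagonal of the adjacency matrix.
def majorityExpr : RExpr :=
  (together 12 + (together 13 + together 14)) / lit 2 * (lit 1 - eq (reg 15 / reg 0) (reg 15 % reg 0))

open RExpr in
-- The counter runs through all ordered triples of samples, written in base S and with repetitions.
def corLoop : Prog :=
  forLoop 11 (reg 7 * (reg 7 * reg 7)) <|
    .seq (assign 12 (reg 20 + reg 11 / reg 7 / reg 7 * reg 0)) <|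
    .seq (assign 13 (reg 20 + reg 11 / reg 7 % reg 7 * reg 0)) <|
    .seq (assign 14 (reg 20 + reg 11 % reg 7 * reg 0)) <|
    .seq (forLoop 15 (reg 0 * reg 0) (pushVal majorityExpr))
      (.seq (.callCor 21) consider)

open RExpr in
def emitLoop : Prog := forLoop 15 (reg 0) (emitVal (ld (reg 22 + reg 15)))

open RExpr in
-- The initial best value T·n² + 1 plays the role of infinity: a sample cost is at most T·n².
def queryProg : Prog :=
  .seq (assign 9 (reg 8 * (reg 0 * reg 0) + lit 1)) (.seq clsLoop (.seq corLoop emitLoop))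

def algorithm (C : ℕ) : StreamAlg := ⟨initProg C, updateProg, queryProg⟩

/-! #### Memory layout -/

/-- Registers that keep their values after the initialization. -/
structure Regs (n m S T : ℕ) (c : Core) : Prop where
  r0 : c.mem 0 = n
  r1 : c.mem 1 = m
  r7 : c.mem 7 = S
  r8 : c.mem 8 = T
  r20 : c.mem 20 = 64 + T
  r21 : c.mem 21 = 64 + T + T * n
  r22 : c.mem 22 = 64 + T + T * n + n

variable {n m S T : ℕ} {c c' : Core}

theorem Regs.congr (h : Regs n m S T c)
    (hmem : ∀ a ∈ [0, 1, 7, 8, 20, 21, 22], c'.mem a = c.mem a) : Regs n m S T c' := by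
  simp only [List.forall_mem_cons, List.not_mem_nil, false_imp_iff, implies_true, and_true] at hmem
  obtain ⟨h0, h1, h7, h8, h20, h21, h22⟩ := hmem
  exact ⟨h0 ▸ h.r0, h1 ▸ h.r1, h7 ▸ h.r7, h8 ▸ h.r8, h20 ▸ h.r20, h21 ▸ h.r21, h22 ▸ h.r22⟩

theorem Regs.set (h : Regs n m S T c) {d : ℕ} (x : ℕ)
    (hd : d ∉ [0, 1, 7, 8, 20, 21, 22]) : Regs n m S T (c.set d x) :=
  h.congr fun a ha => Function.update_of_ne (by rintro rfl; exact hd ha) _ _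

/-- The space is sufficient and words are large enough. -/
structure Room (n m S T : ℕ) (Γ : Setting) : Prop where
  npos : 0 < n
  mpos : 0 < m
  space : Γ.B = 64 + T + T * n + n + n
  addr : 64 + T + T * n + n + n ≤ Γ.W
  cost : T * (n * n) + 1 ≤ Γ.W
  triples : S * (S * S) ≤ Γ.W
  pairs : n * n ≤ Γ.W
  le : S ≤ T

theorem not_mem_regs_of_le {d : ℕ} (h : 64 ≤ d) : d ∉ [0, 1, 7, 8, 20, 21, 22] := by
  intro h'
  simp at h'
  omega

theorem mul_add_lt {t u : ℕ} (ht : t < T) (hu : u < n) : t * n + u < T * n := by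
  have : (t + 1) * n ≤ T * n := Nat.mul_le_mul_right n ht
  rw [Nat.succ_mul] at this
  omega

theorem mul_add_inj {t t' u u' : ℕ} (hu : u < n) (hu' : u' < n) (h : t * n + u = t' * n + u') :
    t = t' ∧ u = u' := by
  have hn : 0 < n := by omega
  have h1 : (t * n + u) / n = t := by
    rw [mul_comm, Nat.mul_add_div hn, Nat.div_eq_of_lt hu, add_zero]
  have h2 : (t' * n + u') / n = t' := by
    rw [mul_comm, Nat.mul_add_div hn, Nat.div_eq_of_lt hu', add_zero]
  have ht : t = t' := by rw [← h1, h, h2]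
  subst ht
  exact ⟨rfl, by omega⟩

/-- The labels of the sampled clusterings. -/
def Rows (n T : ℕ) (lab : ℕ → ℕ → ℕ) (c : Core) : Prop :=
  ∀ t < T, ∀ u < n, c.mem (64 + T + (t * n + u)) = lab t u

/-- The sampled indices. -/
def Indices (T : ℕ) (X : ℕ → ℕ) (c : Core) : Prop := ∀ t < T, c.mem (64 + t) = X t

/-! #### Initialization -/

theorem drawLoop_run {Γ : Setting} (hΓ : Room n m S T Γ) (hc : Regs n m S T c)
    (hdraws : c.draws = 0) :
    Run Γ drawLoop (20 + 20 * T) c fun c' => Regs n m S T c' ∧ c'.arg = c.arg ∧ c'.out = c.out ∧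
      Indices T (fun t => (Γ.env.coins (t, m - 1) : ℕ)) c' := by
  have := hΓ.addr
  have := hΓ.space
  have := hΓ.npos
  -- The invariant equates the number of draws with the counter, so the t-th index comes from the
  -- entry `(t, m - 1)` of the random source.
  refine Run.forLoop 8 T (fun i c' => Regs n m S T c' ∧ c'.arg = c.arg ∧
      c'.out = c.out ∧ c'.draws = i ∧
      ∀ t < i, c'.mem (64 + t) = (Γ.env.coins (t, m - 1) : ℕ)) (by simp; omega)
    (by decide) (by decide) (by simp) (by simpa using hc.r8) (by omega) (by omega) ?_
    ⟨hc, rfl, rfl, hdraws, by simp⟩ ?_ ?_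
  · rintro i c' x ⟨h1, h2, h3, h4, h5⟩
    refine ⟨h1.set x (by decide), h2, h3, h4, fun t ht => ?_⟩
    rw [Core.set_mem, Function.update_of_ne (by omega), h5 t ht]
  · rintro i hi c' hi' ⟨h1, h2, h3, h4, h5⟩
    refine Run.seq 1 7 le_rfl (Run.rand le_rfl (by decide) (by decide) (h1.r1 ▸ hΓ.mpos) ?_)
    rw [h1.r1, h4]
    refine Run.storeAt (by decide) (by decide) (by decide) ?_ (by simp) ?_ ?_ ?_
    · simp [hi']; omega
    · simp [hi']
    · simp [hi']; omega
    · have hr := (h1.set (d := 16) (Γ.env.coins (i, m - 1) : ℕ) (by decide)).set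
        (d := 64 + i) (Γ.env.coins (i, m - 1) : ℕ) (not_mem_regs_of_le (by omega))
      simp only [RExpr.eval_add, RExpr.eval_lit, RExpr.eval_reg, Core.set_mem,
        Function.update_self, Function.update_of_ne (show (15 : ℕ) ≠ 16 by decide), hi']
      refine ⟨?_, hr.congr fun _ _ => rfl, h2, h3, rfl, fun t ht => ?_⟩
      · simp [Function.update_of_ne (show 15 ≠ 64 + i by omega), hi']
      · rcases Nat.lt_succ_iff_lt_or_eq.1 ht with ht | rfl
        · simp [Function.update_of_ne (show 64 + t ≠ 64 + i by omega),
            Function.update_of_ne (show 64 + t ≠ 16 by omega), h5 t ht]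
        · simp
  · rintro c' ⟨h1, h2, h3, -, h5⟩
    exact ⟨h1, h2, h3, h5⟩

theorem Indices.set {X : ℕ → ℕ} (h : Indices T X c) {d : ℕ} (x : ℕ) (hd : d < 64 ∨ 64 + T ≤ d) :
    Indices T X (c.set d x) := fun t ht => by
  rw [Core.set_mem, Function.update_of_ne (by omega), h t ht]

theorem rowLoop_run {Γ : Setting} (hΓ : Room n m S T Γ) (hc : Regs n m S T c) {X : ℕ → ℕ}
    (hX : Indices T X c) :
    Run Γ rowLoop (20 + 20 * (T * n)) c fun c' => Regs n m S T c' ∧ c'.arg = c.arg ∧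
      c'.out = c.out ∧ Indices T X c' ∧ Rows n T (fun _ u => u) c' := by
  have := hΓ.addr
  have := hΓ.space
  have := hΓ.npos
  refine Run.forLoop 11 (T * n) (fun i c' => Regs n m S T c' ∧ c'.arg = c.arg ∧
      c'.out = c.out ∧ Indices T X c' ∧ ∀ q < i, c'.mem (64 + T + q) = q % n) (by simp; omega)
    (by decide) (by decide) ?_ ?_ (by omega) (by omega) ?_
    ⟨hc, rfl, rfl, hX, by simp⟩ ?_ ?_
  · simp [hc.r8, hc.r0]; omega
  · simp [hc.r8, hc.r0]
  · rintro i c' x ⟨h1, h2, h3, h4, h5⟩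
    refine ⟨h1.set x (by decide), h2, h3, h4.set x (by omega), fun t ht => ?_⟩
    rw [Core.set_mem, Function.update_of_ne (by omega), h5 t ht]
  · rintro i hi c' hi' ⟨h1, h2, h3, h4, h5⟩
    refine Run.storeAt (by decide) (by decide) (by decide) ?_ (by simp) ?_ ?_ ?_
    · simp [hi', h1.r20]; omega
    · simp [hi', h1.r20]; omega
    · simp [hi', h1.r20]; omega
    · simp only [RExpr.eval_add, RExpr.eval_mod, RExpr.eval_reg, hi', h1.r20, h1.r0]
      refine ⟨?_, h1.set _ (not_mem_regs_of_le (by omega)), h2, h3, h4.set _ (by omega),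
        fun t ht => ?_⟩
      · simp [Function.update_of_ne (show 15 ≠ 64 + T + i by omega), hi']
      · rcases Nat.lt_succ_iff_lt_or_eq.1 ht with ht | rfl
        · simp [Function.update_of_ne (show 64 + T + t ≠ 64 + T + i by omega), h5 t ht]
        · simp
  · rintro c' ⟨h1, h2, h3, h4, h5⟩
    refine ⟨h1, h2, h3, h4, fun t ht u hu => ?_⟩
    rw [h5 _ (mul_add_lt ht hu), mul_comm, Nat.mul_add_mod, Nat.mod_eq_of_lt hu]

theorem initProg_run {Γ : Setting} {C e : ℕ} (hΓ : Room n m S T Γ) (hS : S = C * Nat.size m)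
    (hT : T = S * (e * e)) (hC : C ≤ Γ.W) (he : e * e ≤ Γ.W) (h0 : c.mem 0 = n) (h1 : c.mem 1 = m)
    (h2 : c.mem 2 = e) (hdraws : c.draws = 0) :
    Run Γ (initProg C) (200 + 20 * T + 20 * (T * n)) c fun c' => Regs n m S T c' ∧
      c'.arg = c.arg ∧ c'.out = c.out ∧
      Indices T (fun t => (Γ.env.coins (t, m - 1) : ℕ)) c' ∧ Rows n T (fun _ u => u) c' := by
  have := hΓ.addr
  have := hΓ.space
  have := hΓ.npos
  have := hΓ.le
  refine Run.seq 7 _ (by omega : 7 + (193 + 20 * T + 20 * (T * n)) ≤ _) (Run.assign (by simp)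
    (by decide) (by change max 1 (1 + 1) ≤ 24; decide) (by simp [h1, ← hS]; omega) ?_)
  simp only [RExpr.eval_mul, RExpr.eval_lit, RExpr.eval_size, RExpr.eval_reg, h1, ← hS]
  refine Run.seq 10 _ (by omega : 10 + (183 + 20 * T + 20 * (T * n)) ≤ _) (Run.assign (by decide)
    (by decide) (by decide) (by simp [h2, ← hT]; omega) ?_)
  refine Run.seq 10 _ (by omega : 10 + (173 + 20 * T + 20 * (T * n)) ≤ _) (Run.assign (by decide)
    (by decide) (by decide) (by simp [h2, ← hT]; omega) ?_)
  refine Run.seq 10 _ (by omega : 10 + (163 + 20 * T + 20 * (T * n)) ≤ _) (Run.assign (by decide)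
    (by decide) (by decide) (by simp [h2, h0, ← hT]; omega) ?_)
  refine Run.seq 10 _ (by omega : 10 + (153 + 20 * T + 20 * (T * n)) ≤ _) (Run.assign (by decide)
    (by decide) (by decide) (by simp [h2, h0, ← hT]; omega) ?_)
  refine Run.seq (20 + 20 * T) (20 + 20 * (T * n)) (by omega) ((drawLoop_run (S := S) (T := T)
    (n := n) (m := m) hΓ ?_ ?_).mono le_rfl ?_)
  · constructor <;> simp [h0, h1, h2, ← hT]
  · exact hdraws
  · rintro c' ⟨a1, a2, a3, a4⟩
    refine (rowLoop_run hΓ a1 a4).mono le_rfl ?_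
    rintro c'' ⟨b1, b2, b3, b4, b5⟩
    exact ⟨b1, b2.trans a2, b3.trans a3, b4, b5⟩

end FairConsensus

namespace FairConsensus

variable {n m S T : ℕ} {c c' : Core}

/-! #### Processing a triple -/

theorem Rows.set {lab : ℕ → ℕ → ℕ} (h : Rows n T lab c) {d : ℕ} (x : ℕ)
    (hd : d < 64 + T ∨ 64 + T + T * n ≤ d) : Rows n T lab (c.set d x) := fun t ht u hu => by
  have := mul_add_lt ht hu
  rw [Core.set_mem, Function.update_of_ne (by omega), h t ht u hu]

theorem Rows.set_row {lab : ℕ → ℕ → ℕ} (h : Rows n T lab c) {i w : ℕ} (hw : w < n)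
    (x : ℕ) : Rows n T (Function.update lab i (Function.update (lab i) w x))
      (c.set (64 + T + (i * n + w)) x) := fun t ht u hu => by
  by_cases hti : t = i
  · subst hti
    by_cases huw : u = w
    · subst huw
      simp
    · have : t * n + u ≠ t * n + w := by omega
      rw [Core.set_mem, Function.update_of_ne (by omega), h t ht u hu, Function.update_self,
        Function.update_of_ne huw]
  · have : t * n + u ≠ i * n + w := fun e => hti (mul_add_inj hu hw e).1
    rw [Core.set_mem, Function.update_of_ne (by omega), h t ht u hu, Function.update_of_ne hti]

theorem Rows.congr_lab {lab lab' : ℕ → ℕ → ℕ} (h : Rows n T lab c)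
    (he : ∀ t < T, ∀ u < n, lab t u = lab' t u) : Rows n T lab' c := fun t ht u hu => by
  rw [h t ht u hu, he t ht u hu]

def lowerRow (row : ℕ → ℕ) (p q : ℕ) : ℕ → ℕ := Function.update row p (min (row p) q)

/-- The effect of a triple on the labels. -/
def labStep (X : ℕ → ℕ) (u v j b : ℕ) (lab : ℕ → ℕ → ℕ) (t : ℕ) : ℕ → ℕ :=
  if X t = j ∧ b = 0 then lowerRow (lowerRow (lab t) u v) v u else lab t

theorem lower_run {Γ : Setting} {Q : Core → Prop} (hΓ : Room n m S T Γ) {lab : ℕ → ℕ → ℕ}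
    (hlab : Rows n T lab c) {p q i x y : ℕ} (hp : p < 40) (hq : q < 40) (hi : i < T) (hx : x < n)
    (h16 : c.mem 16 = 64 + T + i * n) (hcp : c.mem p = x) (hcq : c.mem q = y)
    (h : Q (c.set (64 + T + (i * n + x)) (min (lab i x) y))) :
    Run Γ (lower p q) 24 c Q := by
  have := hΓ.addr
  have := hΓ.space
  have := mul_add_lt hi hx
  have e : c.mem (64 + T + i * n + x) = lab i x := by rw [add_assoc, hlab i hi x hx]
  refine Run.storeAt (by simp) (show 2 ≤ 24 by decide) (show 3 ≤ 23 by decide) ?_ ?_ ?_ ?_ ?_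
  · simp [hp, h16, hcp]; omega
  · simp [hp, hq, h16, hcp]; omega
  · simp [h16, hcp]; omega
  · simp [h16, hcp]; omega
  · simp only [RExpr.eval_add, RExpr.eval_sub, RExpr.eval_ld, RExpr.eval_reg, h16, hcp, hcq, e]
    rw [Nat.sub_sub_eq_min, add_assoc]
    exact h

theorem updateProg_run {Γ : Setting} (hΓ : Room n m S T Γ) (hc : Regs n m S T c) {X : ℕ → ℕ}
    (hX : Indices T X c) {lab : ℕ → ℕ → ℕ} (hlab : Rows n T lab c) {u v j b : ℕ} (hu : u < n)
    (hv : v < n) (hb : b ≤ 1) (h3 : c.mem 3 = u) (h4 : c.mem 4 = v) (h5 : c.mem 5 = j)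
    (h6 : c.mem 6 = b) :
    Run Γ updateProg (20 + 120 * T) c fun c' => Regs n m S T c' ∧ c'.arg = c.arg ∧
      c'.out = c.out ∧ Indices T X c' ∧ Rows n T (labStep X u v j b lab) c' := by
  have := hΓ.addr
  have := hΓ.space
  have := hΓ.npos
  -- Rows below the counter have been updated, the others are still the old ones.
  refine Run.forLoop 110 T (fun i c' => Regs n m S T c' ∧ c'.arg = c.arg ∧
      c'.out = c.out ∧ Indices T X c' ∧
      (c'.mem 3 = u ∧ c'.mem 4 = v ∧ c'.mem 5 = j ∧ c'.mem 6 = b) ∧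
      Rows n T (fun t => if t < i then labStep X u v j b lab t else lab t) c') (by simp; omega)
    (by decide) (by decide) (by simp) (by simpa using hc.r8) (by omega) (by omega) ?_
    ⟨hc, rfl, rfl, hX, ⟨h3, h4, h5, h6⟩, by simpa using hlab⟩ ?_ ?_
  · rintro i c' x ⟨h1, h2, h3, h4, h5, h6⟩
    exact ⟨h1.set x (by decide), h2, h3, h4.set x (by omega), by simpa using h5,
      h6.set x (by omega)⟩
  · clear h3 h4 h5 h6
    rintro i hi c' hi' ⟨h1, h2, h3, h4, ⟨r3, r4, r5, r6⟩, h6⟩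
    have hidx := h4 i hi
    have hin := mul_add_lt hi hΓ.npos
    refine Run.branch 80 (by decide) (by decide) ?_ ?_ ?_
    · simp [hi', hidx, r5, r6]
      refine ⟨by omega, ?_⟩
      split_ifs <;> omega
    · intro hcond
      simp [hi', hidx, r5, r6] at hcond
      have hcond' : X i = j ∧ b = 0 := by
        refine ⟨?_, hcond.2⟩
        by_contra hne
        rw [if_neg hne] at hcond
        omega
      refine Run.seq 10 48 (by norm_num) (Run.assign (by decide) (by decide) (by decide) ?_ ?_)
      · simp [hi', h1.r20, h1.r0]; omega
      simp only [RExpr.eval_add, RExpr.eval_mul, RExpr.eval_reg, hi', h1.r20, h1.r0]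
      refine Run.seq 24 24 (by norm_num) (lower_run (y := v) hΓ (h6.set _ (by omega)) (by decide) (by decide)
        hi hu (by simp) (by simp [r3]) (by simp [r4]) ?_)
      have hne : ∀ w, ∀ a < 40, a ≠ 64 + T + (i * n + w) := by intros; omega
      refine lower_run (y := u) hΓ ((h6.set _ (by omega)).set_row hu _) (by decide) (by decide)
        hi hv ?_ ?_ ?_ ?_
      · simp [Function.update_of_ne (hne u 16 (by decide))]
      · simp [Function.update_of_ne (hne u 4 (by decide)), r4]
      · simp [Function.update_of_ne (hne u 3 (by decide)), r3]
      refine ⟨?_, ?_, h2, h3, ?_, ?_, ?_⟩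
      · simp [Function.update_of_ne (hne _ 15 (by decide)), hi']
      · exact ((h1.set _ (by decide)).set _ (not_mem_regs_of_le (by omega))).set _
          (not_mem_regs_of_le (by omega))
      · exact ((h4.set _ (by omega)).set _ (by omega)).set _ (by omega)
      · simp [Function.update_of_ne (hne _ 3 (by decide)),
          Function.update_of_ne (hne _ 4 (by decide)), Function.update_of_ne (hne _ 5 (by decide)),
          Function.update_of_ne (hne _ 6 (by decide)), r3, r4, r5, r6]
      · refine Rows.congr_lab (((h6.set _ (by omega)).set_row hu _).set_row hv _) fun t _ w _ => ?_
        by_cases hti : t = i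
        · subst hti
          simp [labStep, hcond', lowerRow]
        · rw [Function.update_of_ne hti, Function.update_of_ne hti]
          have : t < i + 1 ↔ t < i := by omega
          simp [this]
    · intro hcond
      simp [hi', hidx, r5, r6] at hcond
      have hcond' : ¬ (X i = j ∧ b = 0) := by
        rintro ⟨e1, e2⟩
        simp [e1] at hcond
        exact hcond e2
      refine Run.skip (by decide) ⟨hi', h1, h2, h3, h4, ⟨r3, r4, r5, r6⟩, ?_⟩
      refine h6.congr_lab fun t _ w _ => ?_
      by_cases hti : t = i
      · subst hti
        simp [labStep, hcond']
      · have : t < i + 1 ↔ t < i := by omega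
        simp [this]
  · rintro c' ⟨h1, h2, h3, h4, -, h6⟩
    refine ⟨h1, h2, h3, h4, h6.congr_lab fun t ht w _ => ?_⟩
    simp [ht]

end FairConsensus

namespace FairConsensus

variable {n m S T : ℕ} {c c' : Core}

/-! #### Evaluating candidates -/

/-- `L` is stored from address `b` on. -/
def Buffer (n b : ℕ) (L : List ℕ) (c : Core) : Prop := ∀ u < n, c.mem (b + u) = L.getD u 0

theorem Rows.flat {lab : ℕ → ℕ → ℕ} (h : Rows n T lab c) {q : ℕ} (hq : q < T * n) :
    c.mem (64 + T + q) = lab (q / n) (q % n) := by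
  have hn : 0 < n := Nat.pos_of_ne_zero (by rintro rfl; simp at hq)
  have := h (q / n) ((Nat.div_lt_iff_lt_mul hn).2 hq) (q % n) (Nat.mod_lt _ hn)
  rwa [mul_comm, Nat.div_add_mod] at this

/-- Whether the labels of sample `t` and the labels `L` disagree about the pair `u`, `v`. -/
def pairCost (lab : ℕ → ℕ → ℕ) (L : List ℕ) (t u v : ℕ) : ℕ :=
  if (lab t u = lab t v) = (L.getD u 0 = L.getD v 0) then 0 else 1

theorem pairCost_le (lab : ℕ → ℕ → ℕ) (L : List ℕ) (t u v : ℕ) : pairCost lab L t u v ≤ 1 := by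
  unfold pairCost
  split_ifs <;> simp

/-- The cost of `L` on the samples, over ordered pairs. -/
def sampleCost (n T : ℕ) (lab : ℕ → ℕ → ℕ) (L : List ℕ) : ℕ :=
  ∑ q ∈ Finset.range (T * (n * n)), pairCost lab L (q / n / n) (q / n % n) (q % n)

theorem sum_pairCost_le (lab : ℕ → ℕ → ℕ) (L : List ℕ) (i : ℕ) :
    ∑ q ∈ Finset.range i, pairCost lab L (q / n / n) (q / n % n) (q % n) ≤ i :=
  (Finset.sum_le_card_nsmul _ _ 1 fun _ _ => pairCost_le _ _ _ _ _).trans (by simp)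

theorem disagreeExpr_spec {W : ℕ} {lab : ℕ → ℕ → ℕ} {L : List ℕ} (hn : 0 < n)
    (hW : 64 + T + T * n + n + n ≤ W) (hc : Regs n m S T c) (hlab : Rows n T lab c)
    (hL : Buffer n (64 + T + T * n) L c) (hq : c.mem 15 < T * (n * n)) :
    disagreeExpr.Ok W c.mem ∧ disagreeExpr.eval c.mem =
      pairCost lab L (c.mem 15 / n / n) (c.mem 15 / n % n) (c.mem 15 % n) := by
  obtain ⟨q, hq'⟩ : ∃ q, q = c.mem 15 := ⟨_, rfl⟩
  rw [← hq'] at hq ⊢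
  have h1 : q / n < T * n := by
    rw [Nat.div_lt_iff_lt_mul hn, mul_assoc]
    exact hq
  have h2 : q / n / n < T := by rwa [Nat.div_lt_iff_lt_mul hn]
  have h3 : q % n < n := Nat.mod_lt _ hn
  have h4 : q / n % n < n := Nat.mod_lt _ hn
  have h5 := mul_add_lt h2 h3
  have e1 := hlab.flat h1
  have e2 := hlab _ h2 _ h3
  have e3 := hL _ h3
  have e4 := hL _ h4
  constructor
  · clear e1 e2 e3 e4
    have h6 : q / n / n * n ≤ q / n := Nat.div_mul_le_self _ _
    simp [disagreeExpr, hc.r20, hc.r21, hc.r0, ← hq']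
    generalize q / n / n * n = a at *
    generalize q / n % n = b at *
    generalize q % n = d at *
    generalize q / n = f at *
    omega
  · simp only [disagreeExpr, RExpr.eval_sub, RExpr.eval_lit, RExpr.eval_eq, RExpr.eval_ld,
      RExpr.eval_add, RExpr.eval_mul, RExpr.eval_div, RExpr.eval_mod, RExpr.eval_reg, hc.r20,
      hc.r21, hc.r0, ← hq', e1, e2, e3, e4, pairCost]
    by_cases a : lab (q / n / n) (q / n % n) = lab (q / n / n) (q % n) <;>
      by_cases b : L.getD (q / n % n) 0 = L.getD (q % n) 0 <;>
        simp [a, b, -List.getD_eq_getElem?_getD]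

theorem costLoop_run {Γ : Setting} (hΓ : Room n m S T Γ) (hc : Regs n m S T c)
    {lab : ℕ → ℕ → ℕ} (hlab : Rows n T lab c) {L : List ℕ}
    (hL : Buffer n (64 + T + T * n) L c) :
    Run Γ costLoop (20 + 260 * (T * (n * n))) c fun c' => c'.arg = c.arg ∧ c'.out = c.out ∧
      c'.mem 10 = sampleCost n T lab L ∧ ∀ a, a ≠ 10 → a ≠ 15 → c'.mem a = c.mem a := by
  have := hΓ.addr
  have := hΓ.npos
  have := hΓ.cost
  have := hΓ.pairs
  refine Run.seq 3 (17 + 260 * (T * (n * n))) (by omega)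
    (Run.assign (by decide) (by decide) (by decide) (by simp) ?_)
  refine Run.forLoop 250 (T * (n * n)) (fun i c' => c'.arg = c.arg ∧ c'.out = c.out ∧
      c'.mem 10 = ∑ q ∈ Finset.range i, pairCost lab L (q / n / n) (q / n % n) (q % n) ∧
      ∀ a, a ≠ 10 → a ≠ 15 → c'.mem a = c.mem a) (by simp; omega)
    (by decide) (by decide) ?_ ?_ (by omega) (by omega) ?_ ⟨rfl, rfl, ?_, ?_⟩ ?_ ?_
  · simp [hc.r0, hc.r8]; omega
  · simp [hc.r0, hc.r8]
  · rintro i c' x ⟨h1, h2, h3, h4⟩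
    refine ⟨h1, h2, by simpa using h3, fun a ha ha' => ?_⟩
    rw [Core.set_mem, Function.update_of_ne ha', h4 a ha ha']
  · simp
  · intro a ha _
    rw [Core.set_mem, Function.update_of_ne ha]
  · rintro i hi c' hi' ⟨h1, h2, h3, h4⟩
    have hc' : Regs n m S T c' := hc.congr fun a ha => h4 a (by rintro rfl; revert ha; decide)
      (by rintro rfl; revert ha; decide)
    have hlab' : Rows n T lab c' := fun t ht u hu => by
      rw [h4 _ (by omega) (by omega), hlab t ht u hu]
    have hL' : Buffer n (64 + T + T * n) L c' := fun u hu => by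
      rw [h4 _ (by omega) (by omega), hL u hu]
    obtain ⟨hok, hev⟩ := disagreeExpr_spec hΓ.npos hΓ.addr hc' hlab' hL' (hi' ▸ hi)
    rw [hi'] at hev
    -- A partial sum is at most its number of terms, which keeps the accumulator within the word
    -- bound.
    have hle := sum_pairCost_le (n := n) lab L i
    have hle' := pairCost_le lab L (i / n / n) (i / n % n) (i % n)
    refine Run.assign (by decide) (by decide) (by decide) ?_ ?_
    · simp only [RExpr.ok_add, RExpr.ok_reg, RExpr.eval_reg, h3, hev]
      exact ⟨by decide, hok, by omega⟩
    · simp only [RExpr.eval_add, RExpr.eval_reg, hev, h3]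
      refine ⟨by simpa using hi', h1, h2, ?_, fun a ha ha' => ?_⟩
      · rw [Core.set_mem, Function.update_self, Finset.sum_range_succ]
      · rw [Core.set_mem, Function.update_of_ne ha, h4 a ha ha']
  · rintro c' ⟨h1, h2, h3, h4⟩
    exact ⟨h1, h2, h3, h4⟩

theorem copyLoop_run {Γ : Setting} (hΓ : Room n m S T Γ) (hc : Regs n m S T c) {L : List ℕ}
    (hL : Buffer n (64 + T + T * n) L c) :
    Run Γ copyLoop (20 + 30 * n) c fun c' => c'.arg = c.arg ∧ c'.out = c.out ∧
      Buffer n (64 + T + T * n + n) L c' ∧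
      ∀ a, a ≠ 15 → a < 64 + T + T * n + n → c'.mem a = c.mem a := by
  have := hΓ.addr
  have := hΓ.npos
  have := hΓ.space
  refine Run.forLoop 20 n (fun i c' => c'.arg = c.arg ∧ c'.out = c.out ∧
      (∀ u < i, c'.mem (64 + T + T * n + n + u) = L.getD u 0) ∧
      ∀ a, a ≠ 15 → a < 64 + T + T * n + n → c'.mem a = c.mem a) (by simp; omega)
    (by decide) (by decide) (by simp) (by simpa using hc.r0) (by omega) (by omega) ?_
    ⟨rfl, rfl, by simp, fun _ _ _ => rfl⟩ ?_ ?_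
  · rintro i c' x ⟨h1, h2, h3, h4⟩
    refine ⟨h1, h2, fun u hu => ?_, fun a ha ha' => ?_⟩
    · rw [Core.set_mem, Function.update_of_ne (by omega), h3 u hu]
    · rw [Core.set_mem, Function.update_of_ne ha, h4 a ha ha']
  · rintro i hi c' hi' ⟨h1, h2, h3, h4⟩
    have r21 : c'.mem 21 = _ := (h4 21 (by decide) (by omega)).trans hc.r21
    have r22 : c'.mem 22 = _ := (h4 22 (by decide) (by omega)).trans hc.r22
    have hv := (h4 (64 + T + T * n + i) (by omega) (by omega)).trans (hL i hi)
    refine Run.storeAt (by decide) (by decide) (by decide) ?_ ?_ ?_ ?_ ?_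
    · simp [hi', r22]; omega
    · simp [hi', r21]; omega
    · simp [hi', r22]; omega
    · simp [hi', r22]; omega
    · simp only [RExpr.eval_add, RExpr.eval_ld, RExpr.eval_reg, hi', r21, r22, hv]
      refine ⟨?_, h1, h2, fun u hu => ?_, fun a ha ha' => ?_⟩
      · rw [Core.set_mem, Function.update_of_ne (by omega), hi']
      · rcases Nat.lt_succ_iff_lt_or_eq.1 hu with hu | rfl
        · rw [Core.set_mem, Function.update_of_ne (by omega), h3 u hu]
        · simp
      · rw [Core.set_mem, Function.update_of_ne (by omega), h4 a ha ha']
  · rintro c' ⟨h1, h2, h3, h4⟩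
    exact ⟨h1, h2, h3, h4⟩

/-- The best candidate so far: `Done` are the candidates that have been considered, and `All` those
that may be considered. -/
structure Best (n T : ℕ) (lab : ℕ → ℕ → ℕ) (All Done : Set (List ℕ)) (c : Core) : Prop where
  le : ∀ L ∈ Done, c.mem 9 ≤ sampleCost n T lab L
  eq : c.mem 9 = T * (n * n) + 1 ∨ ∃ L ∈ All, c.mem 9 = sampleCost n T lab L ∧
    Buffer n (64 + T + T * n + n) L c

theorem Best.congr {lab : ℕ → ℕ → ℕ} {All Done : Set (List ℕ)} (h : Best n T lab All Done c)
    (h9 : c'.mem 9 = c.mem 9)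
    (hbuf : ∀ u < n, c'.mem (64 + T + T * n + n + u) = c.mem (64 + T + T * n + n + u)) :
    Best n T lab All Done c' := by
  refine ⟨fun L hL => h9 ▸ h.le L hL, ?_⟩
  rw [h9]
  refine h.eq.imp id ?_
  rintro ⟨L, h1, h2, h3⟩
  exact ⟨L, h1, h2, fun u hu => (hbuf u hu).trans (h3 u hu)⟩

theorem sampleCost_le (lab : ℕ → ℕ → ℕ) (L : List ℕ) : sampleCost n T lab L ≤ T * (n * n) :=
  sum_pairCost_le lab L _

theorem consider_run {Γ : Setting} (hΓ : Room n m S T Γ) (hc : Regs n m S T c)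
    {lab : ℕ → ℕ → ℕ} (hlab : Rows n T lab c) {L : List ℕ}
    (hL : Buffer n (64 + T + T * n) L c) {All Done : Set (List ℕ)}
    (hbest : Best n T lab All Done c) (hAll : L ∈ All) :
    Run Γ consider (60 + 260 * (T * (n * n)) + 30 * n) c fun c' => c'.arg = c.arg ∧
      c'.out = c.out ∧ Best n T lab All (insert L Done) c' ∧
      ∀ a, a ≠ 9 → a ≠ 10 → a ≠ 15 → a < 64 + T + T * n → c'.mem a = c.mem a := by
  refine Run.seq (20 + 260 * (T * (n * n))) (40 + 30 * n) (by omega)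
    ((costLoop_run hΓ hc hlab hL).mono le_rfl ?_)
  rintro c₁ ⟨h1, h2, h3, h4⟩
  have h9 := h4 9 (by decide) (by decide)
  -- The truncated difference vanishes exactly if the new candidate is not strictly better, and then
  -- the old one is kept.
  refine Run.branch (30 + 30 * n) (by simp; omega) (by decide) (by simp) ?_ ?_
  · intro hcond
    simp only [RExpr.eval_sub, RExpr.eval_reg, h3, h9] at hcond
    refine Run.skip (by omega) ⟨h1, h2, ?_, fun a _ ha ha' _ => h4 a ha ha'⟩
    have hb : Best n T lab All Done c₁ := hbest.congr h9 fun u _ => h4 _ (by omega) (by omega)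
    refine ⟨fun L' hL' => ?_, hb.eq⟩
    rcases hL' with rfl | hL'
    · rw [h9]; omega
    · exact hb.le L' hL'
  · intro hcond
    simp only [RExpr.eval_sub, RExpr.eval_reg, h3, h9] at hcond
    refine Run.seq 4 (20 + 30 * n) (by omega)
      (Run.assign (by decide) (by decide) (by decide) (by simp) ?_)
    simp only [RExpr.eval_reg, h3]
    have hc₁ : Regs n m S T (c₁.set 9 (sampleCost n T lab L)) :=
      (hc.congr fun a ha => h4 a (by rintro rfl; revert ha; decide)
        (by rintro rfl; revert ha; decide)).set _ (by decide)
    have hL₁ : Buffer n (64 + T + T * n) L (c₁.set 9 (sampleCost n T lab L)) := fun u hu => by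
      rw [Core.set_mem, Function.update_of_ne (by omega), h4 _ (by omega) (by omega), hL u hu]
    refine (copyLoop_run hΓ hc₁ hL₁).mono le_rfl ?_
    rintro c₂ ⟨k1, k2, k3, k4⟩
    have k9 : c₂.mem 9 = sampleCost n T lab L :=
      (k4 9 (by decide) (by omega)).trans (by simp)
    refine ⟨k1.trans h1, k2.trans h2, ⟨fun L' hL' => ?_, Or.inr ⟨L, hAll, k9, k3⟩⟩, ?_⟩
    · rw [k9]
      rcases hL' with rfl | hL'
      · exact le_rfl
      · have := hbest.le L' hL'
        omega
    · intro a ha ha' ha'' hlt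
      rw [k4 a ha'' (by omega), Core.set_mem, Function.update_of_ne ha, h4 a ha' ha'']

end FairConsensus

namespace FairConsensus

variable {n m S T : ℕ} {c c' : Core}

/-! #### The query -/

theorem Best.mono {lab : ℕ → ℕ → ℕ} {All Done Done' : Set (List ℕ)}
    (h : Best n T lab All Done c) (hD : Done' ⊆ Done) : Best n T lab All Done' c :=
  ⟨fun L hL => h.le L (hD hL), h.eq⟩

/-- Both kinds of subroutine arguments are written by such a loop. Pushing leaves the memory alone,
so `e` is only evaluated in memories that differ from the initial one in the counter. -/
theorem pushLoop_run {Γ : Setting} {e e' : RExpr} {N s t : ℕ} (f : ℕ → ℕ)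
    (hs : e'.cost + 4 + N * (t + 7) ≤ s) (ht : e.cost + 1 ≤ t) (hd : e.depth ≤ 24)
    (hd' : e'.depth ≤ 24) (hok : e'.Ok Γ.W (c.set 15 0).mem) (hN : e'.eval (c.set 15 0).mem = N)
    (hNW : N ≤ Γ.W) (hW : 1 ≤ Γ.W)
    (he : ∀ i < N, ∀ c' : Core, c'.mem 15 = i → (∀ a, a ≠ 15 → c'.mem a = c.mem a) →
      e.Ok Γ.W c'.mem ∧ e.eval c'.mem = f i) :
    Run Γ (forLoop 15 e' (pushVal e)) s c fun c' => c'.out = c.out ∧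
      c'.arg = c.arg ++ (List.range N).map f ∧ ∀ a, a ≠ 15 → c'.mem a = c.mem a := by
  refine Run.forLoop t N (fun i c' => c'.out = c.out ∧
      c'.arg = c.arg ++ (List.range i).map f ∧ ∀ a, a ≠ 15 → c'.mem a = c.mem a) hs (by decide)
    hd' hok hN hNW hW ?_ ⟨rfl, by simp, fun _ _ => rfl⟩ ?_ fun _ h => h
  · rintro i c' x ⟨h1, h2, h3⟩
    refine ⟨h1, h2, fun a ha => ?_⟩
    rw [Core.set_mem, Function.update_of_ne ha, h3 a ha]
  · rintro i hi c' hi' ⟨h1, h2, h3⟩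
    obtain ⟨hok', hev⟩ := he i hi c' hi' h3
    refine Run.pushVal ht hd hok' ⟨hi', h1, ?_, h3⟩
    rw [hev, h2, List.range_succ, List.map_append, List.append_assoc]
    rfl

/-- The argument for the closest fair clustering subroutine. -/
def clsArg (n : ℕ) (lab : ℕ → ℕ → ℕ) (t : ℕ) : List ℕ := (List.range n).map (lab t)

/-- Whether the pair that is encoded by `p` is together in sample `t`. -/
def tog (n : ℕ) (lab : ℕ → ℕ → ℕ) (t p : ℕ) : ℕ := if lab t (p / n) = lab t (p % n) then 1 else 0

/-- The argument for the fair correlation clustering subroutine. -/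
def corArg (n S : ℕ) (lab : ℕ → ℕ → ℕ) (q : ℕ) : List ℕ :=
  (List.range (n * n)).map fun p =>
    (tog n lab (q / S / S) p + (tog n lab (q / S % S) p + tog n lab (q % S) p)) / 2
      * (1 - if p / n = p % n then 1 else 0)

theorem tog_le (lab : ℕ → ℕ → ℕ) (t p : ℕ) : tog n lab t p ≤ 1 := by
  unfold tog; split_ifs <;> simp

/-- What holds before and after each candidate. -/
structure QueryInv (n m S T : ℕ) (lab : ℕ → ℕ → ℕ) (All Done : Set (List ℕ)) (c : Core) :
    Prop where
  regs : Regs n m S T c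
  rows : Rows n T lab c
  arg : c.arg = []
  out : c.out = []
  best : Best n T lab All Done c

theorem QueryInv.set {lab : ℕ → ℕ → ℕ} {All Done : Set (List ℕ)}
    (h : QueryInv n m S T lab All Done c) {d : ℕ} (x : ℕ) (hd : 10 ≤ d) (hd' : d < 20) :
    QueryInv n m S T lab All Done (c.set d x) := by
  refine ⟨h.regs.set x ?_, h.rows.set x (by omega), h.arg, h.out, h.best.congr ?_ ?_⟩
  · intro h'
    simp at h'
    omega
  · rw [Core.set_mem, Function.update_of_ne (by omega)]
  · intro u _
    rw [Core.set_mem, Function.update_of_ne (by omega)]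

theorem QueryInv.mono {lab : ℕ → ℕ → ℕ} {All Done Done' : Set (List ℕ)}
    (h : QueryInv n m S T lab All Done c) (hD : Done' ⊆ Done) :
    QueryInv n m S T lab All Done' c :=
  ⟨h.regs, h.rows, h.arg, h.out, h.best.mono hD⟩

/-- Considering the answer of a subroutine. -/
theorem consider_answer_run {Γ : Setting} (hΓ : Room n m S T Γ) {lab : ℕ → ℕ → ℕ}
    {All Done : Set (List ℕ)} {L : List ℕ} (hLn : L.length = n) (hAll : L ∈ All)
    (hc : Regs n m S T c) (hrows : Rows n T lab c) (hout : c.out = [])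
    (hbest : Best n T lab All Done c) :
    Run Γ consider (60 + 260 * (T * (n * n)) + 30 * n)
      { c with mem := writeList c.mem (c.mem 21) L, arg := [] } fun c' =>
        QueryInv n m S T lab All (insert L Done) c' ∧ c'.mem 11 = c.mem 11 := by
  -- The answer fills exactly the n cells of the current candidate; registers and rows lie below
  -- them, the best candidate above.
  have hlow : ∀ a < 64 + T + T * n, writeList c.mem (c.mem 21) L a = c.mem a := by
    intro a ha
    rw [hc.r21, writeList, if_neg (by omega)]
  have hhigh : ∀ a ≥ 64 + T + T * n + n, writeList c.mem (c.mem 21) L a = c.mem a := by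
    intro a ha
    rw [hc.r21, writeList, if_neg (by omega)]
  have hregs : ∀ {c₁ c₂ : Core}, Regs n m S T c₁ →
      (∀ a, a ≠ 9 → a ≠ 10 → a ≠ 15 → a < 64 + T + T * n → c₂.mem a = c₁.mem a) →
      Regs n m S T c₂ := by
    intro c₁ c₂ h h'
    refine h.congr fun a ha => h' a ?_ ?_ ?_ ?_
    · rintro rfl; revert ha; decide
    · rintro rfl; revert ha; decide
    · rintro rfl; revert ha; decide
    · by_contra hlt
      exact not_mem_regs_of_le (by omega) ha
  have hrowsc : ∀ {c₁ c₂ : Core}, Rows n T lab c₁ →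
      (∀ a, a ≠ 9 → a ≠ 10 → a ≠ 15 → a < 64 + T + T * n → c₂.mem a = c₁.mem a) →
      Rows n T lab c₂ := by
    intro c₁ c₂ h h' t ht u hu
    have := mul_add_lt ht hu
    rw [h' _ (by omega) (by omega) (by omega) (by omega), h t ht u hu]
  have hr := hregs (c₂ := { c with mem := writeList c.mem (c.mem 21) L, arg := [] }) hc
    fun a _ _ _ h => hlow a h
  have hw := hrowsc (c₂ := { c with mem := writeList c.mem (c.mem 21) L, arg := [] }) hrows
    fun a _ _ _ h => hlow a h
  refine (consider_run hΓ hr hw (L := L) ?_ (hbest.congr (hlow 9 (by omega))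
    fun u _ => hhigh _ (by omega)) hAll).mono le_rfl ?_
  · intro u hu
    rw [hc.r21]
    dsimp only
    rw [writeList, if_pos (by omega), Nat.add_sub_cancel_left]
  · rintro c' ⟨h1, h2, h3, h4⟩
    exact ⟨⟨hregs hr h4, hrowsc hw h4, h1, h2.trans hout, h3⟩,
      (h4 11 (by decide) (by decide) (by decide) (by omega)).trans (hlow 11 (by omega))⟩

theorem clsLoop_run {Γ : Setting} (hΓ : Room n m S T Γ) {lab : ℕ → ℕ → ℕ}
    {All : Set (List ℕ)} {t₁ : ℕ}
    (hlen : ∀ t < S, (Γ.env.cls.answer (clsArg n lab t)).length = n)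
    (hlt : ∀ t < S, ∀ x ∈ Γ.env.cls.answer (clsArg n lab t), x < n)
    (hcost : ∀ t < S, Γ.env.cls.cost (clsArg n lab t) ≤ t₁)
    (hAll : ∀ t < S, Γ.env.cls.answer (clsArg n lab t) ∈ All)
    (hc : QueryInv n m S T lab All ∅ c) :
    Run Γ clsLoop (20 + S * (100 + 260 * (T * (n * n)) + 70 * n + t₁)) c
      (QueryInv n m S T lab All {L | ∃ t < S, L = Γ.env.cls.answer (clsArg n lab t)}) := by
  have := hΓ.addr
  have := hΓ.npos
  have := hΓ.space
  have := hΓ.le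
  refine Run.forLoop (93 + 260 * (T * (n * n)) + 70 * n + t₁) S (fun i =>
      QueryInv n m S T lab All {L | ∃ t < i, L = Γ.env.cls.answer (clsArg n lab t)})
    ?_ (by decide) (by decide) (by simp) (by simpa using hc.regs.r7) (by omega) (by omega)
    (fun i c' x h => h.set x (by decide) (by decide)) (hc.mono (by simp)) ?_ fun _ h => h
  · rw [show 93 + 260 * (T * (n * n)) + 70 * n + t₁ + 7 =
      100 + 260 * (T * (n * n)) + 70 * n + t₁ by omega]
    simp
  · rintro i hi c' hi' h
    have hiT : i < T := by omega
    refine Run.seq (20 + 30 * n) (73 + 260 * (T * (n * n)) + 40 * n + t₁) (by omega)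
      ((pushLoop_run (t := 20) (N := n) (lab i) (by simp; omega) (by decide) (by decide) (by decide)
        (by simp) (by simpa using h.regs.r0) (by omega) (by omega) ?_).mono le_rfl ?_)
    · intro u hu c₁ hu' hmem
      have hi₁ : c₁.mem 11 = i := (hmem 11 (by decide)).trans hi'
      have r0 : c₁.mem 0 = n := (hmem 0 (by decide)).trans h.regs.r0
      have r20 : c₁.mem 20 = 64 + T := (hmem 20 (by decide)).trans h.regs.r20
      have hlt := mul_add_lt hiT hu
      constructor
      · simp [hi₁, r0, r20, hu']
        omega
      · simp only [RExpr.eval_ld, RExpr.eval_add, RExpr.eval_mul, RExpr.eval_reg, hi₁, r0, r20, hu']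
        rw [hmem _ (by omega), h.rows i hiT u hu]
    · rintro c₁ ⟨k1, k2, k3⟩
      have harg : c₁.arg = clsArg n lab i := by rw [k2, h.arg]; rfl
      have hr : Regs n m S T c₁ := h.regs.congr fun a ha => k3 a (by rintro rfl; revert ha; decide)
      have hrows : Rows n T lab c₁ := fun t ht u hu => by
        rw [k3 _ (by omega), h.rows t ht u hu]
      have hl := hlen i hi
      have hco := hcost i hi
      refine Run.seq (1 + t₁ + n) (60 + 260 * (T * (n * n)) + 30 * n) (by omega)
        (Run.callCls ?_ (by decide) ?_ ?_ ?_ ?_)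
      · rw [harg, hl]; omega
      · rw [hr.r21]; omega
      · rw [hr.r21, harg, hl]; omega
      · intro x hx
        rw [harg] at hx
        have := hlt i hi x hx
        omega
      · rw [harg]
        refine (consider_answer_run hΓ hl (hAll i hi) hr hrows (k1.trans h.out)
          (h.best.congr (k3 9 (by decide)) fun u _ => k3 _ (by omega))).mono le_rfl ?_
        rintro c₂ ⟨l1, l2⟩
        refine ⟨l2.trans ((k3 11 (by decide)).trans hi'), l1.mono ?_⟩
        rintro L ⟨t, ht, rfl⟩
        rcases Nat.lt_succ_iff_lt_or_eq.1 ht with ht | rfl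
        · exact Or.inr ⟨t, ht, rfl⟩
        · exact Or.inl rfl

theorem majorityExpr_spec {W i j k p : ℕ} {lab : ℕ → ℕ → ℕ} (hn : 0 < n)
    (hW : 64 + T + T * n + n + n ≤ W) (hlab : Rows n T lab c) (hi : i < T) (hj : j < T) (hk : k < T)
    (hp : p < n * n) (r0 : c.mem 0 = n) (r12 : c.mem 12 = 64 + T + i * n)
    (r13 : c.mem 13 = 64 + T + j * n) (r14 : c.mem 14 = 64 + T + k * n) (r15 : c.mem 15 = p) :
    majorityExpr.Ok W c.mem ∧ majorityExpr.eval c.mem =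
      (tog n lab i p + (tog n lab j p + tog n lab k p)) / 2
        * (1 - if p / n = p % n then 1 else 0) := by
  have h1 : p / n < n := (Nat.div_lt_iff_lt_mul hn).2 hp
  have h2 : p % n < n := Nat.mod_lt _ hn
  have tog_spec : ∀ (r t : ℕ), r < 40 → t < T → c.mem r = 64 + T + t * n →
      (together r).Ok W c.mem ∧ (together r).eval c.mem = tog n lab t p := by
    intro r t hr ht hrt
    have e1 := hlab t ht _ h1
    have e2 := hlab t ht _ h2
    have h3 := mul_add_lt ht h1
    have h4 := mul_add_lt ht h2
    constructor
    · clear e1 e2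
      simp [together, hrt, r0, r15, hr]
      generalize p / n = a at *
      generalize p % n = b at *
      omega
    · simp only [together, RExpr.eval_eq, RExpr.eval_ld, RExpr.eval_add, RExpr.eval_div,
        RExpr.eval_mod, RExpr.eval_reg, hrt, r0, r15, add_assoc _ (t * n), e1, e2, tog]
  obtain ⟨a1, a2⟩ := tog_spec 12 i (by decide) hi r12
  obtain ⟨b1, b2⟩ := tog_spec 13 j (by decide) hj r13
  obtain ⟨d1, d2⟩ := tog_spec 14 k (by decide) hk r14
  have t1 := tog_le (n := n) lab i p
  have t2 := tog_le (n := n) lab j p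
  have t3 := tog_le (n := n) lab k p
  constructor
  · simp only [majorityExpr, RExpr.ok_mul, RExpr.ok_div, RExpr.ok_add, RExpr.ok_sub, RExpr.ok_lit,
      RExpr.ok_eq, RExpr.ok_mod, RExpr.ok_reg, a1, b1, d1, RExpr.eval_add, RExpr.eval_div,
      RExpr.eval_sub, RExpr.eval_lit, a2, b2, d2]
    have hle : (tog n lab i p + (tog n lab j p + tog n lab k p)) / 2 ≤ 1 := by omega
    refine ⟨⟨⟨trivial, ⟨trivial, trivial, by omega⟩, by omega⟩, by omega⟩,
      ⟨by omega, by omega, ⟨by decide, by decide⟩, by decide, by decide⟩, ?_⟩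
    refine (Nat.mul_le_mul hle (Nat.sub_le _ _)).trans ?_
    omega
  · simp only [majorityExpr, RExpr.eval_mul, RExpr.eval_add, RExpr.eval_div, RExpr.eval_sub,
      RExpr.eval_lit, RExpr.eval_eq, RExpr.eval_mod, RExpr.eval_reg, a2, b2, d2, r0, r15]

theorem corLoop_run {Γ : Setting} (hΓ : Room n m S T Γ) {lab : ℕ → ℕ → ℕ}
    {All Done : Set (List ℕ)} {t₂ : ℕ}
    (hlen : ∀ q < S * (S * S), (Γ.env.cor.answer (corArg n S lab q)).length = n)
    (hlt : ∀ q < S * (S * S), ∀ x ∈ Γ.env.cor.answer (corArg n S lab q), x < n)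
    (hcost : ∀ q < S * (S * S), Γ.env.cor.cost (corArg n S lab q) ≤ t₂)
    (hAll : ∀ q < S * (S * S), Γ.env.cor.answer (corArg n S lab q) ∈ All)
    (hc : QueryInv n m S T lab All Done c) :
    Run Γ corLoop
      (20 + S * (S * S) * (200 + 260 * (T * (n * n)) + 200 * (n * n) + 40 * n + t₂)) c
      (QueryInv n m S T lab All
        (Done ∪ {L | ∃ q < S * (S * S), L = Γ.env.cor.answer (corArg n S lab q)})) := by
  have := hΓ.addr
  have := hΓ.npos
  have := hΓ.space
  have := hΓ.le
  have := hΓ.triples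
  have := hΓ.pairs
  refine Run.forLoop (193 + 260 * (T * (n * n)) + 200 * (n * n) + 40 * n + t₂) (S * (S * S))
    (fun i => QueryInv n m S T lab All
        (Done ∪ {L | ∃ q < i, L = Γ.env.cor.answer (corArg n S lab q)}))
    ?_ (by decide) (by decide) ?_ ?_ (by omega) (by omega)
    (fun i c' x h => h.set x (by decide) (by decide)) (hc.mono (by simp)) ?_ fun _ h => h
  · rw [show 193 + 260 * (T * (n * n)) + 200 * (n * n) + 40 * n + t₂ + 7 =
      200 + 260 * (T * (n * n)) + 200 * (n * n) + 40 * n + t₂ by omega]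
    simp
  · simp [hc.regs.r7]
    refine ⟨?_, by omega⟩
    nlinarith
  · simp [hc.regs.r7]
  · rintro q hq c' hq' h
    have hS : 0 < S := Nat.pos_of_ne_zero (by rintro rfl; simp at hq)
    have hi : q / S / S < T := by
      refine lt_of_lt_of_le ?_ hΓ.le
      rw [Nat.div_lt_iff_lt_mul hS, Nat.div_lt_iff_lt_mul hS, mul_assoc]
      exact hq
    have hj : q / S % S < T := (Nat.mod_lt _ hS).trans_le hΓ.le
    have hk : q % S < T := (Nat.mod_lt _ hS).trans_le hΓ.le
    have hrow : ∀ t < T, t * n ≤ T * n := fun t ht => Nat.mul_le_mul_right n ht.le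
    have hri := hrow _ hi
    have hrj := hrow _ hj
    have hrk := hrow _ hk
    have hqS := Nat.div_le_self q S
    refine Run.seq 20 (173 + 260 * (T * (n * n)) + 200 * (n * n) + 40 * n + t₂) (by omega)
      (Run.assign (by decide) (by decide) (by decide) ?_ ?_)
    · simp [h.regs.r20, h.regs.r7, h.regs.r0, hq']
      omega
    simp only [RExpr.eval_add, RExpr.eval_mul, RExpr.eval_div, RExpr.eval_reg, h.regs.r20,
      h.regs.r7, h.regs.r0, hq']
    have h12 := h.set (d := 12) (64 + T + q / S / S * n) (by decide) (by decide)
    have q12 : (c'.set 12 (64 + T + q / S / S * n)).mem 11 = q := by simpa using hq'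
    refine Run.seq 20 (153 + 260 * (T * (n * n)) + 200 * (n * n) + 40 * n + t₂) (by omega)
      (Run.assign (by decide) (by decide) (by decide) ?_ ?_)
    · simp [h.regs.r20, h.regs.r7, h.regs.r0, hq']
      omega
    simp only [RExpr.eval_add, RExpr.eval_mul, RExpr.eval_div, RExpr.eval_mod, RExpr.eval_reg,
      h12.regs.r20, h12.regs.r7, h12.regs.r0, q12]
    have h13 := h12.set (d := 13) (64 + T + q / S % S * n) (by decide) (by decide)
    have q13 : ((c'.set 12 (64 + T + q / S / S * n)).set 13 (64 + T + q / S % S * n)).mem 11 = q := by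
      simpa using hq'
    refine Run.seq 20 (133 + 260 * (T * (n * n)) + 200 * (n * n) + 40 * n + t₂) (by omega)
      (Run.assign (by decide) (by decide) (by decide) ?_ ?_)
    · simp [h.regs.r20, h.regs.r7, h.regs.r0, hq']
      omega
    simp only [RExpr.eval_add, RExpr.eval_mul, RExpr.eval_mod, RExpr.eval_reg,
      h13.regs.r20, h13.regs.r7, h13.regs.r0, q13]
    obtain ⟨c₀, hc₀⟩ : ∃ c₀, c₀ = ((c'.set 12 (64 + T + q / S / S * n)).set 13
      (64 + T + q / S % S * n)).set 14 (64 + T + q % S * n) := ⟨_, rfl⟩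
    rw [← hc₀]
    have h₀ : QueryInv n m S T lab All
        (Done ∪ {L | ∃ q' < q, L = Γ.env.cor.answer (corArg n S lab q')}) c₀ := by
      rw [hc₀]
      exact ((h.set _ (by decide) (by decide)).set _ (by decide) (by decide)).set _
        (by decide) (by decide)
    have r11 : c₀.mem 11 = q := by rw [hc₀]; simp [hq']
    have r12 : c₀.mem 12 = 64 + T + q / S / S * n := by rw [hc₀]; simp
    have r13 : c₀.mem 13 = 64 + T + q / S % S * n := by rw [hc₀]; simp
    have r14 : c₀.mem 14 = 64 + T + q % S * n := by rw [hc₀]; simp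
    refine Run.seq (20 + 200 * (n * n)) (113 + 260 * (T * (n * n)) + 40 * n + t₂) (by omega)
      ((pushLoop_run (t := 193) (N := n * n) (fun p =>
        (tog n lab (q / S / S) p + (tog n lab (q / S % S) p + tog n lab (q % S) p)) / 2
          * (1 - if p / n = p % n then 1 else 0)) (by simp; omega) (by decide)
        (by decide) (by decide) ?_ ?_ (by omega) (by omega) ?_).mono le_rfl ?_)
    · simp [h₀.regs.r0]; omega
    · simp [h₀.regs.r0]
    · intro p hp c₁ hp' hmem
      refine majorityExpr_spec hΓ.npos hΓ.addr (fun t ht u hu => ?_) hi hj hk hp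
        ((hmem 0 (by decide)).trans h₀.regs.r0) ((hmem 12 (by decide)).trans r12)
        ((hmem 13 (by decide)).trans r13) ((hmem 14 (by decide)).trans r14) hp'
      rw [hmem _ (by omega), h₀.rows t ht u hu]
    · rintro c₁ ⟨k1, k2, k3⟩
      have harg : c₁.arg = corArg n S lab q := by rw [k2, h₀.arg]; rfl
      have hr : Regs n m S T c₁ := h₀.regs.congr fun a ha => k3 a (by rintro rfl; revert ha; decide)
      have hrows : Rows n T lab c₁ := fun t ht u hu => by
        rw [k3 _ (by omega), h₀.rows t ht u hu]
      have hl := hlen q hq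
      have hco := hcost q hq
      refine Run.seq (1 + t₂ + n) (60 + 260 * (T * (n * n)) + 30 * n) (by omega)
        (Run.callCor ?_ (by decide) ?_ ?_ ?_ ?_)
      · rw [harg, hl]; omega
      · rw [hr.r21]; omega
      · rw [hr.r21, harg, hl]; omega
      · intro x hx
        rw [harg] at hx
        have := hlt q hq x hx
        omega
      · rw [harg]
        refine (consider_answer_run hΓ hl (hAll q hq) hr hrows (k1.trans h₀.out)
          (h₀.best.congr (k3 9 (by decide)) fun u _ => k3 _ (by omega))).mono le_rfl ?_
        rintro c₂ ⟨l1, l2⟩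
        refine ⟨l2.trans ((k3 11 (by decide)).trans r11), l1.mono ?_⟩
        rintro L (hL | ⟨t, ht, rfl⟩)
        · exact Or.inr (Or.inl hL)
        · rcases Nat.lt_succ_iff_lt_or_eq.1 ht with ht | rfl
          · exact Or.inr (Or.inr ⟨t, ht, rfl⟩)
          · exact Or.inl rfl

theorem emitLoop_run {Γ : Setting} (hΓ : Room n m S T Γ) (hc : Regs n m S T c)
    (hout : c.out = []) {L : List ℕ} (hLn : L.length = n)
    (hL : Buffer n (64 + T + T * n + n) L c) :
    Run Γ emitLoop (20 + 20 * n) c fun c' => c'.out = L := by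
  have := hΓ.addr
  have := hΓ.npos
  refine Run.forLoop 13 n (fun i c' => c'.out = (List.range i).map (fun u => L.getD u 0) ∧
      ∀ a, a ≠ 15 → c'.mem a = c.mem a) (by simp; omega) (by decide) (by decide) (by simp)
    (by simpa using hc.r0) (by omega) (by omega) ?_ ⟨by simpa using hout, fun _ _ => rfl⟩ ?_ ?_
  · rintro i c' x ⟨h1, h2⟩
    refine ⟨h1, fun a ha => ?_⟩
    rw [Core.set_mem, Function.update_of_ne ha, h2 a ha]
  · rintro i hi c' hi' ⟨h1, h2⟩
    have r22 : c'.mem 22 = _ := (h2 22 (by decide)).trans hc.r22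
    have hv := (h2 (64 + T + T * n + n + i) (by omega)).trans (hL i hi)
    refine Run.emitVal (by decide) (by decide) ?_ ⟨hi', ?_, h2⟩
    · simp [r22, hi']; omega
    · simp only [RExpr.eval_ld, RExpr.eval_add, RExpr.eval_reg, r22, hi', hv, h1]
      rw [List.range_succ, List.map_append]
      rfl
  · rintro c' ⟨h1, -⟩
    rw [h1]
    refine List.ext_getElem (by simp [hLn]) fun i h _ => ?_
    simp only [List.length_map, List.length_range] at h
    simp [hLn, h]

/-- The candidates. -/
def candidates (n S : ℕ) (E : Env) (lab : ℕ → ℕ → ℕ) : Set (List ℕ) :=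
  {L | ∃ t < S, L = E.cls.answer (clsArg n lab t)} ∪
    {L | ∃ q < S * (S * S), L = E.cor.answer (corArg n S lab q)}

theorem queryProg_run {Γ : Setting} (hΓ : Room n m S T Γ) (hS : 0 < S) {lab : ℕ → ℕ → ℕ}
    {t₁ t₂ : ℕ}
    (hlen : ∀ L ∈ candidates n S Γ.env lab, L.length = n)
    (hlt : ∀ L ∈ candidates n S Γ.env lab, ∀ x ∈ L, x < n)
    (hcls : ∀ t < S, Γ.env.cls.cost (clsArg n lab t) ≤ t₁)
    (hcor : ∀ q < S * (S * S), Γ.env.cor.cost (corArg n S lab q) ≤ t₂)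
    (hc : Regs n m S T c) (hlab : Rows n T lab c) (harg : c.arg = []) (hout : c.out = []) :
    Run Γ queryProg (100 + 20 * n + S * (100 + 260 * (T * (n * n)) + 70 * n + t₁) +
      S * (S * S) * (200 + 260 * (T * (n * n)) + 200 * (n * n) + 40 * n + t₂)) c
      fun c' => c'.out ∈ candidates n S Γ.env lab ∧
        ∀ L ∈ candidates n S Γ.env lab, sampleCost n T lab c'.out ≤ sampleCost n T lab L := by
  have := hΓ.addr
  have := hΓ.cost
  have := hΓ.pairs
  generalize hA : S * (100 + 260 * (T * (n * n)) + 70 * n + t₁) = A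
  generalize hB : S * (S * S) * (200 + 260 * (T * (n * n)) + 200 * (n * n) + 40 * n + t₂) = B
  refine Run.seq 20 (80 + 20 * n + A + B) (by omega)
    (Run.assign (by decide) (by decide) (by decide) ?_ ?_)
  · simp [hc.r8, hc.r0]; omega
  simp only [RExpr.eval_add, RExpr.eval_mul, RExpr.eval_reg, RExpr.eval_lit, hc.r8, hc.r0]
  refine Run.seq (20 + A) (60 + 20 * n + B) (by omega) ?_
  subst hA hB
  refine (clsLoop_run hΓ (lab := lab) (All := candidates n S Γ.env lab)
    (fun t ht => hlen _ (Or.inl ⟨t, ht, rfl⟩)) (fun t ht => hlt _ (Or.inl ⟨t, ht, rfl⟩)) hcls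
    (fun t ht => Or.inl ⟨t, ht, rfl⟩) ⟨hc.set _ (by decide), hlab.set _ (by omega), harg, hout,
      ⟨by simp, Or.inl (by simp)⟩⟩).mono le_rfl ?_
  intro c₁ h₁
  refine Run.seq _ (20 + 20 * n) (by omega)
    ((corLoop_run hΓ (fun t ht => hlen _ (Or.inr ⟨t, ht, rfl⟩))
      (fun t ht => hlt _ (Or.inr ⟨t, ht, rfl⟩)) hcor
      (fun t ht => Or.inr ⟨t, ht, rfl⟩) h₁).mono le_rfl ?_)
  intro c₂ h₂
  have hbest : Best n T lab (candidates n S Γ.env lab) (candidates n S Γ.env lab) c₂ := h₂.best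
  rcases hbest.eq with h9 | ⟨L, hL, h9, hbuf⟩
  -- The initial value T·n² + 1 cannot survive: as S > 0, at least one candidate has been
  -- considered.
  · have h := hbest.le _ (Or.inl ⟨0, hS, rfl⟩)
    have h' := sampleCost_le (n := n) (T := T) lab (Γ.env.cls.answer (clsArg n lab 0))
    omega
  · refine (emitLoop_run hΓ h₂.regs h₂.out (hlen L hL) hbuf).mono le_rfl ?_
    rintro c₃ rfl
    exact ⟨hL, fun L' hL' => h9 ▸ hbest.le L' hL'⟩

end FairConsensus

namespace FairConsensus

variable {n m S T : ℕ} {c c' : Core}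

/-! ### Labels and clusterings -/

/-- The least point of the cluster of `u`. -/
noncomputable def minLabel (C : Clustering n) (u : ℕ) : ℕ :=
  sInf {w : ℕ | ∃ (hw : w < n) (hu : u < n), C.r ⟨w, hw⟩ ⟨u, hu⟩}

theorem minLabel_spec (C : Clustering n) (u : Fin n) :
    ∃ w : Fin n, minLabel C u = w ∧ C.r w u := by
  obtain ⟨hw, hu, h⟩ := Nat.sInf_mem (s := {w : ℕ | ∃ (hw : w < n) (hu : (u : ℕ) < n),
    C.r ⟨w, hw⟩ ⟨u, hu⟩}) ⟨u, u.2, u.2, C.refl' _⟩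
  exact ⟨⟨_, hw⟩, rfl, h⟩

theorem minLabel_le (C : Clustering n) {u w : Fin n} (h : C.r w u) : minLabel C u ≤ w :=
  Nat.sInf_le ⟨w.2, u.2, h⟩

theorem minLabel_lt (C : Clustering n) (u : Fin n) : minLabel C u < n := by
  obtain ⟨w, h, -⟩ := minLabel_spec C u
  exact h ▸ w.2

theorem minLabel_eq_iff (C : Clustering n) (u v : Fin n) :
    minLabel C u = minLabel C v ↔ C.r u v := by
  constructor
  · intro h
    obtain ⟨w, h1, h2⟩ := minLabel_spec C u
    obtain ⟨w', h1', h2'⟩ := minLabel_spec C v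
    have : w = w' := Fin.ext (by rw [← h1, ← h1', h])
    subst this
    exact C.trans' (C.symm' h2) h2'
  · intro h
    obtain ⟨w, h1, h2⟩ := minLabel_spec C u
    obtain ⟨w', h1', h2'⟩ := minLabel_spec C v
    apply le_antisymm
    · rw [h1']
      exact minLabel_le C (C.trans' h2' (C.symm' h))
    · rw [h1]
      exact minLabel_le C (C.trans' h2 h)

/-- The rows spell this word at the end of the stream, so the subroutine's answer for a sample
depends only on the sampled clustering. -/
noncomputable def labelList (C : Clustering n) : List ℕ := (List.range n).map (minLabel C)

theorem represents_labelList (C : Clustering n) : Represents (labelList C) C := by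
  refine ⟨by simp [labelList], ?_, fun u v => ?_⟩
  · intro x hx
    obtain ⟨u, hu, rfl⟩ := List.mem_map.1 hx
    exact minLabel_lt C ⟨u, List.mem_range.1 hu⟩
  · have : ∀ u : Fin n, (labelList C).getD u 0 = minLabel C u := by
      intro u
      simp [labelList]
    rw [this, this, minLabel_eq_iff]

/-! #### The labels during the stream -/

/-- Each label is a point of the same cluster which is not larger. -/
def RowOk (C : Clustering n) (row : ℕ → ℕ) : Prop :=
  ∀ u : Fin n, ∃ w : Fin n, row u = w ∧ C.r w u ∧ w ≤ u

theorem lowerRow_le (row : ℕ → ℕ) (p q u : ℕ) : lowerRow row p q u ≤ row u := by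
  by_cases h : u = p
  · subst h; simp [lowerRow]
  · simp [lowerRow, Function.update_of_ne h]

theorem lowerRow_self_le (row : ℕ → ℕ) (p q : ℕ) : lowerRow row p q p ≤ q := by
  simp [lowerRow]

theorem RowOk.lowerRow {C : Clustering n} {row : ℕ → ℕ} (h : RowOk C row) {p q : Fin n}
    (hpq : C.r p q) : RowOk C (lowerRow row p q) := by
  intro u
  obtain ⟨w, h1, h2, h3⟩ := h u
  by_cases hup : u = p
  · subst hup
    rcases le_total w q with hle | hle
    · exact ⟨w, by simp [FairConsensus.lowerRow, h1, hle], h2, h3⟩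
    · exact ⟨q, by simp [FairConsensus.lowerRow, h1, hle], C.symm' hpq, hle.trans h3⟩
  · refine ⟨w, ?_, h2, h3⟩
    rw [FairConsensus.lowerRow, Function.update_of_ne (fun e => hup (Fin.ext e)), h1]

/-- What is known about the labels after the triples of `l`. -/
def LabInv (I : Fin m → Clustering n) (X : ℕ → Fin m) (l : List (Triple n m))
    (lab : ℕ → ℕ → ℕ) : Prop :=
  ∀ t, RowOk (I (X t)) (lab t) ∧
    ∀ x ∈ l, x.j = X t → x.sep = false → lab t x.u ≤ x.v ∧ lab t x.v ≤ x.u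

theorem LabInv.nil (I : Fin m → Clustering n) (X : ℕ → Fin m) : LabInv I X [] fun _ u => u :=
  fun t => ⟨fun u => ⟨u, rfl, (I (X t)).refl' u, le_rfl⟩, by simp⟩

/-- Labels never increase, so the bounds from earlier triples persist; and a label is only ever
replaced by another point of the same cluster. -/
theorem LabInv.step {I : Fin m → Clustering n} {X : ℕ → Fin m} {l : List (Triple n m)}
    {lab : ℕ → ℕ → ℕ} (h : LabInv I X l lab) (x : Triple n m)
    (hx : x.sep = false ↔ (I x.j).r x.u x.v) :
    LabInv I X (l ++ [x])
      (labStep (fun t => (X t : ℕ)) x.u x.v x.j (if x.sep then 1 else 0) lab) := by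
  intro t
  obtain ⟨h1, h2⟩ := h t
  by_cases hcond : (X t : ℕ) = x.j ∧ (if x.sep then 1 else 0) = 0
  · rw [labStep, if_pos hcond]
    obtain ⟨e1, e2⟩ := hcond
    have e1 : X t = x.j := Fin.ext e1
    have e2 : x.sep = false := by
      by_contra hne
      simp [hne] at e2
    have hr : (I (X t)).r x.u x.v := e1 ▸ hx.1 e2
    have hle : ∀ u, lowerRow (lowerRow (lab t) x.u x.v) x.v x.u u ≤ lab t u := fun u =>
      (lowerRow_le _ _ _ _).trans (lowerRow_le _ _ _ _)
    refine ⟨(h1.lowerRow hr).lowerRow ((I (X t)).symm' hr), fun y hy hj hs => ?_⟩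
    rcases List.mem_append.1 hy with hy | hy
    · exact ⟨(hle _).trans (h2 y hy hj hs).1, (hle _).trans (h2 y hy hj hs).2⟩
    · obtain rfl := List.mem_singleton.1 hy
      exact ⟨(lowerRow_le _ _ _ _).trans (lowerRow_self_le _ _ _), lowerRow_self_le _ _ _⟩
  · rw [labStep, if_neg hcond]
    refine ⟨h1, fun y hy hj hs => ?_⟩
    rcases List.mem_append.1 hy with hy | hy
    · exact h2 y hy hj hs
    · obtain rfl := List.mem_singleton.1 hy
      exact absurd ⟨by rw [hj], by simp [hs]⟩ hcond

/-- Let w be the least point of the cluster of u. If w ≠ u, the pair occurs in the stream in some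
orientation, and its triple forced the label of u down to at most w. Labels stay within the cluster,
so they cannot go lower. Since all pairs occur, no transitive merging is needed. -/
theorem LabInv.eq_minLabel {I : Fin m → Clustering n} {X : ℕ → Fin m} {l : List (Triple n m)}
    {lab : ℕ → ℕ → ℕ} (h : LabInv I X l lab) (hl : IsStream I l) (t : ℕ) {u : ℕ} (hu : u < n) :
    lab t u = minLabel (I (X t)) u := by
  obtain ⟨h1, h2⟩ := h t
  apply le_antisymm
  · obtain ⟨w, e, hr⟩ := minLabel_spec (I (X t)) ⟨u, hu⟩
    obtain ⟨w', e', -, hle⟩ := h1 ⟨u, hu⟩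
    dsimp only at e e'
    rw [e]
    by_cases hwu : w = ⟨u, hu⟩
    · rw [e', hwu]
      exact hle
    · obtain ⟨x, hx, hj, hx'⟩ := hl.2 (X t) w ⟨u, hu⟩ hwu
      rcases hx' with ⟨hu', hv'⟩ | ⟨hu', hv'⟩
      · have hs : x.sep = false := (hl.1 x hx).2 (by rw [hj, hu', hv']; exact hr)
        have := (h2 x hx hj hs).2
        rwa [hu', hv'] at this
      · have hs : x.sep = false := (hl.1 x hx).2 (by rw [hj, hu', hv']; exact (I (X t)).symm' hr)
        have := (h2 x hx hj hs).1
        rwa [hu', hv'] at this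
  · obtain ⟨w', e', hr, -⟩ := h1 ⟨u, hu⟩
    dsimp only at e'
    rw [e']
    exact minLabel_le (I (X t)) (u := ⟨u, hu⟩) hr

/-! #### Arguments and costs in terms of clusterings -/

theorem flatMap_range_map (f : ℕ → ℕ → ℕ) (a b : ℕ) :
    ((List.range a).flatMap fun u => (List.range b).map fun v => f u v) =
      (List.range (a * b)).map fun p => f (p / b) (p % b) := by
  rcases Nat.eq_zero_or_pos b with rfl | hb
  · simp
  induction a with
  | zero => simp
  | succ a ih =>
    rw [List.range_succ, List.flatMap_append, ih, Nat.succ_mul, List.range_add, List.map_append,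
      List.flatMap_singleton, List.map_map]
    congr 1
    refine List.map_congr_left fun v hv => ?_
    have hv := List.mem_range.1 hv
    simp only [Function.comp_apply]
    rw [mul_comm a b, Nat.mul_add_div hb, Nat.mul_add_mod, Nat.div_eq_of_lt hv,
      Nat.mod_eq_of_lt hv, add_zero]

theorem matrixWord_eq (G : SimpleGraph (Fin n)) (f : ℕ → ℕ → ℕ)
    (hf : ∀ u v : Fin n, (G.Adj u v → f u v = 1) ∧ (¬ G.Adj u v → f u v = 0)) :
    matrixWord G = (List.range (n * n)).map fun p => f (p / n) (p % n) := by
  classical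
  rw [← flatMap_range_map, ← List.map_coe_finRange_eq_range, matrixWord, List.flatMap_map]
  refine List.flatMap_congr fun u _ => ?_
  rw [List.map_map]
  refine List.map_congr_left fun v _ => ?_
  simp only [Function.comp_apply]
  split_ifs with h
  · exact ((hf u v).1 h).symm
  · exact ((hf u v).2 h).symm

/-- The labels of the clusterings with indices `X t`. -/
noncomputable def sampleLab (I : Fin m → Clustering n) (X : ℕ → Fin m) (t u : ℕ) : ℕ :=
  minLabel (I (X t)) u

theorem corArg_eq (I : Fin m → Clustering n) (X : ℕ → Fin m) (q : ℕ) :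
    corArg n S (sampleLab I X) q =
      matrixWord (majority (I (X (q / S / S))) (I (X (q / S % S))) (I (X (q % S)))) := by
  classical
  refine (matrixWord_eq _ (fun u v =>
    ((if sampleLab I X (q / S / S) u = sampleLab I X (q / S / S) v then 1 else 0) +
      ((if sampleLab I X (q / S % S) u = sampleLab I X (q / S % S) v then 1 else 0) +
        (if sampleLab I X (q % S) u = sampleLab I X (q % S) v then 1 else 0))) / 2
      * (1 - if u = v then 1 else 0)) fun u v => ?_).symm
  simp only [sampleLab, minLabel_eq_iff, majority, Fin.val_inj]
  by_cases h : u = v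
  · subst h
    simp
  · by_cases h1 : (I (X (q / S / S))).r u v <;> by_cases h2 : (I (X (q / S % S))).r u v <;>
      by_cases h3 : (I (X (q % S))).r u v <;> simp [h, h1, h2, h3]

theorem sum_range_mul_eq (f : ℕ → ℕ → ℕ) (a b : ℕ) :
    ∑ q ∈ Finset.range (a * b), f (q / b) (q % b) =
      ∑ x ∈ Finset.range a, ∑ y ∈ Finset.range b, f x y := by
  rcases Nat.eq_zero_or_pos b with rfl | hb
  · simp
  induction a with
  | zero => simp
  | succ a ih =>
    rw [Nat.succ_mul, Finset.sum_range_add, ih, Finset.sum_range_succ]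
    congr 1
    refine Finset.sum_congr rfl fun v hv => ?_
    have hv := Finset.mem_range.1 hv
    rw [mul_comm a b, Nat.mul_add_div hb, Nat.mul_add_mod, Nat.div_eq_of_lt hv,
      Nat.mod_eq_of_lt hv, add_zero]

/-- Disagreement is symmetric and absent on the diagonal, so each unordered pair is counted twice.
-/
theorem sum_ordered_pairs (C D : Clustering n) (f : ℕ → ℕ → ℕ)
    (hf : ∀ u v : Fin n, ((C.r u v ↔ D.r u v) → f u v = 0) ∧ (¬ (C.r u v ↔ D.r u v) → f u v = 1)) :
    ∑ u ∈ Finset.range n, ∑ v ∈ Finset.range n, f u v = 2 * dist C D := by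
  classical
  have hsymm : ∀ u v : Fin n, f u v = f v u := by
    intro u v
    have : (C.r u v ↔ D.r u v) ↔ (C.r v u ↔ D.r v u) :=
      ⟨fun h => ⟨fun k => D.symm' (h.1 (C.symm' k)), fun k => C.symm' (h.2 (D.symm' k))⟩,
        fun h => ⟨fun k => D.symm' (h.1 (C.symm' k)), fun k => C.symm' (h.2 (D.symm' k))⟩⟩
    by_cases h : C.r u v ↔ D.r u v
    · rw [(hf u v).1 h, (hf v u).1 (this.1 h)]
    · rw [(hf u v).2 h, (hf v u).2 (this.not.1 h)]
  have hdiag : ∀ u : Fin n, f u u = 0 := fun u =>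
    (hf u u).1 ⟨fun _ => D.refl' u, fun _ => C.refl' u⟩
  have hdist : dist C D = ∑ u : Fin n, ∑ v : Fin n, if u < v then f u v else 0 := by
    rw [← Fintype.sum_prod_type', dist, Finset.card_filter]
    refine Finset.sum_congr rfl fun p _ => ?_
    by_cases hp : p.1 < p.2
    · by_cases h : C.r p.1 p.2 ↔ D.r p.1 p.2
      · rw [if_neg (fun k => k.2 h), if_pos hp, (hf _ _).1 h]
      · rw [if_pos ⟨hp, h⟩, if_pos hp, (hf _ _).2 h]
    · rw [if_neg (fun k => hp k.1), if_neg hp]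
  have hdist' : dist C D = ∑ u : Fin n, ∑ v : Fin n, if v < u then f u v else 0 := by
    rw [hdist, Finset.sum_comm]
    refine Finset.sum_congr rfl fun u _ => Finset.sum_congr rfl fun v _ => ?_
    rw [hsymm]
  have htwo : 2 * dist C D = (∑ u : Fin n, ∑ v : Fin n, if u < v then f u v else 0) +
      ∑ u : Fin n, ∑ v : Fin n, if v < u then f u v else 0 := by
    rw [← hdist, ← hdist', two_mul]
  rw [htwo]
  rw [← Finset.sum_add_distrib, Finset.sum_range]
  refine Finset.sum_congr rfl fun u _ => ?_
  rw [← Finset.sum_add_distrib, Finset.sum_range]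
  refine Finset.sum_congr rfl fun v _ => ?_
  rcases lt_trichotomy u v with h | h | h
  · simp [h, h.not_gt]
  · subst h
    simp [hdiag]
  · simp [h, h.not_gt]

/-- The factor 2 is harmless, since sample costs are only compared with each other. -/
theorem sampleCost_eq (I : Fin m → Clustering n) (X : ℕ → Fin m) {L : List ℕ} {F : Clustering n}
    (hL : Represents L F) :
    sampleCost n T (sampleLab I X) L = 2 * ∑ t ∈ Finset.range T, dist (I (X t)) F := by
  rw [sampleCost, ← mul_assoc,
    sum_range_mul_eq (fun x v => pairCost (sampleLab I X) L (x / n) (x % n) v),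
    sum_range_mul_eq (fun t u => ∑ v ∈ Finset.range n, pairCost (sampleLab I X) L t u v),
    Finset.mul_sum]
  refine Finset.sum_congr rfl fun t _ => sum_ordered_pairs _ _ _ fun u v => ?_
  rw [hL.2.2 u v, ← minLabel_eq_iff (I (X t)) u v, pairCost, sampleLab, sampleLab]
  constructor
  · intro h
    rw [if_pos (propext h)]
  · intro h
    rw [if_neg (fun k => h (iff_of_eq k))]

end FairConsensus

namespace FairConsensus

variable {n m S T : ℕ}

/-! ### The success probability -/

/-- The index of the `t`-th sampled clustering. -/
def draw (hm : 0 < m) (ω : Coins) (t : ℕ) : Fin m :=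
  ⟨ω (t, m - 1), by
    have : (ω (t, m - 1) : ℕ) < m - 1 + 1 := (ω (t, m - 1)).isLt
    omega⟩

/-- A much worse clustering looks better on the sample only with small probability. -/
theorem measure_sample_le (hm : 0 < m) (I : Fin m → Clustering n) {F F' : Clustering n} {ε : ℝ}
    (hε₀ : 0 < ε) (hε₁ : ε < 1) (h : (1 + 2 * ε) * obj I F' < obj I F) (T : ℕ) :
    coinMeasure {ω | ∑ t ∈ Finset.range T, dist (I (draw hm ω t)) F ≤
        ∑ t ∈ Finset.range T, dist (I (draw hm ω t)) F'} ≤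
      ENNReal.ofReal (Real.exp (-(ε ^ 2 / 16)) ^ T) := by
  have hmR : (0 : ℝ) < m := by exact_mod_cast hm
  have hF' : (0 : ℝ) ≤ obj I F' := Nat.cast_nonneg _
  have hmd : (m : ℝ) * dist F F' ≤ obj I F + obj I F' := by
    exact_mod_cast mul_dist_le_obj_add I F F'
  have hlt : (obj I F' : ℝ) < obj I F := by nlinarith
  have hD : (0 : ℝ) < dist F F' := by
    by_contra h0
    have h0 : (dist F F' : ℝ) = 0 := le_antisymm (not_lt.1 h0) (Nat.cast_nonneg _)
    have := obj_le_of_dist I F' F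
    rw [dist_comm F' F, h0] at this
    linarith
  -- Dividing by `dist F F'` makes the variable bounded by 1 (triangle inequality). By `hmd` and the
  -- gap between the objectives its mean is at most −ε/2, whatever the scale of the distances.
  obtain ⟨h', hh'⟩ : ∃ h' : ℕ → ℝ, h' = fun j =>
      if hj : j < m then ((dist (I ⟨j, hj⟩) F' : ℝ) - dist (I ⟨j, hj⟩) F) / dist F F' else 0 :=
    ⟨_, rfl⟩
  have hval : ∀ j : Fin m, h' j = ((dist (I j) F' : ℝ) - dist (I j) F) / dist F F' := by
    intro j
    rw [hh']
    simp
  refine (measure_mono ?_).trans (measure_sum_nonneg_le hm h' hε₀ hε₁ ?_ ?_ T)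
  · intro ω hω
    simp only [Set.mem_ofPred_eq] at hω ⊢
    have hω' : (∑ t ∈ Finset.range T, (dist (I (draw hm ω t)) F : ℝ)) ≤
        ∑ t ∈ Finset.range T, (dist (I (draw hm ω t)) F' : ℝ) := by exact_mod_cast hω
    have : ∑ t ∈ Finset.range T, h' (ω (t, m - 1) : ℕ) = ∑ t ∈ Finset.range T,
        ((dist (I (draw hm ω t)) F' : ℝ) - dist (I (draw hm ω t)) F) / dist F F' :=
      Finset.sum_congr rfl fun t _ => hval (draw hm ω t)
    rw [this, ← Finset.sum_div, Finset.sum_sub_distrib]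
    exact div_nonneg (by linarith) hD.le
  · intro j hj
    have h1 : (dist (I ⟨j, hj⟩) F' : ℝ) ≤ dist (I ⟨j, hj⟩) F + dist F F' := by
      exact_mod_cast dist_triangle _ F _
    have h2 : (dist (I ⟨j, hj⟩) F : ℝ) ≤ dist (I ⟨j, hj⟩) F' + dist F F' := by
      rw [dist_comm F F']
      exact_mod_cast dist_triangle _ F' _
    rw [hval ⟨j, hj⟩, abs_div, abs_of_pos hD, div_le_one hD, abs_le]
    constructor <;> linarith
  · rw [Finset.sum_range]
    simp only [hval]
    rw [← Finset.sum_div, Finset.sum_sub_distrib, div_le_iff₀ hD]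
    have e1 : ∑ j, (dist (I j) F' : ℝ) = obj I F' := by simp [obj]
    have e2 : ∑ j, (dist (I j) F : ℝ) = obj I F := by simp [obj]
    rw [e1, e2]
    have h1 : ε / 2 * (m * dist F F') ≤ ε / 2 * (obj I F + obj I F') :=
      mul_le_mul_of_nonneg_left hmd (by positivity)
    nlinarith

/-- Since m < 2^size(m), a bound 2^(−k) for each block of C draws gives m^(−k) for size(m) blocks.
-/
theorem pow_mul_size_le {x : ℝ} (hx : 0 ≤ x) {C k : ℕ} (hm : 0 < m) (hC : x ^ C ≤ (1 / 2) ^ k) :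
    x ^ (C * Nat.size m) ≤ (1 / (m : ℝ)) ^ k := by
  have hmR : (0 : ℝ) < m := by exact_mod_cast hm
  rw [pow_mul]
  refine (pow_le_pow_left₀ (pow_nonneg hx _) hC _).trans ?_
  rw [← pow_mul, mul_comm, pow_mul]
  refine pow_le_pow_left₀ (by positivity) ?_ _
  rw [div_pow, one_pow]
  refine one_div_le_one_div_of_le hmR ?_
  exact_mod_cast (Nat.lt_size_self m).le

/-- With the required probability, the sample meets all sets of a given family, and no much worse
clustering looks better on the sample. -/
theorem measure_good_sample {ι κ : Type*} [Fintype ι] [Fintype κ] (hm : 2 ≤ m) {p : ℝ}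
    (hp1 : p ≤ 1) {C e : ℕ} {ε : ℝ} (hε₀ : 0 < ε) (hε₁ : ε < 1) (he : 1 ≤ e * ε)
    (hCp : (1 - p) ^ C ≤ (1 / 2) ^ 6) (hCe : Real.exp (-(1 / 16)) ^ C ≤ (1 / 2) ^ 10)
    (hι : Fintype.card ι ≤ m ^ 4) (hκ : Fintype.card κ ≤ m ^ 4)
    (𝒜 : ι → Finset (Fin m)) (h𝒜 : ∀ q, p * m ≤ (𝒜 q).card)
    (I : Fin m → Clustering n) (cand : κ → Clustering n) :
    ENNReal.ofReal (1 - 1 / (m : ℝ)) ≤ coinMeasure {ω |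
      (∀ q, ∃ t < C * Nat.size m, draw (by omega) ω t ∈ 𝒜 q) ∧
      ∀ a b, (1 + 2 * ε) * obj I (cand b) < obj I (cand a) →
        ∑ t ∈ Finset.range (C * Nat.size m * (e * e)), dist (I (draw (by omega) ω t)) (cand b) <
          ∑ t ∈ Finset.range (C * Nat.size m * (e * e)),
            dist (I (draw (by omega) ω t)) (cand a)} := by
  classical
  have hm0 : 0 < m := by omega
  have hmR : (2 : ℝ) ≤ m := by exact_mod_cast hm
  obtain ⟨S, hS⟩ : ∃ S, S = C * Nat.size m := ⟨_, rfl⟩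
  rw [← hS]
  obtain ⟨good, hgood⟩ : ∃ good : Set Coins, good = {ω |
      (∀ q, ∃ t < S, draw hm0 ω t ∈ 𝒜 q) ∧
      ∀ a b, (1 + 2 * ε) * obj I (cand b) < obj I (cand a) →
        ∑ t ∈ Finset.range (S * (e * e)), dist (I (draw hm0 ω t)) (cand b) <
          ∑ t ∈ Finset.range (S * (e * e)), dist (I (draw hm0 ω t)) (cand a)} := ⟨_, rfl⟩
  change _ ≤ coinMeasure _
  rw [← hgood]
  obtain ⟨miss, hmiss⟩ : ∃ miss : ι → Set Coins, miss = fun q =>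
    {ω | ∀ t < S, ∀ i ∈ 𝒜 q, (ω (t, m - 1) : ℕ) ≠ i} := ⟨_, rfl⟩
  obtain ⟨wrong, hwrong⟩ : ∃ wrong : κ × κ → Set Coins, wrong = fun ab =>
    if (1 + 2 * ε) * obj I (cand ab.2) < obj I (cand ab.1) then
      {ω | ∑ t ∈ Finset.range (S * (e * e)), dist (I (draw hm0 ω t)) (cand ab.1) ≤
        ∑ t ∈ Finset.range (S * (e * e)), dist (I (draw hm0 ω t)) (cand ab.2)}
    else ∅ := ⟨_, rfl⟩
  -- Subadditivity over this cover bounds the measure of `good` from below without any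
  -- measurability.
  have hcover : Set.univ ⊆ good ∪ ((⋃ q, miss q) ∪ ⋃ ab, wrong ab) := by
    intro ω _
    by_contra hcon
    simp only [Set.mem_union, Set.mem_iUnion, not_or, not_exists] at hcon
    obtain ⟨h1, h2, h3⟩ := hcon
    apply h1
    rw [hgood]
    refine ⟨fun q => ?_, fun a b hab => ?_⟩
    · by_contra hq
      apply h2 q
      rw [hmiss]
      intro t ht i hi heq
      exact hq ⟨t, ht, (Fin.ext heq : draw hm0 ω t = i) ▸ hi⟩
    · by_contra hlt
      apply h3 (a, b)
      rw [hwrong]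
      dsimp only
      rw [if_pos hab]
      exact not_lt.1 hlt
  have hmiss_le : ∀ q, coinMeasure (miss q) ≤ ENNReal.ofReal ((1 / (m : ℝ)) ^ 6) := by
    intro q
    rw [hmiss]
    refine (measure_forall_notMem_le hm0 (𝒜 q) (h𝒜 q) S).trans (ENNReal.ofReal_le_ofReal ?_)
    rw [hS]
    exact pow_mul_size_le (by linarith) hm0 hCp
  have hwrong_le : ∀ ab, coinMeasure (wrong ab) ≤ ENNReal.ofReal ((1 / (m : ℝ)) ^ 10) := by
    intro ab
    rw [hwrong]
    dsimp only
    split_ifs with hab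
    · refine (measure_sample_le hm0 I hε₀ hε₁ hab _).trans (ENNReal.ofReal_le_ofReal ?_)
      rw [mul_comm S, pow_mul]
      -- As e ≥ 1/ε, a block of e² draws makes up for the factor ε² in the exponent.
      have h1 : Real.exp (-(ε ^ 2 / 16)) ^ (e * e) ≤ Real.exp (-(1 / 16)) := by
        rw [← Real.exp_nat_mul]
        refine Real.exp_le_exp.2 ?_
        have : 1 ≤ (e * ε) ^ 2 := one_le_pow₀ he
        push_cast
        nlinarith
      refine (pow_le_pow_left₀ (pow_nonneg (Real.exp_pos _).le _) h1 S).trans ?_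
      rw [hS]
      exact pow_mul_size_le (Real.exp_pos _).le hm0 hCe
    · simp
  -- At most m⁴ sets are each missed with probability at most m⁻⁶, and at most m⁸ pairs are each
  -- misjudged with probability at most m⁻¹⁰; together 2/m² ≤ 1/m.
  have hsum : coinMeasure ((⋃ q, miss q) ∪ ⋃ ab, wrong ab) ≤ ENNReal.ofReal (1 / m) := by
    have h1 : coinMeasure (⋃ q, miss q) ≤ ENNReal.ofReal ((m : ℝ) ^ 4 * (1 / (m : ℝ)) ^ 6) := by
      refine (measure_iUnion_fintype_le _ _).trans
        ((Finset.sum_le_card_nsmul _ _ _ fun q _ => hmiss_le q).trans ?_)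
      rw [Finset.card_univ, nsmul_eq_mul, ENNReal.ofReal_mul (by positivity),
        ← Nat.cast_pow, ENNReal.ofReal_natCast]
      gcongr
    have h2 : coinMeasure (⋃ ab, wrong ab) ≤
        ENNReal.ofReal ((m : ℝ) ^ 8 * (1 / (m : ℝ)) ^ 10) := by
      refine (measure_iUnion_fintype_le _ _).trans
        ((Finset.sum_le_card_nsmul _ _ _ fun q _ => hwrong_le q).trans ?_)
      rw [Finset.card_univ, nsmul_eq_mul, ENNReal.ofReal_mul (by positivity),
        ← Nat.cast_pow, ENNReal.ofReal_natCast, Fintype.card_prod]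
      gcongr
      calc Fintype.card κ * Fintype.card κ ≤ m ^ 4 * m ^ 4 := Nat.mul_le_mul hκ hκ
        _ = m ^ 8 := by ring
    refine (measure_union_le _ _).trans ((add_le_add h1 h2).trans ?_)
    rw [← ENNReal.ofReal_add (by positivity) (by positivity)]
    refine ENNReal.ofReal_le_ofReal ?_
    have e1 : (m : ℝ) ^ 4 * (1 / (m : ℝ)) ^ 6 = 1 / m * (1 / m) := by
      field_simp
    have e2 : (m : ℝ) ^ 8 * (1 / (m : ℝ)) ^ 10 = 1 / m * (1 / m) := by
      field_simp
    have e3 : 1 / (m : ℝ) ≤ 1 / 2 := one_div_le_one_div_of_le (by norm_num) hmR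
    have e4 : 0 ≤ 1 / (m : ℝ) := by positivity
    rw [e1, e2]
    nlinarith
  have htotal : (1 : ENNReal) ≤ coinMeasure good + ENNReal.ofReal (1 / m) := by
    rw [← measure_univ (μ := coinMeasure)]
    exact (measure_mono hcover).trans ((measure_union_le _ _).trans (add_le_add_right hsum _))
  rw [ENNReal.ofReal_sub _ (by positivity), ENNReal.ofReal_one]
  exact tsub_le_iff_right.2 htotal

end FairConsensus

namespace FairConsensus

variable {n m S T : ℕ}

/-! ### Runs of the algorithm -/

/-- What holds after the initialization and the triples of `l`. -/
structure StreamInv (Γ : Setting) (I : Fin m → Clustering n) (X : ℕ → Fin m) (S T : ℕ)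
    (l : List (Triple n m)) (σ : State) : Prop where
  within : σ.Within Γ.B Γ.W
  regs : Regs n m S T σ.core
  arg : σ.core.arg = []
  out : σ.core.out = []
  indices : Indices T (fun t => (X t : ℕ)) σ.core
  rows : ∃ lab, Rows n T lab σ.core ∧ LabInv I X l lab

theorem start_spec {Γ : Setting} {C e : ℕ} (hΓ : Room n m S T Γ) (hS : S = C * Nat.size m)
    (hT : T = S * (e * e)) (hC : C ≤ Γ.W) (he : e * e ≤ Γ.W) (he' : e ≤ Γ.W) (hm : m ≤ Γ.W)
    (I : Fin m → Clustering n) :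
    StreamInv Γ I (draw hΓ.mpos Γ.env.coins) S T [] ((algorithm C).start Γ.env n m e) ∧
      ((algorithm C).start Γ.env n m e).time ≤ 200 + 20 * T + 20 * (T * n) := by
  have hB := Γ.hB
  have := hΓ.addr
  have h0 : State.empty.Within Γ.B Γ.W :=
    ⟨fun _ => Nat.zero_le _, Nat.zero_le _, Nat.zero_le _⟩
  have hw : (((State.empty.put 0 n).put 1 m).put 2 e).Within Γ.B Γ.W :=
    ((h0.put (by omega) (by omega)).put (by omega) hm).put (by omega) he'
  have hcore : (((State.empty.put 0 n).put 1 m).put 2 e).core =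
      ((State.empty.core.set 0 n).set 1 m).set 2 e := by
    rw [State.core_put (by omega), State.core_put (by omega), State.core_put (by omega)]
  obtain ⟨⟨h1, h2, h3, h4, h5⟩, h6, h7⟩ := initProg_run hΓ hS hT hC he
    (c := ((State.empty.core.set 0 n).set 1 m).set 2 e) (by simp) (by simp) (by simp) rfl _ hcore hw
  refine ⟨⟨h6, h1, h2, h3, h4, _, h5, LabInv.nil I _⟩, h7.trans ?_⟩
  exact (Nat.zero_add _).le

theorem step_spec {Γ : Setting} {C : ℕ} (hΓ : Room n m S T Γ) (hm : m ≤ Γ.W)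
    {I : Fin m → Clustering n} {X : ℕ → Fin m} {l : List (Triple n m)} {σ : State}
    (h : StreamInv Γ I X S T l σ) (x : Triple n m) (hx : x.sep = false ↔ (I x.j).r x.u x.v) :
    StreamInv Γ I X S T (l ++ [x]) ((algorithm C).step Γ.env σ x) ∧
      ((algorithm C).step Γ.env σ x).time ≤ σ.time + (20 + 120 * T) := by
  have hB := Γ.hB
  have := hΓ.addr
  have hu := x.u.2
  have hv := x.v.2
  have hj := x.j.2
  have hb : (if x.sep then 1 else 0) ≤ 1 := by split_ifs <;> simp
  have hw : ((((σ.put 3 x.u).put 4 x.v).put 5 x.j).put 6 (if x.sep then 1 else 0)).Within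
      Γ.B Γ.W :=
    (((h.within.put (by omega) (by omega)).put (by omega) (by omega)).put (by omega)
      (by omega)).put (by omega) (by omega)
  have hcore : ((((σ.put 3 x.u).put 4 x.v).put 5 x.j).put 6 (if x.sep then 1 else 0)).core =
      (((σ.core.set 3 x.u).set 4 x.v).set 5 x.j).set 6 (if x.sep then 1 else 0) := by
    rw [State.core_put (by omega), State.core_put (by omega), State.core_put (by omega),
      State.core_put (by omega)]
  obtain ⟨lab, hlab, hinv⟩ := h.rows
  obtain ⟨⟨h1, h2, h3, h4, h5⟩, h6, h7⟩ := updateProg_run hΓ (X := fun t => (X t : ℕ)) (j := x.j)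
    (c := (((σ.core.set 3 x.u).set 4 x.v).set 5 x.j).set 6 (if x.sep then 1 else 0))
    ((((h.regs.set _ (by decide)).set _ (by decide)).set _ (by decide)).set _ (by decide))
    ((((h.indices.set _ (by omega)).set _ (by omega)).set _ (by omega)).set _ (by omega))
    ((((hlab.set _ (by omega)).set _ (by omega)).set _ (by omega)).set _ (by omega))
    hu hv hb (by simp) (by simp) (by simp) (by simp) _ hcore hw
  exact ⟨⟨h6, h1, h2.trans h.arg, h3.trans h.out, h4, _, h5, hinv.step x hx⟩, h7⟩

theorem after_append (A : StreamAlg) (E : Env) (e : ℕ) (l : List (Triple n m)) (x : Triple n m) :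
    A.after E e (l ++ [x]) = A.step E (A.after E e l) x := by
  simp [StreamAlg.after]

theorem after_spec {Γ : Setting} {C e : ℕ} (hΓ : Room n m S T Γ) (hm : m ≤ Γ.W)
    {I : Fin m → Clustering n} {X : ℕ → Fin m}
    (h : StreamInv Γ I X S T [] ((algorithm C).start Γ.env n m e)) (l : List (Triple n m))
    (hl : ∀ x ∈ l, x.sep = false ↔ (I x.j).r x.u x.v) :
    StreamInv Γ I X S T l ((algorithm C).after Γ.env e l) := by
  induction l using List.reverseRecOn with
  | nil => exact h
  | append_singleton l x ih =>
    rw [after_append]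
    exact (step_spec hΓ hm (ih fun y hy => hl y (by simp [hy])) x (hl x (by simp))).1

theorem final_spec {Γ : Setting} {C e : ℕ} (hΓ : Room n m S T Γ) (hS : 0 < S)
    {I : Fin m → Clustering n} {X : ℕ → Fin m} {l : List (Triple n m)} {t₁ t₂ : ℕ}
    (h : StreamInv Γ I X S T l ((algorithm C).after Γ.env e l)) (hl : IsStream I l)
    (hlen : ∀ L ∈ candidates n S Γ.env (sampleLab I X), L.length = n)
    (hlt : ∀ L ∈ candidates n S Γ.env (sampleLab I X), ∀ x ∈ L, x < n)
    (hcls : ∀ t < S, Γ.env.cls.cost (clsArg n (sampleLab I X) t) ≤ t₁)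
    (hcor : ∀ q < S * (S * S), Γ.env.cor.cost (corArg n S (sampleLab I X) q) ≤ t₂) :
    ((algorithm C).final Γ.env e l).Within Γ.B Γ.W ∧
    ((algorithm C).final Γ.env e l).time ≤ ((algorithm C).after Γ.env e l).time +
      (100 + 20 * n + S * (100 + 260 * (T * (n * n)) + 70 * n + t₁) +
        S * (S * S) * (200 + 260 * (T * (n * n)) + 200 * (n * n) + 40 * n + t₂)) ∧
    ((algorithm C).final Γ.env e l).out ∈ candidates n S Γ.env (sampleLab I X) ∧
    ∀ L ∈ candidates n S Γ.env (sampleLab I X),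
      sampleCost n T (sampleLab I X) ((algorithm C).final Γ.env e l).out ≤
        sampleCost n T (sampleLab I X) L := by
  obtain ⟨lab, hlab, hinv⟩ := h.rows
  have hrows : Rows n T (sampleLab I X) ((algorithm C).after Γ.env e l).core :=
    hlab.congr_lab fun t _ u hu => hinv.eq_minLabel hl t hu
  obtain ⟨⟨h1, h2⟩, h3, h4⟩ := queryProg_run hΓ hS hlen hlt hcls hcor h.regs hrows h.arg h.out
    _ rfl h.within
  exact ⟨h3, h4, h1, h2⟩

/-! #### Bounds -/

/-- The size exceeds log₂ m by at most 1 ≤ log₂ m, and 2/log 2 < 3. -/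
theorem size_le_log (hm : 2 ≤ m) : (Nat.size m : ℝ) ≤ 3 * Real.log m := by
  have hmR : (2 : ℝ) ≤ m := by exact_mod_cast hm
  have h1 : 2 ^ (Nat.size m - 1) ≤ m := by
    have hpos : 0 < Nat.size m := Nat.size_pos.2 (by omega)
    exact Nat.lt_size.1 (by omega)
  have h2 : ((Nat.size m - 1 : ℕ) : ℝ) * Real.log 2 ≤ Real.log m := by
    rw [← Real.log_pow]
    refine Real.log_le_log (by positivity) ?_
    exact_mod_cast h1
  have h3 : (Nat.size m : ℝ) ≤ (Nat.size m - 1 : ℕ) + 1 := by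
    exact_mod_cast (by omega : Nat.size m ≤ Nat.size m - 1 + 1)
  have h4 : Real.log 2 ≤ Real.log m := Real.log_le_log (by norm_num) hmR
  have h5 := Real.log_two_gt_d9
  nlinarith

/-- The constant C is absorbed by C ≤ M^C with M = n + m + e. Thus all words stay below a power of M
whose exponent depends on C only, which means O(log M) bits. -/
theorem exists_room {C e : ℕ} (hC : 0 < C) (hn : 1 ≤ n) (hm : 2 ≤ m) (he : 2 ≤ e) (E : Env)
    (hS : S = C * Nat.size m) (hT : T = S * (e * e)) :
    ∃ Γ : Setting, Γ.env = E ∧ Γ.B = 64 + T + T * n + n + n ∧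
      Γ.W = (n + m + e) ^ (3 * C + 12) ∧ Room n m S T Γ ∧ C ≤ Γ.W ∧ e * e ≤ Γ.W ∧ e ≤ Γ.W ∧
      m ≤ Γ.W := by
  obtain ⟨M, hM⟩ : ∃ M, M = n + m + e := ⟨_, rfl⟩
  have hM5 : 5 ≤ M := by omega
  have hnM : n ≤ M := by omega
  have hmM : m ≤ M := by omega
  have heM : e ≤ M := by omega
  have hsize : Nat.size m ≤ M := (Nat.size_le.2 Nat.lt_two_pow_self).trans hmM
  have hCM : C ≤ M ^ C := Nat.lt_two_pow_self.le.trans (Nat.pow_le_pow_left (by omega) C)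
  have hSM : S ≤ M ^ (C + 1) := by rw [hS, pow_succ]; exact Nat.mul_le_mul hCM hsize
  have hTM : T ≤ M ^ (C + 3) := by
    rw [hT, show C + 3 = C + 1 + 2 by omega, pow_add, sq]
    exact Nat.mul_le_mul hSM (Nat.mul_le_mul heM heM)
  have hnn : n * n ≤ M ^ 2 := by rw [sq]; exact Nat.mul_le_mul hnM hnM
  have hpow : ∀ {i j : ℕ}, i ≤ j → M ^ i ≤ M ^ j := fun h => Nat.pow_le_pow_right (by omega) h
  have hTn : T * n ≤ M ^ (C + 4) := by
    rw [pow_succ]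
    exact Nat.mul_le_mul hTM hnM
  have hTnn : T * (n * n) ≤ M ^ (C + 5) := by
    rw [show C + 5 = C + 3 + 2 by omega, pow_add]
    exact Nat.mul_le_mul hTM hnn
  have hSSS : S * (S * S) ≤ M ^ (3 * C + 3) := by
    rw [show M ^ (3 * C + 3) = M ^ (C + 1) * (M ^ (C + 1) * M ^ (C + 1)) by ring]
    exact Nat.mul_le_mul hSM (Nat.mul_le_mul hSM hSM)
  have h64 : 64 ≤ M ^ 6 := (by norm_num : 64 ≤ 5 ^ 6).trans (Nat.pow_le_pow_left hM5 6)
  have hS0 : 0 < S := by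
    rw [hS]
    exact Nat.mul_pos hC (Nat.size_pos.2 (by omega))
  have hST : S ≤ T := by
    rw [hT]
    exact Nat.le_mul_of_pos_right _ (by positivity)
  -- The largest address is a sum of five terms of size at most M^(C+6), and M ≥ 5 absorbs their
  -- number.
  have hbig : 5 * M ^ (C + 6) ≤ M ^ (3 * C + 12) :=
    calc 5 * M ^ (C + 6) ≤ M * M ^ (C + 6) := Nat.mul_le_mul_right _ hM5
      _ = M ^ (C + 7) := by rw [pow_succ' M (C + 6)]
      _ ≤ M ^ (3 * C + 12) := hpow (by omega)
  have b1 : M ^ 6 ≤ M ^ (C + 6) := hpow (by omega)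
  have b2 : M ^ (C + 3) ≤ M ^ (C + 6) := hpow (by omega)
  have b3 : M ^ (C + 4) ≤ M ^ (C + 6) := hpow (by omega)
  have b4 : M ≤ M ^ (C + 6) := by simpa using hpow (show 1 ≤ C + 6 by omega)
  have b5 : M ^ (C + 5) ≤ M ^ (C + 6) := hpow (by omega)
  have b6 : M ^ 2 ≤ M ^ (C + 6) := hpow (by omega)
  have b7 : M ^ C ≤ M ^ (C + 6) := hpow (by omega)
  have b8 : M ^ (3 * C + 3) ≤ M ^ (3 * C + 12) := hpow (by omega)
  have hee : e * e ≤ M ^ 2 := by rw [sq]; exact Nat.mul_le_mul heM heM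
  rw [← hM]
  refine ⟨⟨E, 64 + T + T * n + n + n, M ^ (3 * C + 12), by omega⟩, rfl, rfl, rfl,
    ⟨by omega, by omega, rfl, ?_, ?_, ?_, ?_, hST⟩, ?_, ?_, ?_, ?_⟩ <;> dsimp only <;> omega

/-- All time bounds together. -/
theorem time_le {t₁ t₂ : ℕ} (hn : 1 ≤ n) (hS : 1 ≤ S) (hT : 1 ≤ T) :
    200 + 20 * T + 20 * (T * n) +
      (100 + 20 * n + S * (100 + 260 * (T * (n * n)) + 70 * n + t₁) +
        S * (S * S) * (200 + 260 * (T * (n * n)) + 200 * (n * n) + 40 * n + t₂)) ≤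
    1500 * (S ^ 3 * T * n ^ 2) + S * t₁ + S ^ 3 * t₂ := by
  have h1 : n ≤ n ^ 2 := by nlinarith
  have h2 : 1 ≤ n ^ 2 := Nat.one_le_pow _ _ hn
  have h3 : S ≤ S ^ 3 := Nat.le_self_pow (by norm_num) S
  have h4 : n ^ 2 ≤ T * n ^ 2 := Nat.le_mul_of_pos_left _ hT
  have h5 : T ≤ T * n ^ 2 := Nat.le_mul_of_pos_right _ h2
  have h6 : T * n ≤ T * n ^ 2 := Nat.mul_le_mul_left T h1
  have h7 : T * n ^ 2 ≤ S ^ 3 * (T * n ^ 2) := Nat.le_mul_of_pos_left _ (by omega)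
  have h8 : S * (100 + 260 * (T * (n * n)) + 70 * n) ≤ S ^ 3 * (430 * (T * n ^ 2)) := by
    refine Nat.mul_le_mul h3 ?_
    rw [← sq]
    omega
  have h9 : S * (S * S) * (200 + 260 * (T * (n * n)) + 200 * (n * n) + 40 * n) ≤
      S ^ 3 * (700 * (T * n ^ 2)) := by
    refine Nat.mul_le_mul (by rw [pow_succ, sq, mul_assoc]) ?_
    rw [← sq]
    omega
  have e1 : S * (100 + 260 * (T * (n * n)) + 70 * n + t₁) =
      S * (100 + 260 * (T * (n * n)) + 70 * n) + S * t₁ := Nat.mul_add _ _ _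
  have e2 : S * (S * S) * (200 + 260 * (T * (n * n)) + 200 * (n * n) + 40 * n + t₂) =
      S * (S * S) * (200 + 260 * (T * (n * n)) + 200 * (n * n) + 40 * n) + S ^ 3 * t₂ := by ring
  have e3 : S ^ 3 * (430 * (T * n ^ 2)) = 430 * (S ^ 3 * (T * n ^ 2)) := by ring
  have e4 : S ^ 3 * (700 * (T * n ^ 2)) = 700 * (S ^ 3 * (T * n ^ 2)) := by ring
  rw [e1, e2, mul_assoc (S ^ 3) T]
  omega

end FairConsensus

namespace FairConsensus

/-! ### Choice of the constants and assembly of the main theorem -/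

variable {n m : ℕ}

/-- The exponents 6 and 10 are those that the union bound of `measure_good_sample` requires. -/
theorem exists_sample_constant {p : ℝ} (hp0 : 0 < p) (hp1 : p ≤ 1) :
    ∃ C : ℕ, 0 < C ∧ (1 - p) ^ C ≤ (1 / 2 : ℝ) ^ 6 ∧
      Real.exp (-(1 / 16)) ^ C ≤ (1 / 2 : ℝ) ^ 10 := by
  have hexp : Real.exp (-(1 / 16)) < 1 := by
    rw [← Real.exp_zero]
    exact Real.exp_lt_exp.2 (by norm_num)
  obtain ⟨a, ha⟩ := exists_pow_lt_of_lt_one (show (0 : ℝ) < (1 / 2) ^ 6 by positivity)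
    (show 1 - p < 1 by linarith)
  obtain ⟨b, hb⟩ := exists_pow_lt_of_lt_one (show (0 : ℝ) < (1 / 2) ^ 10 by positivity) hexp
  refine ⟨a + b + 1, by omega, ?_, ?_⟩
  · exact (pow_le_pow_of_le_one (by linarith) (by linarith) (by omega)).trans ha.le
  · exact (pow_le_pow_of_le_one (Real.exp_pos _).le hexp.le (by omega)).trans hb.le

/-- The answers of the subroutines that are candidates. -/
theorem represents_of_mem_candidates {S : ℕ} {E : Env} {I : Fin m → Clustering n} {X : ℕ → Fin m}
    {cls : Fin m → Clustering n} {cor : Fin m → Fin m → Fin m → Clustering n}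
    (hcls : ∀ i, Represents (E.cls.answer (labelList (I i))) (cls i))
    (hcor : ∀ i j k,
      Represents (E.cor.answer (matrixWord (majority (I i) (I j) (I k)))) (cor i j k))
    {L : List ℕ} (hL : L ∈ candidates n S E (sampleLab I X)) :
    ∃ a : Fin m ⊕ Fin m × Fin m × Fin m,
      Represents L (Sum.elim cls (fun q => cor q.1 q.2.1 q.2.2) a) := by
  rcases hL with ⟨t, -, rfl⟩ | ⟨q, -, rfl⟩
  · exact ⟨Sum.inl (X t), hcls (X t)⟩
  · rw [corArg_eq]
    exact ⟨Sum.inr (X (q / S / S), X (q / S % S), X (q % S)), hcor _ _ _⟩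

theorem cls_mem_candidates {S t : ℕ} (ht : t < S) (E : Env) (I : Fin m → Clustering n)
    (X : ℕ → Fin m) :
    E.cls.answer (labelList (I (X t))) ∈ candidates n S E (sampleLab I X) :=
  Or.inl ⟨t, ht, rfl⟩

theorem cor_mem_candidates {S i j k : ℕ} (hi : i < S) (hj : j < S) (hk : k < S) (E : Env)
    (I : Fin m → Clustering n) (X : ℕ → Fin m) :
    E.cor.answer (matrixWord (majority (I (X i)) (I (X j)) (I (X k)))) ∈
      candidates n S E (sampleLab I X) := by
  have hS : 0 < S := by omega
  have h1 : (i * S + j) * S + k < S * (S * S) := by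
    rw [← mul_assoc]
    exact mul_add_lt (mul_add_lt hi hj) hk
  have e1 : ((i * S + j) * S + k) / S = i * S + j := by
    rw [mul_comm _ S, Nat.mul_add_div hS, Nat.div_eq_of_lt hk, add_zero]
  have e2 : ((i * S + j) * S + k) % S = k := by
    rw [mul_comm _ S, Nat.mul_add_mod, Nat.mod_eq_of_lt hk]
  have e3 : (i * S + j) / S = i := by
    rw [mul_comm _ S, Nat.mul_add_div hS, Nat.div_eq_of_lt hj, add_zero]
  have e4 : (i * S + j) % S = j := by
    rw [mul_comm _ S, Nat.mul_add_mod, Nat.mod_eq_of_lt hj]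
  refine Or.inr ⟨_, h1, ?_⟩
  rw [corArg_eq, e1, e2, e3, e4]

/-- If a good candidate exists and no much worse clustering looks better on the sample, then the
candidate that looks best is good. -/
theorem obj_le_of_sample {T : ℕ} {I : Fin m → Clustering n} {X : ℕ → Fin m} {ε r O : ℝ}
    (hε₀ : 0 < ε) (hε₁ : ε < 1) {L L' : List ℕ} {F F' : Clustering n} (hL : Represents L F)
    (hL' : Represents L' F') (hgood : (obj I F' : ℝ) ≤ r * O)
    (hle : sampleCost n T (sampleLab I X) L ≤ sampleCost n T (sampleLab I X) L')
    (hcmp : (1 + 2 * ε) * obj I F' < obj I F →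
      ∑ t ∈ Finset.range T, dist (I (X t)) F' < ∑ t ∈ Finset.range T, dist (I (X t)) F) :
    (obj I F : ℝ) ≤ (1 + ε) / (1 - ε) * r * O := by
  rw [sampleCost_eq I X hL, sampleCost_eq I X hL'] at hle
  have h1 : (obj I F : ℝ) ≤ (1 + 2 * ε) * obj I F' := by
    by_contra hcon
    have := hcmp (not_le.1 hcon)
    omega
  -- Indeed (1+2ε)(1−ε) = 1 + ε − 2ε².
  have h2 : 1 + 2 * ε ≤ (1 + ε) / (1 - ε) := by
    rw [le_div_iff₀ (by linarith)]
    nlinarith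
  calc (obj I F : ℝ) ≤ (1 + 2 * ε) * obj I F' := h1
    _ ≤ (1 + ε) / (1 - ε) * obj I F' := mul_le_mul_of_nonneg_right h2 (Nat.cast_nonneg _)
    _ ≤ (1 + ε) / (1 - ε) * (r * O) :=
        mul_le_mul_of_nonneg_left hgood (by linarith)
    _ = _ := by ring

/-- Real bounds for the numbers of samples. -/
theorem sample_bounds {C e : ℕ} {ε : ℝ} (hm : 2 ≤ m) (hε₀ : 0 < ε) (he : (e : ℝ) ≤ 2 * ε⁻¹) :
    ((C * Nat.size m : ℕ) : ℝ) ≤ 3 * C * Real.log m ∧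
      ((C * Nat.size m * (e * e) : ℕ) : ℝ) ≤ 12 * C * (ε⁻¹ ^ 2 * Real.log m) := by
  have h1 := size_le_log hm
  have hlog : 0 ≤ Real.log m := Real.log_natCast_nonneg m
  have h2 : ((C * Nat.size m : ℕ) : ℝ) ≤ 3 * C * Real.log m := by
    push_cast
    calc (C : ℝ) * Nat.size m ≤ C * (3 * Real.log m) :=
          mul_le_mul_of_nonneg_left h1 (Nat.cast_nonneg C)
      _ = _ := by ring
  have h3 : (e : ℝ) * e ≤ 2 * ε⁻¹ * (2 * ε⁻¹) := by
    have : 0 < ε⁻¹ := by positivity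
    exact mul_le_mul he he (Nat.cast_nonneg e) (by positivity)
  refine ⟨h2, ?_⟩
  rw [Nat.cast_mul, Nat.cast_mul e e]
  calc ((C * Nat.size m : ℕ) : ℝ) * (e * e) ≤ 3 * C * Real.log m * (2 * ε⁻¹ * (2 * ε⁻¹)) := by
        gcongr
    _ = _ := by ring

/-- The constant is governed by the leading term: 1500·3³·12 = 486000. -/
theorem total_time_le {C S T t₁ t₂ : ℕ} {a ℓ : ℝ} (hC : 0 < C) (hℓ : 0 ≤ ℓ)
    (hS : (S : ℝ) ≤ 3 * C * ℓ) (hT : (T : ℝ) ≤ 12 * C * (a ^ 2 * ℓ)) :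
    ((1500 * (S ^ 3 * T * n ^ 2) + S * t₁ + S ^ 3 * t₂ : ℕ) : ℝ) ≤
      500000 * (C : ℝ) ^ 4 * (a ^ 2 * (n : ℝ) ^ 2 * ℓ ^ 4 + t₁ * ℓ + t₂ * ℓ ^ 3) := by
  have hC1 : (1 : ℝ) ≤ C := by exact_mod_cast hC
  have h1 : (S : ℝ) ^ 3 ≤ (3 * C * ℓ) ^ 3 := pow_le_pow_left₀ (Nat.cast_nonneg S) hS 3
  have h2 : (S : ℝ) ^ 3 * T * n ^ 2 ≤ (3 * C * ℓ) ^ 3 * (12 * C * (a ^ 2 * ℓ)) * n ^ 2 := by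
    gcongr
  have h3 : (S : ℝ) * t₁ ≤ 3 * C * ℓ * t₁ := by gcongr
  have h4 : (S : ℝ) ^ 3 * t₂ ≤ (3 * C * ℓ) ^ 3 * t₂ := by gcongr
  have c1 : (C : ℝ) ≤ C ^ 4 := le_self_pow₀ hC1 (by norm_num)
  have c3 : (C : ℝ) ^ 3 ≤ C ^ 4 := pow_le_pow_right₀ hC1 (by norm_num)
  have c4 : (0 : ℝ) ≤ (C : ℝ) ^ 4 := by positivity
  have h5 : 3 * C * ℓ * t₁ ≤ 500000 * (C : ℝ) ^ 4 * (t₁ * ℓ) := by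
    calc 3 * C * ℓ * t₁ = 3 * C * (t₁ * ℓ) := by ring
      _ ≤ 500000 * (C : ℝ) ^ 4 * (t₁ * ℓ) :=
        mul_le_mul_of_nonneg_right (by linarith) (by positivity)
  have h6 : (3 * C * ℓ) ^ 3 * t₂ ≤ 500000 * (C : ℝ) ^ 4 * (t₂ * ℓ ^ 3) := by
    calc (3 * C * ℓ) ^ 3 * t₂ = 27 * (C : ℝ) ^ 3 * (t₂ * ℓ ^ 3) := by ring
      _ ≤ 500000 * (C : ℝ) ^ 4 * (t₂ * ℓ ^ 3) :=
        mul_le_mul_of_nonneg_right (by linarith) (by positivity)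
  have h7 : 1500 * ((3 * C * ℓ) ^ 3 * (12 * C * (a ^ 2 * ℓ)) * n ^ 2) ≤
      500000 * (C : ℝ) ^ 4 * (a ^ 2 * (n : ℝ) ^ 2 * ℓ ^ 4) := by
    calc 1500 * ((3 * C * ℓ) ^ 3 * (12 * C * (a ^ 2 * ℓ)) * n ^ 2)
        = 486000 * (C : ℝ) ^ 4 * (a ^ 2 * (n : ℝ) ^ 2 * ℓ ^ 4) := by ring
      _ ≤ 500000 * (C : ℝ) ^ 4 * (a ^ 2 * (n : ℝ) ^ 2 * ℓ ^ 4) :=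
        mul_le_mul_of_nonneg_right (by linarith) (by positivity)
  push_cast
  rw [mul_add, mul_add]
  linarith

end FairConsensus

open FairConsensus in
/-- The algorithm `A` and the constants `K`, `κ` depend only on `γ, η, α, β, c, s, g`. The accuracy
`ε` is handed to the machine as the word `⌈1/ε⌉`. -/
theorem mainTheorem4 (γ η α β c s g : ℝ) (hγ : 0 < γ) (hη : 0 < η) (hα : 0 < α)
    (hβ₀ : 0 < β) (hβ₁ : β < 1) (hc : 1 < c) (hs : 1 < s) (hg : s < g)
    (hsc : 0 < s * c - s - 2 * c) :
    ∃ (A : StreamAlg) (K : ℝ) (κ : ℕ),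
      ∀ (tcls tcor : ℕ → ℕ) (n m : ℕ) (_ : 1 ≤ n) (_ : 2 ≤ m) (P : Set (Fin n) → Prop)
        (Scls Scor : Subroutine) (_ : SolvesClosestFair P γ (tcls n) Scls)
        (_ : SolvesFairCor P η (tcor n) Scor) (ε : ℝ) (_ : 0 < ε) (_ : ε < 1)
        (I : Fin m → Clustering n) (l : List (Triple n m)) (_ : IsStream I l),
        -- success probability and approximation ratio
        ENNReal.ofReal (1 - 1 / (m : ℝ)) ≤
          coinMeasure {ω | ∃ F : Clustering n,
            Represents (A.final ⟨ω, Scls, Scor⟩ ⌈1 / ε⌉₊ l).out F ∧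
              IsApproxConsensus P ((1 + ε) / (1 - ε) * ratio γ η α β c s g) I F} ∧
        ∀ ω : Coins,
          -- running time before and after the pass over the stream
          (((A.start ⟨ω, Scls, Scor⟩ n m ⌈1 / ε⌉₊).time : ℝ) +
              ((A.final ⟨ω, Scls, Scor⟩ ⌈1 / ε⌉₊ l).time
                - (A.after ⟨ω, Scls, Scor⟩ ⌈1 / ε⌉₊ l).time) ≤
            K * (ε⁻¹ ^ 2 * (n : ℝ) ^ 2 * Real.log m ^ 4 + tcls n * Real.log m
              + tcor n * Real.log m ^ 3)) ∧
          -- time per triple of the stream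
          (∀ (l' : List (Triple n m)) (x : Triple n m), l' ++ [x] <+: l →
            ((A.after ⟨ω, Scls, Scor⟩ ⌈1 / ε⌉₊ (l' ++ [x])).time : ℝ)
                - (A.after ⟨ω, Scls, Scor⟩ ⌈1 / ε⌉₊ l').time ≤
              K * (ε⁻¹ ^ 2 * Real.log m)) ∧
          -- number of memory words, over the whole run
          ((A.final ⟨ω, Scls, Scor⟩ ⌈1 / ε⌉₊ l).space : ℝ) ≤
            K * (ε⁻¹ ^ 2 * n * Real.log m) ∧
          -- each memory word has `O(log (n + m + 1/ε))` bits
          (A.final ⟨ω, Scls, Scor⟩ ⌈1 / ε⌉₊ l).top ≤ (n + m + ⌈1 / ε⌉₊) ^ κ := by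
  have hp0 : 0 < min (1 / g) (1 / (2 * s)) :=
    lt_min (one_div_pos.2 (by linarith)) (one_div_pos.2 (by linarith))
  have hp1 : min (1 / g) (1 / (2 * s)) ≤ 1 :=
    (min_le_left _ _).trans ((div_le_one (by linarith)).2 (by linarith))
  obtain ⟨C, hC, hCp, hCe⟩ := exists_sample_constant hp0 hp1
  refine ⟨algorithm C, 500000 * (C : ℝ) ^ 4, 3 * C + 12, ?_⟩
  intro tcls tcor n m hn hm P Scls Scor hScls hScor ε hε₀ hε₁ I l hl
  obtain ⟨e, he⟩ : ∃ e, e = ⌈1 / ε⌉₊ := ⟨_, rfl⟩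
  rw [← he]
  have hinv : 1 < 1 / ε := one_lt_one_div hε₀ hε₁
  have he1 : 1 / ε ≤ e := he ▸ Nat.le_ceil _
  have he2 : 2 ≤ e := by
    have : (1 : ℝ) < e := hinv.trans_le he1
    exact_mod_cast this
  have heε : 1 ≤ e * ε := (div_le_iff₀ hε₀).1 he1
  have heinv : (e : ℝ) ≤ 2 * ε⁻¹ := by
    have := Nat.ceil_lt_add_one (show 0 ≤ 1 / ε by positivity)
    rw [← he] at this
    rw [one_div] at this hinv
    linarith
  have hm0 : 0 < m := by omega
  obtain ⟨S, hS⟩ : ∃ S, S = C * Nat.size m := ⟨_, rfl⟩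
  obtain ⟨T, hT⟩ : ∃ T, T = S * (e * e) := ⟨_, rfl⟩
  have hS0 : 0 < S := hS ▸ Nat.mul_pos hC (Nat.size_pos.2 hm0)
  have hT0 : 0 < T := hT ▸ Nat.mul_pos hS0 (Nat.mul_pos (by omega) (by omega))
  -- Subroutines are functions of their argument, so the answers for all single inputs and all
  -- triples are fixed before any draw. The union bound runs over these clusterings.
  choose cls hcls hcls' using fun i => (hScls (I i) _ (represents_labelList (I i))).2
  choose cor hcor hcor' using fun i j k => (hScor (majority (I i) (I j) (I k))).2
  have hrep : ∀ (ω : Coins) (L : List ℕ),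
      L ∈ candidates n S ⟨ω, Scls, Scor⟩ (sampleLab I (draw hm0 ω)) →
      ∃ a : Fin m ⊕ Fin m × Fin m × Fin m,
        Represents L (Sum.elim cls (fun q => cor q.1 q.2.1 q.2.2) a) :=
    fun ω L hL => represents_of_mem_candidates hcls hcor hL
  -- These guarantees hold for every outcome of the draws; only the quality of the best candidate is
  -- a matter of probability.
  have hrun : ∀ ω : Coins,
      ((algorithm C).start ⟨ω, Scls, Scor⟩ n m e).time ≤ 200 + 20 * T + 20 * (T * n) ∧
      (∀ (l' : List (Triple n m)) (x : Triple n m), l' ++ [x] <+: l →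
        ((algorithm C).after ⟨ω, Scls, Scor⟩ e (l' ++ [x])).time ≤
          ((algorithm C).after ⟨ω, Scls, Scor⟩ e l').time + (20 + 120 * T)) ∧
      ((algorithm C).final ⟨ω, Scls, Scor⟩ e l).Within (64 + T + T * n + n + n)
        ((n + m + e) ^ (3 * C + 12)) ∧
      ((algorithm C).final ⟨ω, Scls, Scor⟩ e l).time ≤
        ((algorithm C).after ⟨ω, Scls, Scor⟩ e l).time +
        (100 + 20 * n + S * (100 + 260 * (T * (n * n)) + 70 * n + tcls n) +
          S * (S * S) * (200 + 260 * (T * (n * n)) + 200 * (n * n) + 40 * n + tcor n)) ∧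
      ((algorithm C).final ⟨ω, Scls, Scor⟩ e l).out ∈
        candidates n S ⟨ω, Scls, Scor⟩ (sampleLab I (draw hm0 ω)) ∧
      ∀ L ∈ candidates n S ⟨ω, Scls, Scor⟩ (sampleLab I (draw hm0 ω)),
        sampleCost n T (sampleLab I (draw hm0 ω))
            ((algorithm C).final ⟨ω, Scls, Scor⟩ e l).out ≤
          sampleCost n T (sampleLab I (draw hm0 ω)) L := by
    intro ω
    obtain ⟨Γ, hE, hB, hW, hΓ, w1, w2, w3, w4⟩ := exists_room hC hn hm he2 ⟨ω, Scls, Scor⟩ hS hT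
    obtain ⟨h1, h2⟩ := start_spec hΓ hS hT w1 w2 w3 w4 I
    have h3 := fun l' hl' => after_spec hΓ w4 h1 l' hl'
    have h4 := final_spec hΓ hS0 (t₁ := tcls n) (t₂ := tcor n) (h3 l hl.1) hl
    have h5 : ∀ (l' : List (Triple n m)) (x : Triple n m), l' ++ [x] <+: l →
        ((algorithm C).after Γ.env e (l' ++ [x])).time ≤
          ((algorithm C).after Γ.env e l').time + (20 + 120 * T) := by
      intro l' x hpre
      rw [after_append]
      exact (step_spec hΓ w4 (h3 l' fun y hy => hl.1 y (hpre.subset (by simp [hy]))) x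
        (hl.1 x (hpre.subset (by simp)))).2
    rw [hE] at h2 h4 h5
    rw [hB, hW] at h4
    obtain ⟨h6, h7, h8, h9⟩ := h4
      (fun L hL => (hrep ω L hL).elim fun a ha => ha.1)
      (fun L hL => (hrep ω L hL).elim fun a ha => ha.2.1)
      (fun t _ => (hScls _ _ (represents_labelList (I (draw hm0 ω t)))).1)
      (fun q _ => by rw [corArg_eq]; exact (hScor _).1)
    exact ⟨h2, h5, h6, h7, h8, h9⟩
  obtain ⟨hSR, hTR⟩ := sample_bounds (C := C) hm hε₀ heinv
  rw [← hS] at hSR hTR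
  rw [← hT] at hTR
  have hlog : 0 ≤ Real.log m := Real.log_natCast_nonneg m
  have hCR : (1 : ℝ) ≤ C := by exact_mod_cast hC
  have hC4 : (C : ℝ) ≤ C ^ 4 := le_self_pow₀ hCR (by norm_num)
  constructor
  -- A fair clustering exists because the subroutine returns one, so there is an optimal one.
  · obtain ⟨N, hN, hNopt⟩ := exists_forall_le (IsFair P) (obj I) ⟨cls ⟨0, hm0⟩, (hcls' _).1⟩
    obtain ⟨𝒜, h𝒜, hfam⟩ := exists_family hγ hη hα hβ₀ hβ₁ hc hs hg hsc hm0 I hN cls hcls' cor hcor'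
    have hι : Fintype.card (Fin 3 × Fin m × Fin m) ≤ m ^ 4 := by
      simp only [Fintype.card_prod, Fintype.card_fin]
      calc 3 * (m * m) ≤ (m * m) * (m * m) := Nat.mul_le_mul_right _ (by nlinarith)
        _ = m ^ 4 := by ring
    have hκ : Fintype.card (Fin m ⊕ Fin m × Fin m × Fin m) ≤ m ^ 4 := by
      simp only [Fintype.card_sum, Fintype.card_prod, Fintype.card_fin]
      have h1 : m ≤ m * (m * m) := Nat.le_mul_of_pos_right _ (Nat.mul_pos hm0 hm0)
      calc m + m * (m * m) ≤ 2 * (m * (m * m)) := by omega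
        _ ≤ m * (m * (m * m)) := Nat.mul_le_mul_right _ hm
        _ = m ^ 4 := by ring
    refine (measure_good_sample hm hp1 hε₀ hε₁ heε hCp hCe hι hκ 𝒜 h𝒜 I
      (Sum.elim cls fun q => cor q.1 q.2.1 q.2.2)).trans (measure_mono ?_)
    rw [← hS, ← hT]
    rintro ω ⟨hhit, hcmp⟩
    obtain ⟨-, -, -, -, hout, hmin⟩ := hrun ω
    obtain ⟨a, ha⟩ := hrep ω _ hout
    have hfair : IsFair P (Sum.elim cls (fun q => cor q.1 q.2.1 q.2.2) a) := by
      rcases a with i | ⟨i, j, k⟩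
      · exact (hcls' i).1
      · exact (hcor' i j k).1
    refine ⟨_, ha, hfair, fun D hD => ?_⟩
    have hDN : obj I D = obj I N := le_antisymm (hD.2 N hN) (hNopt D hD.1)
    rw [hDN]
    -- Candidates are built from the first S draws only, so these have to meet the family; the
    -- comparison uses all T.
    have hX := hfam {i | ∃ t < S, draw hm0 ω t = i} fun q => by
      obtain ⟨t, ht, htq⟩ := hhit q
      exact ⟨_, ⟨t, ht, rfl⟩, htq⟩
    rcases hX with ⟨_, ⟨i, hi, rfl⟩, hgood⟩ |
      ⟨_, ⟨i, hi, rfl⟩, _, ⟨j, hj, rfl⟩, _, ⟨k, hk, rfl⟩, hgood⟩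
    · exact obj_le_of_sample hε₀ hε₁ ha (hcls _) hgood
        (hmin _ (cls_mem_candidates hi ⟨ω, Scls, Scor⟩ I _)) (hcmp a (Sum.inl _))
    · exact obj_le_of_sample hε₀ hε₁ ha (hcor _ _ _) hgood
        (hmin _ (cor_mem_candidates hi hj hk ⟨ω, Scls, Scor⟩ I _)) (hcmp a (Sum.inr (_, _, _)))
  · intro ω
    obtain ⟨hstart, hstep, hwithin, hfinal, -, -⟩ := hrun ω
    refine ⟨?_, ?_, ?_, hwithin.top_le⟩
    · have h1 := time_le (t₁ := tcls n) (t₂ := tcor n) hn hS0 hT0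
      refine le_trans ?_ (total_time_le hC hlog hSR hTR)
      have h2 : ((algorithm C).start ⟨ω, Scls, Scor⟩ n m e).time +
          ((algorithm C).final ⟨ω, Scls, Scor⟩ e l).time ≤
          1500 * (S ^ 3 * T * n ^ 2) + S * tcls n + S ^ 3 * tcor n +
            ((algorithm C).after ⟨ω, Scls, Scor⟩ e l).time := by omega
      have h3 : (((algorithm C).start ⟨ω, Scls, Scor⟩ n m e).time : ℝ) +
          ((algorithm C).final ⟨ω, Scls, Scor⟩ e l).time ≤
          ((1500 * (S ^ 3 * T * n ^ 2) + S * tcls n + S ^ 3 * tcor n : ℕ) : ℝ) +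
            ((algorithm C).after ⟨ω, Scls, Scor⟩ e l).time := by exact_mod_cast h2
      linarith
    · intro l' x hpre
      have h1 : (((algorithm C).after ⟨ω, Scls, Scor⟩ e (l' ++ [x])).time : ℝ) ≤
          ((algorithm C).after ⟨ω, Scls, Scor⟩ e l').time + 140 * T := by
        have := hstep l' x hpre
        exact_mod_cast (by omega : ((algorithm C).after ⟨ω, Scls, Scor⟩ e (l' ++ [x])).time ≤
          ((algorithm C).after ⟨ω, Scls, Scor⟩ e l').time + 140 * T)
      have h2 : 1680 * C * (ε⁻¹ ^ 2 * Real.log m) ≤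
          500000 * (C : ℝ) ^ 4 * (ε⁻¹ ^ 2 * Real.log m) :=
        mul_le_mul_of_nonneg_right (by linarith) (by positivity)
      linarith
    · have h1 : ((algorithm C).final ⟨ω, Scls, Scor⟩ e l).space ≤ 68 * (T * n) := by
        have h2 := hwithin.space_le
        have h3 : n ≤ T * n := Nat.le_mul_of_pos_left _ hT0
        have h4 : T ≤ T * n := Nat.le_mul_of_pos_right _ hn
        omega
      have h2 : (((algorithm C).final ⟨ω, Scls, Scor⟩ e l).space : ℝ) ≤ 68 * (T * n) := by
        exact_mod_cast h1
      have h3 : (T : ℝ) * n ≤ 12 * C * (ε⁻¹ ^ 2 * Real.log m) * n :=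
        mul_le_mul_of_nonneg_right hTR (Nat.cast_nonneg n)
      have h4 : 816 * C * (ε⁻¹ ^ 2 * n * Real.log m) ≤
          500000 * (C : ℝ) ^ 4 * (ε⁻¹ ^ 2 * n * Real.log m) :=
        mul_le_mul_of_nonneg_right (by linarith) (by positivity)
      linarith
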